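/- **Setting.** Let $T,\beta>0$, $I=(0,T)$, let $Q_1,Q_2\in\mathbb R^{n\times n}$ be symmetric positive semidefinite, $y_d\in L^2(I;\mathbb R^n)$, $y_d^T\in\mathbb R^n$, $f:[0,T]\times\mathbb R^n\to\mathbb R^n$ and $g:[0,T]\times\mathbb R^n\to\mathbb R^{n\times m}$. Let $W_T=H^1(I;\mathbb R^n)$ with norm $\|y\|_{W_T}=(\|y\|_{L^2}^2+\|\dot y\|_{L^2}^2)^{1/2}$, let $\imath:W_T\to C([0,T];\mathbb R^n)$ be the embedding, and put $$J_t(y,u)=\tfrac12\int_t^T\big(|Q_1(y(s)-y_d(s))|^2+\beta|u(s)|^2\big)\,ds+\tfrac12|Q_2(y(T)-y_d^T)|^2,\qquad J=J_0 .$$ For $t<T$ let $V^*(t,y_0)=\inf J_t(y,u)$ over all $y\in H^1(t,T;\mathbb R^n)$, $u\in L^2(t,T;\mathbb R^m)$ with $\dot y=f(\cdot,y)+g(\cdot,y)u$ a.e. and $y(t)=y_0$; let $V^*(T,y_0)=\frac12|Q_2(y_0-y_d^T)|^2$. Let $Y_0\subset\mathbb R^n$ be compact with positive Lebesgue measure,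 $\mathcal L$ the normalized Lebesgue measure on $Y_0$, $\omega\in L^\infty(Y_0)$ with $\omega\ge\delta$ a.e. for some $\delta>0$, and $\gamma_1,\gamma_2\ge0$. **Assumption 1.** (A.1) $f,g$ are $C^2$ on $[0,T]\times\mathbb R^n$, and their first and second derivatives in $y$ are Lipschitz in $y$ on compact sets, uniformly in $t\in[0,T]$. (A.2) For some $M>0$, with $\widehat M=M\|\imath\|$ and $B=\{y\in\mathbb R^n:|y|\le2\widehat M\}$, the function $V^*$ is finite and $C^2$ on $[0,T]\times B$, and its $y$-gradient and $y$-Hessian are Lipschitz in $y\in B$, uniformly in $t$. (A.3) Let $F^*(t,y)=-\frac1\beta g(t,y)^\top\partial_yV^*(t,y)$. For every $y_0\in Y_0$ there is exactly one $y\in W_T$ with $\dot y=f(\cdot,y)+g(\cdot,y)F^*(\cdot,y)$, $y(0)=y_0$, $\|y\|_{W_T}\le M$, and the pair $(y,F^*(\cdot,y))$ minimizes $J$ among all $(y,u)\in W_T\times L^2(I;\mathbb R^m)$ with $\dot y=f(\cdot,y)+g(\cdot,y)u$, $y(0)=y_0$. **Assumption 2.** Let $\varepsilon_0>0$. For each $0<\varepsilon\le\varepsilon_0$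 let $\mathcal R_\varepsilon$ be a finite-dimensional Hilbert space, $V^\varepsilon:\mathcal R_\varepsilon\times\mathbb R\times\mathbb R^n\to\mathbb R$, $(\theta,t,y)\mapsto V^\varepsilon_\theta(t,y)$, a $C^4$ function with $V^\varepsilon_\theta(T,y)=\frac12|Q_2(y-y_d^T)|^2$ for all $\theta,y$, and $\theta_\varepsilon\in\mathcal R_\varepsilon$ such that, with a constant independent of $\varepsilon$, $$\max_{t\in[0,T],\,y\in B}\Big(|V^\varepsilon_{\theta_\varepsilon}-V^*|+|\partial_y(V^\varepsilon_{\theta_\varepsilon}-V^*)|+\|\partial_{yy}(V^\varepsilon_{\theta_\varepsilon}-V^*)\|\Big)(t,y)\le c\,\varepsilon .$$ **Learning problem.** Let $F^\varepsilon_\theta(t,y)=-\frac1\beta g(t,y)^\top\partial_yV^\varepsilon_\theta(t,y)$, $\mathcal F^\varepsilon_\theta(y)(t)=F^\varepsilon_\theta(t,y(t))$, $\gamma_\varepsilon>0$, and for $y,p\in W_T$ $$J_\varepsilon(y,p,\theta)=J(y,\mathcal F^\varepsilon_\theta(y))+\int_0^T\tfrac{\gamma_1}2\big|V^\varepsilon_\theta(t,y(t))-J_t(y,\mathcal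 F^\varepsilon_\theta(y))\big|^2+\tfrac{\gamma_2}2\big|\partial_yV^\varepsilon_\theta(t,y(t))-p(t)\big|^2\,dt .$$ Problem $(\mathcal P_\varepsilon)$: minimize $$\int_{Y_0}\omega(y_0)J_\varepsilon(\mathbf y(y_0),\mathbf p(y_0),\theta)\,d\mathcal L(y_0)+\tfrac{\gamma_\varepsilon}2\|\theta\|^2_{\mathcal R_\varepsilon}$$ over $\mathbf y,\mathbf p\in C(Y_0;W_T)$, $\theta\in\mathcal R_\varepsilon$ with $\|\mathbf y(y_0)\|_{W_T}\le2M$ for all $y_0\in Y_0$, $\mathcal F^\varepsilon_\theta(\mathbf y)\in L^2(Y_0;L^2(I;\mathbb R^m))$ and, for $\mathcal L$-a.e. $y_0$, with $y=\mathbf y(y_0)$, $p=\mathbf p(y_0)$ and $u=\mathcal F^\varepsilon_\theta(y)$, for a.e. $t\in I$, $$\dot y=f(t,y)+g(t,y)u,\quad y(0)=y_0,$$ $$-\dot p=D_yf(t,y)^\top p+[D_yg(t,y)^\top u]\,p+Q_1^\top Q_1(y-y_d),\quad p(T)=Q_2^\top Q_2(y(T)-y_d^T),$$ where $[D_yg(t,y)^\top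 u]$ is the transpose of the derivative at $z=y$ of $z\mapsto g(t,z)u$ for fixed $u$. **Theorem.** Let Assumptions 1 and 2 hold and let $\gamma_\varepsilon\|\theta_\varepsilon\|^2_{\mathcal R_\varepsilon}=O(\varepsilon)$ as $\varepsilon\downarrow0$. Then there is a constant $c>0$ such that for all sufficiently small $\varepsilon>0$ and every optimal triple $(\mathbf y^*_\varepsilon,\mathbf p^*_\varepsilon,\theta^*_\varepsilon)$ of $(\mathcal P_\varepsilon)$ $$0\le\int_{Y_0}\omega(y_0)\big[J(\mathbf y^*_\varepsilon(y_0),\mathcal F^\varepsilon_{\theta^*_\varepsilon}(\mathbf y^*_\varepsilon(y_0)))-V^*(0,y_0)\big]\,d\mathcal L(y_0)\le c\,\varepsilon,$$ and, if $\gamma_1,\gamma_2>0$, also $$\int_{Y_0}\omega(y_0)\Big(\big\|V^\varepsilon_{\theta^*_\varepsilon}(\cdot,\mathbf y^*_\varepsilon(y_0))-J_\bullet(\mathbf y^*_\varepsilon(y_0),\mathcal F^\varepsilon_{\theta^*_\varepsilon}(\mathbf y^*_\varepsilon(y_0)))\big\|^2_{L^2(I)}+\big\|\partial_yV^\varepsilon_{\theta^*_\varepsilon}(\cdot,\mathbf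 y^*_\varepsilon(y_0))-\mathbf p^*_\varepsilon(y_0)\big\|^2_{L^2(I;\mathbb R^n)}\Big)\,d\mathcal L(y_0)\le c\,\varepsilon .$$ In both estimates the integrands are integrable over $Y_0$. -/

import Mathlib

open MeasureTheory Set Filter Topology
open scoped ContDiff

namespace FeedbackLearning

noncomputable section

/-- `ℝⁿ` with the Euclidean norm. -/
abbrev E (n : ℕ) := EuclideanSpace ℝ (Fin n)

/-- The Hilbert space `L²(a, b; ℝⁿ)`. -/
abbrev L2 (a b : ℝ) (n : ℕ) := Lp (E n) 2 (volume.restrict (Ioo a b))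

/-- `v` is the distributional derivative of `y` on `(a, b)`. -/
def IsWeakDeriv {n : ℕ} (a b : ℝ) (y v : ℝ → E n) : Prop :=
  ∀ φ : ℝ → ℝ, ContDiff ℝ ∞ φ → HasCompactSupport φ → tsupport φ ⊆ Ioo a b →
    ∫ t in Ioo a b, deriv φ t • y t = -∫ t in Ioo a b, φ t • v t

theorem integrable_test_smul {n : ℕ} {a b : ℝ} {ψ : ℝ → ℝ} (hψ : Continuous ψ)
    (hc : HasCompactSupport ψ) (v : L2 a b n) :
    Integrable (fun t => ψ t • v t) (volume.restrict (Ioo a b)) := by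
  obtain ⟨C, hC⟩ := hc.exists_bound_of_continuous hψ
  exact ((Lp.memLp v).integrable (by norm_num)).bdd_smul C hψ.aestronglyMeasurable
    (Eventually.of_forall hC)

theorem isWeakDeriv_congr {n : ℕ} {a b : ℝ} {y y' v v' : ℝ → E n}
    (hy : y =ᵐ[volume.restrict (Ioo a b)] y') (hv : v =ᵐ[volume.restrict (Ioo a b)] v')
    (h : IsWeakDeriv a b y v) : IsWeakDeriv a b y' v' := by
  intro φ h1 h2 h3
  have e1 : ∫ t in Ioo a b, deriv φ t • y' t = ∫ t in Ioo a b, deriv φ t • y t :=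
    integral_congr_ae (hy.mono fun t ht => by simp only [ht])
  have e2 : ∫ t in Ioo a b, φ t • v' t = ∫ t in Ioo a b, φ t • v t :=
    integral_congr_ae (hv.mono fun t ht => by simp only [ht])
  rw [e1, e2]
  exact h φ h1 h2 h3

/-- The Hilbert space `H¹(a, b; ℝⁿ)`: pairs `(y, v)` of elements of `L²(a, b; ℝⁿ)` such that `v` is
the distributional derivative of `y`, with norm `(‖y‖² + ‖v‖²)^{1/2}`. For `(a, b) = (0, T)` this
is `W_T`. -/
def H1 (a b : ℝ) (n : ℕ) : Submodule ℝ (WithLp 2 (L2 a b n × L2 a b n)) where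
  carrier := {w | IsWeakDeriv a b w.fst w.snd}
  zero_mem' := by
    refine isWeakDeriv_congr (Lp.coeFn_zero _ _ _).symm (Lp.coeFn_zero _ _ _).symm ?_
    intro φ _ _ _
    simp
  add_mem' := by
    intro w z hw hz
    refine isWeakDeriv_congr (Lp.coeFn_add w.fst z.fst).symm (Lp.coeFn_add w.snd z.snd).symm ?_
    intro φ h1 h2 h3
    have hd : Continuous (deriv φ) := h1.continuous_deriv (by norm_num)
    simp only [Pi.add_apply, smul_add]
    rw [integral_add (integrable_test_smul hd h2.deriv _) (integrable_test_smul hd h2.deriv _),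
      integral_add (integrable_test_smul h1.continuous h2 _)
        (integrable_test_smul h1.continuous h2 _), hw φ h1 h2 h3, hz φ h1 h2 h3]
    abel
  smul_mem' := by
    intro c w hw
    refine isWeakDeriv_congr (Lp.coeFn_smul c w.fst).symm (Lp.coeFn_smul c w.snd).symm ?_
    intro φ h1 h2 h3
    simp only [Pi.smul_apply, smul_comm _ c]
    rw [integral_smul, integral_smul, hw φ h1 h2 h3, smul_neg]

namespace H1

variable {a b : ℝ} {n : ℕ}

/-- The distributional derivative of an element of `H¹(a, b; ℝⁿ)`. -/
def weakDeriv (w : H1 a b n) (t : ℝ) : E n := w.1.snd t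

/-- The continuous representative of an element of `H¹(a, b; ℝⁿ)`, for `a < b`
(see `continuousOn_rep` and `rep_ae_eq`). -/
def rep (w : H1 a b n) (t : ℝ) : E n :=
  (b - a)⁻¹ • (∫ s in a..b, (w.1.fst s - ∫ r in a..s, w.1.snd r)) + ∫ s in a..t, w.1.snd s

end H1
theorem isWeakDeriv_primitive {n : ℕ} {a b : ℝ} (hab : a < b) (c : E n) {v : ℝ → E n}
    (hv : IntegrableOn v (Ioo a b)) :
    IsWeakDeriv a b (fun t => c + ∫ s in a..t, v s) v := by
  intro φ h1 h2 h3
  have hvi : IntervalIntegrable v volume a b :=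
    (intervalIntegrable_iff_integrableOn_Ioo_of_le hab.le).2 hv
  have hd : Continuous (deriv φ) := h1.continuous_deriv (by norm_num)
  have hφa : φ a = 0 := image_eq_zero_of_notMem_tsupport fun h => (h3 h).1.false
  have hφb : φ b = 0 := image_eq_zero_of_notMem_tsupport fun h => (h3 h).2.false
  have hcont : ContinuousOn (fun t => c + ∫ s in a..t, v s) (uIcc a b) :=
    continuousOn_const.add (intervalIntegral.continuousOn_primitive_interval' hvi left_mem_uIcc)
  have hI1 : IntervalIntegrable (fun t => deriv φ t • (c + ∫ s in a..t, v s)) volume a b :=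
    (hd.continuousOn.smul hcont).intervalIntegrable
  have hI2 : IntervalIntegrable (fun t => φ t • v t) volume a b :=
    hvi.continuousOn_smul h1.continuous.continuousOn
  rw [← integral_Ioc_eq_integral_Ioo, ← integral_Ioc_eq_integral_Ioo,
    ← intervalIntegral.integral_of_le hab.le, ← intervalIntegral.integral_of_le hab.le]
  ext i
  have hvc : ∀ t ∈ uIcc a b, (∫ s in a..t, v s) i = ∫ s in a..t, v s i := by
    intro t ht
    have := (EuclideanSpace.proj (𝕜 := ℝ) i : E n →L[ℝ] ℝ).intervalIntegral_comp_comm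
      (hvi.mono_set (uIcc_subset_uIcc_left ht))
    simpa using this.symm
  have hvii : IntervalIntegrable (fun s => v s i) volume a b := by
    exact ⟨(EuclideanSpace.proj (𝕜 := ℝ) i : E n →L[ℝ] ℝ).integrable_comp hvi.1,
      (EuclideanSpace.proj (𝕜 := ℝ) i : E n →L[ℝ] ℝ).integrable_comp hvi.2⟩
  have hac : AbsolutelyContinuousOnInterval (fun t => c i + ∫ s in a..t, v s i) a b :=
    (LipschitzOnWith.absolutelyContinuousOnInterval (K := 0)
      (LipschitzWith.const (c i)).lipschitzOnWith).add
      (hvii.absolutelyContinuousOnInterval_intervalIntegral left_mem_uIcc)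
  have key := AbsolutelyContinuousOnInterval.integral_deriv_mul_eq_sub (a := a) (b := b)
    (f := φ) (g := fun t => c i + ∫ s in a..t, v s i)
    ((h1.of_le (by norm_num)).contDiffOn.absolutelyContinuousOnInterval) hac
  rw [hφa, hφb] at key
  have hae : ∀ᵐ x, x ∈ uIoc a b →
      deriv φ x * (c i + ∫ s in a..x, v s i) +
        φ x * deriv (fun t => c i + ∫ s in a..t, v s i) x =
      (deriv φ x • (c + ∫ s in a..x, v s)) i + (φ x • v x) i := by
    filter_upwards [hvii.ae_hasDerivAt_integral] with x hx hxm
    have hxm' := uIoc_subset_uIcc hxm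
    have := ((hx hxm' a left_mem_uIcc).const_add (c i)).deriv
    rw [this]
    simp [hvc x hxm', mul_add]
  rw [intervalIntegral.integral_congr_ae hae] at key
  have p1 := (EuclideanSpace.proj (𝕜 := ℝ) i : E n →L[ℝ] ℝ).intervalIntegral_comp_comm hI1
  have p2 := (EuclideanSpace.proj (𝕜 := ℝ) i : E n →L[ℝ] ℝ).intervalIntegral_comp_comm hI2
  have q1 : IntervalIntegrable (fun x => (deriv φ x • (c + ∫ s in a..x, v s)) i)
      volume a b :=
    ⟨(EuclideanSpace.proj (𝕜 := ℝ) i : E n →L[ℝ] ℝ).integrable_comp hI1.1,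
      (EuclideanSpace.proj (𝕜 := ℝ) i : E n →L[ℝ] ℝ).integrable_comp hI1.2⟩
  have q2 : IntervalIntegrable (fun x => (φ x • v x) i) volume a b :=
    ⟨(EuclideanSpace.proj (𝕜 := ℝ) i : E n →L[ℝ] ℝ).integrable_comp hI2.1,
      (EuclideanSpace.proj (𝕜 := ℝ) i : E n →L[ℝ] ℝ).integrable_comp hI2.2⟩
  rw [intervalIntegral.integral_add q1 q2] at key
  change _ = (∫ x in a..b, deriv φ x • (c + ∫ s in a..x, v s)) i at p1
  change _ = (∫ x in a..b, φ x • v x) i at p2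
  rw [PiLp.neg_apply, ← p1, ← p2]
  change (∫ x in a..b, (deriv φ x • (c + ∫ s in a..x, v s)) i) = -∫ x in a..b, (φ x • v x) i
  linarith

theorem ae_eq_average_of_isWeakDeriv_zero {n : ℕ} {a b : ℝ} (hab : a < b) {u : ℝ → E n}
    (hu : IntegrableOn u (Ioo a b)) (h : IsWeakDeriv a b u 0) :
    u =ᵐ[volume.restrict (Ioo a b)] fun _ => (b - a)⁻¹ • ∫ s in a..b, u s := by
  let B : ContDiffBump ((a + b) / 2) :=
    ⟨(b - a) / 8, (b - a) / 4, by linarith, by linarith⟩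
  let η : ℝ → ℝ := B.normed volume
  have hη : ContDiff ℝ ∞ η := B.contDiff_normed
  have hηc : HasCompactSupport η := B.hasCompactSupport_normed
  have hηs : tsupport η ⊆ Ioo a b := by
    rw [B.tsupport_normed_eq, Real.closedBall_eq_Icc]
    intro x hx
    have h1 : (a + b) / 2 - (b - a) / 4 ≤ x := hx.1
    have h2 : x ≤ (a + b) / 2 + (b - a) / 4 := hx.2
    exact ⟨by linarith, by linarith⟩
  have hη1 : ∫ t, η t = 1 := B.integral_normed
  -- test functions with vanishing integral are derivatives of test functions
  have main : ∀ χ : ℝ → ℝ, ContDiff ℝ ∞ χ → HasCompactSupport χ → tsupport χ ⊆ Ioo a b →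
      ∫ t, χ t = 0 → ∫ t in Ioo a b, χ t • u t = 0 := by
    intro χ h1 h2 h3 h4
    rcases (tsupport χ).eq_empty_or_nonempty with he | hne
    · have : χ = 0 := tsupport_eq_empty_iff.1 he
      simp [this]
    have hK : IsCompact (tsupport χ) := h2
    obtain ⟨p, hp, hpm⟩ := hK.exists_isLeast hne
    obtain ⟨q, hq, hqm⟩ := hK.exists_isGreatest hne
    have hap : a < p := (h3 hp).1
    have hqb : q < b := (h3 hq).2
    have z1 : ∀ t, t < p → χ t = 0 := fun t ht =>
      image_eq_zero_of_notMem_tsupport fun hm => (hpm hm).not_gt ht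
    have z2 : ∀ t, q < t → χ t = 0 := fun t ht =>
      image_eq_zero_of_notMem_tsupport fun hm => (hqm hm).not_gt ht
    have hci : ∀ x y, IntervalIntegrable χ volume x y := fun x y =>
      h1.continuous.intervalIntegrable x y
    have hint : Integrable χ := h1.continuous.integrable_of_hasCompactSupport h2
    let φ : ℝ → ℝ := fun t => ∫ s in Iic t, χ s
    have hφe : ∀ t, φ t = φ a + ∫ s in a..t, χ s := fun t => by
      simp only [φ]
      rw [← intervalIntegral.integral_Iic_sub_Iic hint.integrableOn hint.integrableOn]
      ring
    have hφd : ∀ t, HasDerivAt φ (χ t) t := fun t => by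
      rw [funext hφe]
      exact (h1.continuous.integral_hasStrictDerivAt a t).hasDerivAt.const_add _
    have hφd' : deriv φ = χ := funext fun t => (hφd t).deriv
    have hφs : ContDiff ℝ ∞ φ := by
      rw [contDiff_infty_iff_deriv]
      exact ⟨fun t => (hφd t).differentiableAt, by rwa [hφd']⟩
    have hφz : tsupport φ ⊆ Icc p q := by
      refine closure_minimal ?_ isClosed_Icc
      intro t ht
      by_contra hn
      apply ht
      rcases lt_or_ge t p with hlt | hge
      · exact setIntegral_eq_zero_of_forall_eq_zero fun s hs => z1 s (lt_of_le_of_lt hs hlt)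
      · have hqt : q < t := not_le.1 fun hle => hn ⟨hge, hle⟩
        have := intervalIntegral.integral_Iic_add_Ioi (b := t) hint.integrableOn hint.integrableOn
        rw [h4, setIntegral_eq_zero_of_forall_eq_zero (t := Ioi t)
          fun s hs => z2 s (hqt.trans hs), add_zero] at this
        exact this
    have hφcs : HasCompactSupport φ :=
      HasCompactSupport.of_support_subset_isCompact isCompact_Icc (subset_closure.trans hφz)
    have := h φ hφs hφcs (hφz.trans fun x hx => ⟨hap.trans_le hx.1, hx.2.trans_lt hqb⟩)
    rw [hφd'] at this
    simpa using this
  set c : E n := ∫ t in Ioo a b, η t • u t with hc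
  have huloc : LocallyIntegrableOn (fun t => u t - c) (Ioo a b) :=
    (hu.sub (integrableOn_const (by simp))).locallyIntegrableOn
  have tint : ∀ ψ : ℝ → ℝ, ContDiff ℝ ∞ ψ → HasCompactSupport ψ →
      IntegrableOn (fun t => ψ t • u t) (Ioo a b) := by
    intro ψ h1 h2
    obtain ⟨C, hC⟩ := h2.exists_bound_of_continuous h1.continuous
    exact hu.bdd_smul C h1.continuous.aestronglyMeasurable (Eventually.of_forall hC)
  have hzero := isOpen_Ioo.ae_eq_zero_of_integral_contDiff_smul_eq_zero huloc (by
    intro ψ h1 h2 h3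
    have hψi : Integrable ψ := h1.continuous.integrable_of_hasCompactSupport h2
    have hηi : Integrable η := hη.continuous.integrable_of_hasCompactSupport hηc
    set k : ℝ := ∫ t, ψ t with hk
    have hχs : ContDiff ℝ ∞ fun t => k * η t := contDiff_const.mul hη
    have hχc : HasCompactSupport fun t => k * η t := hηc.mul_left
    have hχt : tsupport (fun t => k * η t) ⊆ Ioo a b :=
      (closure_mono (Function.support_mul_subset_right _ _)).trans hηs
    have m := main (fun t => ψ t - k * η t) (h1.sub hχs) (h2.sub hχc)
      ((tsupport_sub _ _).trans (union_subset h3 hχt)) (by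
        rw [integral_sub hψi (hηi.const_mul k), integral_const_mul, hη1]; simp [hk])
    simp only [sub_smul] at m
    rw [integral_sub (tint ψ h1 h2) (tint _ hχs hχc)] at m
    simp only [mul_smul] at m
    rw [integral_smul, ← hc] at m
    have e1 : ∫ x, ψ x • (u x - c) = ∫ x in Ioo a b, ψ x • (u x - c) := by
      rw [setIntegral_eq_integral_of_forall_compl_eq_zero]
      intro x hx
      rw [image_eq_zero_of_notMem_tsupport fun hm => hx (h3 hm), zero_smul]
    have e2 : ∫ x in Ioo a b, ψ x = k := by
      rw [hk, setIntegral_eq_integral_of_forall_compl_eq_zero]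
      intro x hx
      exact image_eq_zero_of_notMem_tsupport fun hm => hx (h3 hm)
    rw [e1]
    simp only [smul_sub]
    rw [integral_sub (tint ψ h1 h2) (hψi.integrableOn.smul_const c), integral_smul_const, e2]
    exact m)
  have huc : u =ᵐ[volume.restrict (Ioo a b)] fun _ => c := by
    rw [EventuallyEq, ae_restrict_iff' measurableSet_Ioo]
    filter_upwards [hzero] with x hx hm
    exact sub_eq_zero.1 (hx hm)
  have hav : (b - a)⁻¹ • ∫ s in a..b, u s = c := by
    rw [intervalIntegral.integral_of_le hab.le, integral_Ioc_eq_integral_Ioo,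
      integral_congr_ae huc]
    simp [hab.le, (sub_pos.2 hab).ne', smul_smul]
  rw [hav]
  exact huc

namespace H1

variable {a b : ℝ} {n : ℕ}

theorem intervalIntegrable_coe (hab : a < b) (w : L2 a b n) :
    IntervalIntegrable w volume a b :=
  (intervalIntegrable_iff_integrableOn_Ioo_of_le hab.le).2
    ((Lp.memLp w).integrable (by norm_num))

theorem continuousOn_rep (hab : a < b) (w : H1 a b n) : ContinuousOn (rep w) (Icc a b) := by
  rw [← uIcc_of_le hab.le]
  exact continuousOn_const.add (intervalIntegral.continuousOn_primitive_interval'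
    (intervalIntegrable_coe hab _) left_mem_uIcc)

theorem rep_ae_eq (hab : a < b) (w : H1 a b n) :
    rep w =ᵐ[volume.restrict (Ioo a b)] w.1.fst := by
  have hv := intervalIntegrable_coe hab w.1.snd
  have hvI : IntegrableOn w.1.snd (Ioo a b) := (Lp.memLp w.1.snd).integrable (by norm_num)
  have hyI : IntegrableOn w.1.fst (Ioo a b) := (Lp.memLp w.1.fst).integrable (by norm_num)
  have hPI : IntegrableOn (fun t => ∫ s in a..t, w.1.snd s) (Ioo a b) := by
    have : ContinuousOn (fun t => ∫ s in a..t, w.1.snd s) (Icc a b) := by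
      rw [← uIcc_of_le hab.le]
      exact intervalIntegral.continuousOn_primitive_interval' hv left_mem_uIcc
    exact this.integrableOn_Icc.mono_set Ioo_subset_Icc_self
  have hP := isWeakDeriv_primitive hab (0 : E n) hvI
  simp only [zero_add] at hP
  have hdiff : IsWeakDeriv a b (fun t => w.1.fst t - ∫ s in a..t, w.1.snd s) 0 := by
    intro φ h1 h2 h3
    obtain ⟨C, hC⟩ := h2.deriv.exists_bound_of_continuous (h1.continuous_deriv (by norm_num))
    have hm := (h1.continuous_deriv (by norm_num)).aestronglyMeasurable
      (μ := volume.restrict (Ioo a b))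
    have i1 : Integrable (fun t => deriv φ t • w.1.fst t) (volume.restrict (Ioo a b)) :=
      hyI.bdd_smul C hm (Eventually.of_forall hC)
    have i2 : Integrable (fun t => deriv φ t • ∫ s in a..t, w.1.snd s)
        (volume.restrict (Ioo a b)) := hPI.bdd_smul C hm (Eventually.of_forall hC)
    simp only [smul_sub]
    rw [integral_sub i1 i2, w.2 φ h1 h2 h3, hP φ h1 h2 h3]
    simp
  filter_upwards [ae_eq_average_of_isWeakDeriv_zero hab (hyI.sub hPI) hdiff] with t ht
  simp only [Pi.sub_apply] at ht
  simp only [rep]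
  rw [← ht, sub_add_cancel]

theorem average_eq (hab : a < b) (w : H1 a b n) :
    rep w a = (b - a)⁻¹ • (∫ s in a..b, w.1.fst s) -
      (b - a)⁻¹ • ∫ s in a..b, ∫ r in a..s, w.1.snd r := by
  have hP : IntervalIntegrable (fun s => ∫ r in a..s, w.1.snd r) volume a b :=
    (intervalIntegral.continuousOn_primitive_interval'
      (intervalIntegrable_coe hab w.1.snd) left_mem_uIcc).intervalIntegrable
  rw [rep, intervalIntegral.integral_sub (intervalIntegrable_coe hab w.1.fst) hP, smul_sub]
  simp

theorem rep_eq (w : H1 a b n) (t : ℝ) : rep w t = rep w a + ∫ s in a..t, w.1.snd s := by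
  simp [rep]

theorem integral_coe_add (hab : a < b) (v w : L2 a b n) {t : ℝ} (ht : t ∈ Icc a b) :
    ∫ s in a..t, (v + w : L2 a b n) s = (∫ s in a..t, v s) + ∫ s in a..t, w s := by
  have hsub : uIcc a t ⊆ uIcc a b := by
    rw [uIcc_of_le ht.1, uIcc_of_le hab.le]; exact Icc_subset_Icc_right ht.2
  rw [← intervalIntegral.integral_add ((intervalIntegrable_coe hab v).mono_set hsub)
    ((intervalIntegrable_coe hab w).mono_set hsub), intervalIntegral.integral_of_le ht.1,
    intervalIntegral.integral_of_le ht.1, integral_Ioc_eq_integral_Ioo,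
    integral_Ioc_eq_integral_Ioo]
  exact integral_congr_ae (ae_restrict_of_ae_restrict_of_subset (Ioo_subset_Ioo_right ht.2)
    (Lp.coeFn_add v w))

theorem integral_coe_smul (c : ℝ) (v : L2 a b n) {t : ℝ} (ht : t ∈ Icc a b) :
    ∫ s in a..t, (c • v : L2 a b n) s = c • ∫ s in a..t, v s := by
  rw [← intervalIntegral.integral_smul, intervalIntegral.integral_of_le ht.1,
    intervalIntegral.integral_of_le ht.1, integral_Ioc_eq_integral_Ioo,
    integral_Ioc_eq_integral_Ioo]
  exact integral_congr_ae (ae_restrict_of_ae_restrict_of_subset (Ioo_subset_Ioo_right ht.2)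
    (Lp.coeFn_smul c v))

theorem rep_add (hab : a < b) (w z : H1 a b n) {t : ℝ} (ht : t ∈ Icc a b) :
    rep (w + z) t = rep w t + rep z t := by
  have hb : b ∈ Icc a b := right_mem_Icc.2 hab.le
  have hc : ∀ v : L2 a b n, IntervalIntegrable (fun s => ∫ r in a..s, v r) volume a b := fun v =>
    (intervalIntegral.continuousOn_primitive_interval'
      (intervalIntegrable_coe hab v) left_mem_uIcc).intervalIntegrable
  have e : ∫ s in a..b, ∫ r in a..s, (w.1.snd + z.1.snd : L2 a b n) r =
      (∫ s in a..b, ∫ r in a..s, w.1.snd r) + ∫ s in a..b, ∫ r in a..s, z.1.snd r := by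
    rw [← intervalIntegral.integral_add (hc _) (hc _)]
    refine intervalIntegral.integral_congr fun s hs => ?_
    rw [uIcc_of_le hab.le] at hs
    exact integral_coe_add hab _ _ hs
  have e1 : (w + z).1.fst = w.1.fst + z.1.fst := rfl
  have e2 : (w + z).1.snd = w.1.snd + z.1.snd := rfl
  rw [rep_eq, rep_eq w, rep_eq z, average_eq hab, average_eq hab, average_eq hab, e1, e2,
    integral_coe_add hab _ _ ht, integral_coe_add hab _ _ hb, e]
  module

theorem rep_smul (hab : a < b) (c : ℝ) (w : H1 a b n) {t : ℝ} (ht : t ∈ Icc a b) :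
    rep (c • w) t = c • rep w t := by
  have hb : b ∈ Icc a b := right_mem_Icc.2 hab.le
  have e : ∫ s in a..b, ∫ r in a..s, (c • w.1.snd : L2 a b n) r =
      c • ∫ s in a..b, ∫ r in a..s, w.1.snd r := by
    rw [← intervalIntegral.integral_smul]
    refine intervalIntegral.integral_congr fun s hs => ?_
    rw [uIcc_of_le hab.le] at hs
    exact integral_coe_smul c _ hs
  have e1 : (c • w).1.fst = c • w.1.fst := rfl
  have e2 : (c • w).1.snd = c • w.1.snd := rfl
  rw [rep_eq, rep_eq w, average_eq hab, average_eq hab, e1, e2,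
    integral_coe_smul c _ ht, integral_coe_smul c _ hb, e]
  module

theorem exists_norm_integral_le :
    ∃ C : ℝ, 0 ≤ C ∧ ∀ (v : L2 a b n), ∀ t ∈ Icc a b, ‖∫ s in a..t, v s‖ ≤ C * ‖v‖ := by
  refine ⟨(volume (Ioo a b) ^ (1 / 2 : ℝ)).toReal, ENNReal.toReal_nonneg, fun v t ht => ?_⟩
  have hv : MemLp v 2 (volume.restrict (Ioo a b)) := Lp.memLp v
  have hvi : Integrable v (volume.restrict (Ioo a b)) := hv.integrable (by norm_num)
  have h1 := eLpNorm_le_eLpNorm_mul_rpow_measure_univ (p := 1) (q := 2) (by norm_num) hv.1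
  rw [Measure.restrict_apply_univ] at h1
  have hfin : (volume (Ioo a b)) ^ (1 / 2 : ℝ) ≠ ⊤ := by simp
  have h2 : ∫ s in Ioo a b, ‖v s‖ ≤ (volume (Ioo a b) ^ (1 / 2 : ℝ)).toReal * ‖v‖ := by
    rw [integral_norm_eq_lintegral_enorm hv.1, ← eLpNorm_one_eq_lintegral_enorm, Lp.norm_def,
      mul_comm, ← ENNReal.toReal_mul]
    refine ENNReal.toReal_mono (ENNReal.mul_ne_top hv.2.ne hfin) ?_
    convert h1 using 3
    norm_num
  refine le_trans ?_ h2
  rw [intervalIntegral.integral_of_le ht.1, integral_Ioc_eq_integral_Ioo]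
  exact (norm_integral_le_integral_norm _).trans
    (setIntegral_mono_set hvi.norm (ae_of_all _ fun _ => norm_nonneg _)
      (Ioo_subset_Ioo_right ht.2).eventuallyLE)

theorem exists_norm_rep_le (hab : a < b) :
    ∃ C : ℝ, ∀ (w : H1 a b n), ∀ t ∈ Icc a b, ‖rep w t‖ ≤ C * ‖w‖ := by
  obtain ⟨C, hC0, hC⟩ := exists_norm_integral_le (a := a) (b := b) (n := n)
  have hpos : 0 < b - a := sub_pos.2 hab
  refine ⟨(b - a)⁻¹ * C + C + C, fun w t ht => ?_⟩
  have f1 : ‖w.1.fst‖ ≤ ‖w‖ := WithLp.norm_fst_le _ w.1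
  have f2 : ‖w.1.snd‖ ≤ ‖w‖ := WithLp.norm_snd_le _ w.1
  have g1 : ‖∫ s in a..b, w.1.fst s‖ ≤ C * ‖w‖ :=
    (hC _ b (right_mem_Icc.2 hab.le)).trans (by gcongr)
  have g2 : ∀ s ∈ Icc a b, ‖∫ r in a..s, w.1.snd r‖ ≤ C * ‖w‖ := fun s hs =>
    (hC _ s hs).trans (by gcongr)
  have g3 : ‖∫ s in a..b, ∫ r in a..s, w.1.snd r‖ ≤ C * ‖w‖ * |b - a| :=
    intervalIntegral.norm_integral_le_of_norm_le_const fun s hs => by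
      rw [uIoc_of_le hab.le] at hs
      exact g2 s ⟨hs.1.le, hs.2⟩
  rw [rep_eq, average_eq hab]
  refine (norm_add_le _ _).trans ?_
  refine (add_le_add (norm_sub_le _ _) (g2 t ht)).trans ?_
  rw [norm_smul, norm_smul, norm_inv, Real.norm_of_nonneg hpos.le]
  have k1 : (b - a)⁻¹ * ‖∫ s in a..b, w.1.fst s‖ ≤ (b - a)⁻¹ * (C * ‖w‖) := by gcongr
  have k2 : (b - a)⁻¹ * ‖∫ s in a..b, ∫ r in a..s, w.1.snd r‖ ≤ C * ‖w‖ := by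
    rw [abs_of_pos hpos] at g3
    calc _ ≤ (b - a)⁻¹ * (C * ‖w‖ * (b - a)) := by gcongr
      _ = C * ‖w‖ := by field_simp
  linarith

/-- The embedding of `H¹(a, b; ℝⁿ)` into `C([a, b]; ℝⁿ)`. -/
def toC (hab : a < b) : H1 a b n →L[ℝ] C(Icc a b, E n) :=
  LinearMap.mkContinuousOfExistsBound
    { toFun := fun w => ⟨fun t => rep w t, (continuousOn_rep hab w).domRestrict⟩
      map_add' := fun w z => ContinuousMap.ext fun t => rep_add hab w z t.2
      map_smul' := fun c w => ContinuousMap.ext fun t => rep_smul hab c w t.2 }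
    (by
      obtain ⟨C, hC⟩ := exists_norm_rep_le (n := n) hab
      have hm : a ∈ Icc a b := left_mem_Icc.2 hab.le
      refine ⟨C, fun w => (ContinuousMap.norm_le _
        ((norm_nonneg _).trans (hC w a hm))).2 fun t => hC w t t.2⟩)

end H1
/-- The data of the optimal control problem: horizon `T`, dynamics `ẏ = f(t, y) + g(t, y) u`,
symmetric positive semidefinite weights `Q₁`, `Q₂`, control cost `β`, desired state `yd` and
desired terminal state `ydT`. -/
structure ControlProblem (n m : ℕ) where
  T : ℝ
  T_pos : 0 < T
  f : ℝ → E n → E n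
  g : ℝ → E n → E m →L[ℝ] E n
  Q₁ : E n →L[ℝ] E n
  Q₁_pos : Q₁.IsPositive
  Q₂ : E n →L[ℝ] E n
  Q₂_pos : Q₂.IsPositive
  β : ℝ
  β_pos : 0 < β
  yd : ℝ → E n
  yd_memLp : MemLp yd 2 (volume.restrict (Ioo 0 T))
  ydT : E n

namespace ControlProblem

variable {n m : ℕ} (P : ControlProblem n m)

/-- The space `W_T`. -/
abbrev W : Type := H1 0 P.T n

/-- The cost `J_t(y, u)` on the interval `(t, T)`; the full cost is `J = J_0`. -/
def cost (t : ℝ) (y : ℝ → E n) (u : ℝ → E m) : ℝ :=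
  1 / 2 * (∫ s in Ioo t P.T, (‖P.Q₁ (y s - P.yd s)‖ ^ 2 + P.β * ‖u s‖ ^ 2)) +
    1 / 2 * ‖P.Q₂ (y P.T - P.ydT)‖ ^ 2

/-- `(y, u) ∈ H¹(t, T; ℝⁿ) × L²(t, T; ℝᵐ)` solves `ẏ = f(y) + g(y) u`, `y(t) = y₀`. -/
def IsAdmissible (t : ℝ) (y₀ : E n) (y : H1 t P.T n) (u : ℝ → E m) : Prop :=
  MemLp u 2 (volume.restrict (Ioo t P.T)) ∧
    (∀ᵐ s ∂(volume.restrict (Ioo t P.T)),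
      H1.weakDeriv y s = P.f s (H1.rep y s) + P.g s (H1.rep y s) (u s)) ∧
    H1.rep y t = y₀

/-- The set of costs of all admissible pairs. -/
def costSet (t : ℝ) (y₀ : E n) : Set ℝ :=
  {j | ∃ (y : H1 t P.T n) (u : ℝ → E m), P.IsAdmissible t y₀ y u ∧ j = P.cost t (H1.rep y) u}

open Classical in
/-- The value function `V*(t, y₀)`, including its terminal values at `t = T`. -/
def valueFunction (t : ℝ) (y₀ : E n) : ℝ :=
  if t < P.T then sInf (P.costSet t y₀) else 1 / 2 * ‖P.Q₂ (y₀ - P.ydT)‖ ^ 2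

/-- `(y, u)` is a minimizing pair of the open loop problem on `(0, T)` with initial value `y₀`. -/
def IsOptimalPair (y₀ : E n) (y : P.W) (u : ℝ → E m) : Prop :=
  P.IsAdmissible 0 y₀ y u ∧
    ∀ (z : P.W) (w : ℝ → E m), P.IsAdmissible 0 y₀ z w →
      P.cost 0 (H1.rep y) u ≤ P.cost 0 (H1.rep z) w

/-- The feedback law `-(1/β) g(t, y)ᵀ q(t, y)` belonging to a gradient field `q`. -/
def feedback (q : ℝ → E n → E n) (t : ℝ) (y : E n) : E m :=
  -(1 / P.β) • ContinuousLinearMap.adjoint (P.g t y) (q t y)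

/-- `y ∈ W_T` solves the closed loop equation `ẏ = f(y) + g(y) F(y)`, `y(0) = y₀`. -/
def IsClosedLoop (F : ℝ → E n → E m) (y₀ : E n) (y : P.W) : Prop :=
  (∀ᵐ s ∂(volume.restrict (Ioo 0 P.T)),
    H1.weakDeriv y s = P.f s (H1.rep y s) + P.g s (H1.rep y s) (F s (H1.rep y s))) ∧
  H1.rep y 0 = y₀

/-- `p ∈ W_T` solves the adjoint equation
`-ṗ = D_y f(y)ᵀ p + [D_y g(y)ᵀ F(y)] p + Q₁ᵀ Q₁ (y - y_d)`, `p(T) = Q₂ᵀ Q₂ (y(T) - y_d^T)`.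
The matrix in brackets is the transpose of the derivative of `z ↦ g(t, z) u` at `z = y(t)` for the
fixed vector `u = F(t, y(t))`. -/
def IsAdjoint (F : ℝ → E n → E m) (y p : P.W) : Prop :=
  (∀ᵐ s ∂(volume.restrict (Ioo 0 P.T)),
    -H1.weakDeriv p s =
      ContinuousLinearMap.adjoint (fderiv ℝ (P.f s) (H1.rep y s)) (H1.rep p s) +
      ContinuousLinearMap.adjoint
        (fderiv ℝ (fun z => P.g s z (F s (H1.rep y s))) (H1.rep y s)) (H1.rep p s) +
      ContinuousLinearMap.adjoint P.Q₁ (P.Q₁ (H1.rep y s - P.yd s))) ∧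
  H1.rep p P.T = ContinuousLinearMap.adjoint P.Q₂ (P.Q₂ (H1.rep y P.T - P.ydT))

/-- The constant `M̂ = M ‖ι‖`, with `ι` the embedding of `W_T` into `C([0, T]; ℝⁿ)`. -/
def Mhat (M : ℝ) : ℝ := M * ‖H1.toC (n := n) P.T_pos‖

/-- The closed ball of radius `2 M̂` in `ℝⁿ`. -/
def stateBall (M : ℝ) : Set (E n) := Metric.closedBall 0 (2 * P.Mhat M)

/-- The `y`-gradient of `h` on the closed ball of radius `2 M̂`. -/
def gradBall (M : ℝ) (h : ℝ → E n → ℝ) (t : ℝ) (y : E n) : E n :=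
  gradientWithin (h t) (P.stateBall M) y

/-- The `y`-Hessian of `h` on the closed ball of radius `2 M̂`. -/
def hessBall (M : ℝ) (h : ℝ → E n → ℝ) (t : ℝ) (y : E n) : E n →L[ℝ] E n :=
  fderivWithin ℝ (P.gradBall M h t) (P.stateBall M) y

/-- The optimal feedback law `F* = -(1/β) gᵀ ∂_y V*`. -/
def optimalFeedback (M : ℝ) : ℝ → E n → E m :=
  P.feedback (P.gradBall M P.valueFunction)

/-- The dynamics `f`, `g` are `C²` on `[0, T] × ℝⁿ`, and their first and second derivatives in `y`
are Lipschitz on compact sets, uniformly in time. -/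
structure SmoothDynamics : Prop where
  f_contDiff : ContDiffOn ℝ 2 (fun q : ℝ × E n => P.f q.1 q.2) (Icc 0 P.T ×ˢ univ)
  g_contDiff : ContDiffOn ℝ 2 (fun q : ℝ × E n => P.g q.1 q.2) (Icc 0 P.T ×ˢ univ)
  f_lipschitz : ∀ K : Set (E n), IsCompact K → ∃ L, ∀ t ∈ Icc 0 P.T,
    LipschitzOnWith L (fderiv ℝ (P.f t)) K ∧ LipschitzOnWith L (iteratedFDeriv ℝ 2 (P.f t)) K
  g_lipschitz : ∀ K : Set (E n), IsCompact K → ∃ L, ∀ t ∈ Icc 0 P.T,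
    LipschitzOnWith L (fderiv ℝ (P.g t)) K ∧ LipschitzOnWith L (iteratedFDeriv ℝ 2 (P.g t)) K

/-- The value function is finite and `C²` on `[0, T]` times the closed ball of radius `2 M̂`, with
`y`-gradient and `y`-Hessian Lipschitz in `y`, uniformly in time. -/
structure SmoothValue (M : ℝ) : Prop where
  M_pos : 0 < M
  finite : ∀ t ∈ Ico 0 P.T, ∀ y ∈ P.stateBall M, (P.costSet t y).Nonempty
  contDiff : ContDiffOn ℝ 2 (fun q : ℝ × E n => P.valueFunction q.1 q.2)
    (Icc 0 P.T ×ˢ P.stateBall M)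
  lipschitz : ∃ L, ∀ t ∈ Icc 0 P.T,
    LipschitzOnWith L (P.gradBall M P.valueFunction t) (P.stateBall M) ∧
    LipschitzOnWith L (P.hessBall M P.valueFunction t) (P.stateBall M)

/-- For each `y₀ ∈ Y₀` the closed loop system with `F*` has a unique solution in the ball of radius
`M` of `W_T`, and it is optimal for the open loop problem. -/
def OptimalClosedLoop (Y₀ : Set (E n)) (M : ℝ) : Prop :=
  ∀ y₀ ∈ Y₀, ∃ y : P.W,
    (P.IsClosedLoop (P.optimalFeedback M) y₀ y ∧ ‖y‖ ≤ M) ∧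
    (∀ z : P.W, P.IsClosedLoop (P.optimalFeedback M) y₀ z → ‖z‖ ≤ M → z = y) ∧
    P.IsOptimalPair y₀ y (fun t => P.optimalFeedback M t (H1.rep y t))

/-- The approximating family `V^ε_θ`, `0 < ε ≤ ε₀`, is `C⁴`, has the terminal values of the value
function, and approximates it for `θ = θ_ε` up to second `y`-derivatives with an error `O(ε)`. -/
structure ApproximatingFamily (M ε₀ : ℝ) {R : ℝ → Type*} [∀ ε, NormedAddCommGroup (R ε)]
    [∀ ε, InnerProductSpace ℝ (R ε)] (V : ∀ ε, R ε → ℝ → E n → ℝ) (θ : ∀ ε, R ε) : Prop where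
  contDiff : ∀ ε ∈ Ioc 0 ε₀, ContDiff ℝ 4 (fun q : R ε × ℝ × E n => V ε q.1 q.2.1 q.2.2)
  terminal : ∀ ε ∈ Ioc 0 ε₀, ∀ (ϑ : R ε) (y : E n),
    V ε ϑ P.T y = 1 / 2 * ‖P.Q₂ (y - P.ydT)‖ ^ 2
  approx : ∃ c > 0, ∀ ε ∈ Ioc 0 ε₀, ∀ t ∈ Icc 0 P.T, ∀ y ∈ P.stateBall M,
    |V ε (θ ε) t y - P.valueFunction t y| +
      ‖P.gradBall M (fun s z => V ε (θ ε) s z - P.valueFunction s z) t y‖ +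
      ‖P.hessBall M (fun s z => V ε (θ ε) s z - P.valueFunction s z) t y‖ ≤ c * ε

/-- The feedback law `F_V = -(1/β) gᵀ ∂_y V` of an approximate value function `V`. -/
def approxFeedback (V : ℝ → E n → ℝ) : ℝ → E n → E m :=
  P.feedback (fun t y => gradient (V t) y)

/-- The control `t ↦ F_V(t, y(t))`. -/
def approxControl (V : ℝ → E n → ℝ) (y : P.W) (t : ℝ) : E m :=
  P.approxFeedback V t (H1.rep y t)

/-- The squared `L²(0, T)` misfit between `V(t, y(t))` and the cost-to-go `J_t(y, F_V(y))`. -/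
def valueMisfit (V : ℝ → E n → ℝ) (y : P.W) : ℝ :=
  ∫ t in Ioo 0 P.T, |V t (H1.rep y t) - P.cost t (H1.rep y) (P.approxControl V y)| ^ 2

/-- The squared `L²(0, T; ℝⁿ)` misfit between `∂_y V(t, y(t))` and `p(t)`. -/
def gradientMisfit (V : ℝ → E n → ℝ) (y p : P.W) : ℝ :=
  ∫ t in Ioo 0 P.T, ‖gradient (V t) (H1.rep y t) - H1.rep p t‖ ^ 2

/-- The augmented cost for a single initial value. -/
def augmentedCost (γ₁ γ₂ : ℝ) (V : ℝ → E n → ℝ) (y p : P.W) : ℝ :=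
  P.cost 0 (H1.rep y) (P.approxControl V y) + γ₁ / 2 * P.valueMisfit V y +
    γ₂ / 2 * P.gradientMisfit V y p

end ControlProblem

/-- The normalized Lebesgue measure on `Y₀`. -/
def normalizedLebesgue {n : ℕ} (Y₀ : Set (E n)) : Measure Y₀ :=
  (volume Y₀)⁻¹ • Measure.comap Subtype.val volume

namespace ControlProblem

variable {n m : ℕ} (P : ControlProblem n m)

/-- The constraints of the ensemble learning problem for `(ys, ps, θ)`, where `V = V_θ`. -/
structure IsFeasible (Y₀ : Set (E n)) (M : ℝ) (V : ℝ → E n → ℝ) (ys ps : C(Y₀, P.W)) : Prop where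
  state_bound : ∀ y₀, ‖ys y₀‖ ≤ 2 * M
  control_mem : ∃ U : Y₀ → L2 0 P.T m, MemLp U 2 (normalizedLebesgue Y₀) ∧
    ∀ᵐ y₀ ∂(normalizedLebesgue Y₀),
      U y₀ =ᵐ[volume.restrict (Ioo 0 P.T)] P.approxControl V (ys y₀)
  state_eq : ∀ᵐ y₀ : Y₀ ∂(normalizedLebesgue Y₀), P.IsClosedLoop (P.approxFeedback V) y₀ (ys y₀)
  adjoint_eq : ∀ᵐ y₀ : Y₀ ∂(normalizedLebesgue Y₀), P.IsAdjoint (P.approxFeedback V) (ys y₀) (ps y₀)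

/-- The objective of the ensemble learning problem with weight `wt` and parameters `γ₁`, `γ₂`, `γ`. -/
def objective (Y₀ : Set (E n)) (wt : Y₀ → ℝ) (γ₁ γ₂ γ : ℝ) {R : Type*} [NormedAddCommGroup R]
    (V : R → ℝ → E n → ℝ) (ys ps : C(Y₀, P.W)) (θ : R) : ℝ :=
  (∫ y₀, wt y₀ * P.augmentedCost γ₁ γ₂ (V θ) (ys y₀) (ps y₀) ∂(normalizedLebesgue Y₀)) +
    γ / 2 * ‖θ‖ ^ 2

/-- `(ys, ps, θ)` is a minimizing triple of the ensemble learning problem. -/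
def IsOptimalTriple (Y₀ : Set (E n)) (M : ℝ) (wt : Y₀ → ℝ) (γ₁ γ₂ γ : ℝ) {R : Type*}
    [NormedAddCommGroup R] (V : R → ℝ → E n → ℝ) (ys ps : C(Y₀, P.W)) (θ : R) : Prop :=
  P.IsFeasible Y₀ M (V θ) ys ps ∧
    ∀ (zs qs : C(Y₀, P.W)) (ϑ : R), P.IsFeasible Y₀ M (V ϑ) zs qs →
      P.objective Y₀ wt γ₁ γ₂ γ V ys ps θ ≤ P.objective Y₀ wt γ₁ γ₂ γ V zs qs ϑ

end ControlProblem

end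

end FeedbackLearning

open FeedbackLearning

namespace FeedbackLearning

noncomputable section

set_option linter.unusedSectionVars false

/-! ### Gronwall inequalities in integral form -/

/-! An optimal triple is compared with one well chosen feasible triple, built from the parameter
θ_ε. On the state ball B the feedback of V_{θ_ε} differs from F* by O(ε). By Gronwall its closed
loop trajectories stay within O(ε) of the optimal ones, hence in B and, for small ε, in the ball of
radius 2M of W_T. Since the cost is Lipschitz in state and control, the competitor costs at most
V*(0, y₀) + Cε.

Both misfits vanish for the exact value function along an optimal trajectory y* with control u* and
adjoint state p*. First, V*(t, y*(t)) = J_t(y*, u*), because tails of optimal pairs are optimal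
(`valueFunction_eq_cost`). Second, ∂_y V*(t, y*(t)) = p*(t) (`gradBall_valueFunction_eq`). No
Hamilton–Jacobi equation is needed for this: running the fixed open loop control u* from y*(t) + h
is admissible, and integration by parts against p* bounds the extra cost by ⟨p*(t), h⟩ + K|h|²
(`cost_sub_le_of_isAdjointCurve`). So V*(t, ·) lies below a quadratic function that touches it at
y*(t), and differentiability forces the gradient to be p*(t). Passing from V*, y*, u*, p* to the
data of the competitor changes the quantities under the squares by O(ε), so its misfits are O(ε²).

The constants must not depend on ε. The estimates in `exists_almost_optimal_family` therefore insert
F*, V* or ∂_y V* as intermediate terms and use only bounds and Lipschitz constants of f, g and these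
three; the smoothness of V_{θ_ε} itself serves only for existence and for continuity in y₀.

Consequently the competitor has objective at most ∫ ω V*(0, ·) + O(ε), the penalty being O(ε) by
hypothesis, and the optimal triple does no worse. Its cost is a.e. at least V*(0, y₀), since a
closed loop pair is admissible for the open loop problem, and its misfits and penalty are
nonnegative. Hence each excess is O(ε) separately (`weighted_gap_bounds`). Integrability holds
because all integrands are a bounded weight times a continuous function on the compact set Y₀. -/

theorem gronwall_integral {φ : ℝ → ℝ} {a b A K : ℝ} (hab : a ≤ b) (hA : 0 ≤ A) (hK : 0 ≤ K)
    (hφ : ContinuousOn φ (Icc a b))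
    (h : ∀ t ∈ Icc a b, φ t ≤ A + K * ∫ s in a..t, φ s) {t : ℝ} (ht : t ∈ Icc a b) :
    φ t ≤ A * Real.exp (K * (b - a)) := by
  -- The constant extension beyond the endpoints makes the primitive Φ differentiable everywhere.
  -- Then Φ' = Kψ ≤ KΦ on the interval, which is the differential form of Gronwall.
  set ψ : ℝ → ℝ := IccExtend hab ((Icc a b).domRestrict φ) with hψ
  have hψc : Continuous ψ := hφ.domRestrict.Icc_extend'
  have hψe : ∀ t ∈ Icc a b, ψ t = φ t := fun t ht => IccExtend_of_mem hab _ ht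
  set Φ : ℝ → ℝ := fun t => A + K * ∫ s in a..t, ψ s with hΦ
  have hΦd : ∀ t, HasDerivAt Φ (K * ψ t) t := fun t =>
    (((hψc.integral_hasStrictDerivAt a t).hasDerivAt).const_mul K).const_add A
  have hle : ∀ t ∈ Icc a b, ψ t ≤ Φ t := fun t ht => by
    rw [hψe t ht, hΦ]
    refine (h t ht).trans_eq ?_
    congr 2
    refine intervalIntegral.integral_congr fun s hs => ?_
    rw [uIcc_of_le ht.1] at hs
    exact (hψe s ⟨hs.1, hs.2.trans ht.2⟩).symm
  have key := le_gronwallBound_of_liminf_deriv_right_le (f := Φ) (f' := fun t => K * ψ t)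
    (δ := A) (K := K) (ε := 0) (a := a) (b := b)
    (fun t _ => (hΦd t).continuousAt.continuousWithinAt)
    (fun t _ r hr => by
      have := (hΦd t).hasDerivWithinAt (s := Ici t)
      exact (this.liminf_right_slope_le hr).mono fun z hz => by
        rwa [slope_def_field, div_eq_inv_mul] at hz)
    (by simp [hΦ])
    (fun t ht => by
      rw [add_zero]
      exact mul_le_mul_of_nonneg_left (hle t ⟨ht.1, ht.2.le⟩) hK) t ht
  rw [gronwallBound_ε0] at key
  rw [← hψe t ht]
  refine (hle t ht).trans (key.trans ?_)
  gcongr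
  exact ht.2

/-- Reflecting time by t ↦ a + b - t reduces this to the forward inequality. -/
theorem gronwall_integral_backward {φ : ℝ → ℝ} {a b A K : ℝ} (hab : a ≤ b) (hA : 0 ≤ A)
    (hK : 0 ≤ K) (hφ : ContinuousOn φ (Icc a b))
    (h : ∀ t ∈ Icc a b, φ t ≤ A + K * ∫ s in t..b, φ s) {t : ℝ} (ht : t ∈ Icc a b) :
    φ t ≤ A * Real.exp (K * (b - a)) := by
  have hm : MapsTo (fun t => a + b - t) (Icc a b) (Icc a b) := fun t ht =>
    ⟨by linarith [ht.2], by linarith [ht.1]⟩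
  have := gronwall_integral (φ := fun t => φ (a + b - t)) hab hA hK
    (hφ.comp (by fun_prop) hm) (fun t ht => by
      have := h _ (hm ht)
      rw [intervalIntegral.integral_comp_sub_left (fun s => φ s)]
      simpa using this) (hm ht)
  simpa using this

/-! ### Radial retraction onto a ball -/

section Retraction

variable {F : Type*} [NormedAddCommGroup F] [NormedSpace ℝ F]

/-- The radial retraction onto the closed ball of radius `r` about the origin. -/
def radialRetraction (r : ℝ) (x : F) : F := if ‖x‖ ≤ r then x else (r / ‖x‖) • x

theorem radialRetraction_of_norm_le {r : ℝ} {x : F} (h : ‖x‖ ≤ r) : radialRetraction r x = x :=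
  if_pos h

theorem norm_radialRetraction_le {r : ℝ} (hr : 0 ≤ r) (x : F) : ‖radialRetraction r x‖ ≤ r := by
  unfold radialRetraction
  split_ifs with h
  · exact h
  · have hx : 0 < ‖x‖ := hr.trans_lt (not_le.1 h)
    rw [norm_smul, norm_div, norm_norm, Real.norm_of_nonneg hr, div_mul_cancel₀ _ hx.ne']

theorem norm_radialRetraction_le_norm {r : ℝ} (hr : 0 ≤ r) (x : F) :
    ‖radialRetraction r x‖ ≤ ‖x‖ := by
  by_cases h : ‖x‖ ≤ r
  · rw [radialRetraction_of_norm_le h]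
  · exact (norm_radialRetraction_le hr x).trans (not_le.1 h).le

/-- Composing with the retraction turns a field that is Lipschitz on a ball into a globally
Lipschitz and bounded one. The constant 2 holds in every normed space and costs only a factor in the
Gronwall exponents. -/
theorem norm_radialRetraction_sub_le {r : ℝ} (hr : 0 ≤ r) (x y : F) :
    ‖radialRetraction r x - radialRetraction r y‖ ≤ 2 * ‖x - y‖ := by
  have mixed : ∀ x y : F, ‖x‖ ≤ r → ¬ ‖y‖ ≤ r →
      ‖radialRetraction r x - radialRetraction r y‖ ≤ 2 * ‖x - y‖ := by
    intro x y hx hy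
    have hy0 : 0 < ‖y‖ := hr.trans_lt (not_le.1 hy)
    rw [radialRetraction_of_norm_le hx, radialRetraction, if_neg hy]
    have e : x - (r / ‖y‖) • y = (x - y) + (1 - r / ‖y‖) • y := by module
    have e2 : ‖(1 - r / ‖y‖) • y‖ = ‖y‖ - r := by
      rw [norm_smul, Real.norm_of_nonneg (by
        rw [sub_nonneg, div_le_one hy0]; exact (not_le.1 hy).le)]
      field_simp
    rw [e]
    refine (norm_add_le _ _).trans ?_
    rw [e2]
    have := norm_sub_norm_le y x
    rw [norm_sub_rev] at this
    linarith
  by_cases hx : ‖x‖ ≤ r <;> by_cases hy : ‖y‖ ≤ r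
  · rw [radialRetraction_of_norm_le hx, radialRetraction_of_norm_le hy]
    linarith [norm_nonneg (x - y)]
  · exact mixed x y hx hy
  · rw [norm_sub_rev, norm_sub_rev x]
    exact mixed y x hy hx
  · have hx0 : 0 < ‖x‖ := hr.trans_lt (not_le.1 hx)
    have hy0 : 0 < ‖y‖ := hr.trans_lt (not_le.1 hy)
    rw [radialRetraction, radialRetraction, if_neg hx, if_neg hy]
    -- Rescale y to the norm of x first: the radial correction has length |‖y‖ - ‖x‖| ≤ ‖x - y‖, and
    -- the remaining common factor r / ‖x‖ is at most 1.
    have e : (r / ‖x‖) • x - (r / ‖y‖) • y = (r / ‖x‖) • ((x - y) + ((‖y‖ - ‖x‖) / ‖y‖) • y) := by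
      have : r / ‖y‖ = (r / ‖x‖) * (1 - (‖y‖ - ‖x‖) / ‖y‖) := by field_simp; ring
      rw [this]; module
    have e2 : ‖((‖y‖ - ‖x‖) / ‖y‖) • y‖ = |‖y‖ - ‖x‖| := by
      rw [norm_smul, norm_div, norm_norm, div_mul_cancel₀ _ hy0.ne', Real.norm_eq_abs]
    rw [e, norm_smul, norm_div, norm_norm, Real.norm_of_nonneg hr]
    have h1 : r / ‖x‖ ≤ 1 := (div_le_one hx0).2 (not_le.1 hx).le
    have h2 : ‖(x - y) + ((‖y‖ - ‖x‖) / ‖y‖) • y‖ ≤ 2 * ‖x - y‖ := by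
      refine (norm_add_le _ _).trans ?_
      rw [e2]
      have := abs_norm_sub_norm_le y x
      rw [norm_sub_rev] at this
      linarith
    calc _ ≤ 1 * (2 * ‖x - y‖) := by gcongr
      _ = _ := one_mul _

end Retraction

/-! ### Continuous time dependent fields that are Lipschitz in space -/

section Tame

variable {X Y Z F : Type*} [NormedAddCommGroup X] [NormedSpace ℝ X] [NormedAddCommGroup Y]
  [NormedSpace ℝ Y] [NormedAddCommGroup Z] [NormedSpace ℝ Z] [NormedAddCommGroup F]
  [NormedSpace ℝ F]

/-- `φ` is jointly continuous on `I × B` and Lipschitz in the second variable, uniformly in the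
first one. -/
structure TameOn (I : Set ℝ) (B : Set X) (φ : ℝ → X → Y) : Prop where
  cont : ContinuousOn (fun q : ℝ × X => φ q.1 q.2) (I ×ˢ B)
  lip : ∃ L, 0 ≤ L ∧ ∀ t ∈ I, ∀ x ∈ B, ∀ y ∈ B, ‖φ t x - φ t y‖ ≤ L * ‖x - y‖

namespace TameOn

variable {I : Set ℝ} {B : Set X}

theorem bound {φ : ℝ → X → Y} (h : TameOn I B φ) (hI : IsCompact I) (hB : IsCompact B) :
    ∃ C, 0 ≤ C ∧ ∀ t ∈ I, ∀ x ∈ B, ‖φ t x‖ ≤ C := by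
  obtain ⟨C, hC⟩ := (hI.prod hB).exists_bound_of_continuousOn h.cont
  exact ⟨max C 0, le_max_right _ _, fun t ht x hx => (hC (t, x) ⟨ht, hx⟩).trans (le_max_left _ _)⟩

theorem comp_curve {φ : ℝ → X → Y} (h : TameOn I B φ) {J : Set ℝ} (hJ : J ⊆ I) {y : ℝ → X}
    (hy : ContinuousOn y J) (hm : ∀ t ∈ J, y t ∈ B) : ContinuousOn (fun t => φ t (y t)) J :=
  h.cont.comp (continuousOn_id.prodMk hy) fun t ht => ⟨hJ ht, hm t ht⟩

theorem add {φ ψ : ℝ → X → Y} (h : TameOn I B φ) (h' : TameOn I B ψ) :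
    TameOn I B fun t x => φ t x + ψ t x := by
  obtain ⟨L, hL0, hL⟩ := h.lip
  obtain ⟨L', hL0', hL'⟩ := h'.lip
  refine ⟨h.cont.add h'.cont, L + L', by positivity, fun t ht x hx y hy => ?_⟩
  rw [add_sub_add_comm, add_mul]
  exact (norm_add_le _ _).trans (add_le_add (hL t ht x hx y hy) (hL' t ht x hx y hy))

theorem comp_lipschitz {φ : ℝ → X → Y} (h : TameOn I B φ) {ψ : Y → Z} {K : NNReal}
    (hψ : LipschitzWith K ψ) : TameOn I B fun t x => ψ (φ t x) := by
  obtain ⟨L, hL0, hL⟩ := h.lip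
  refine ⟨hψ.continuous.comp_continuousOn h.cont, K * L, by positivity, fun t ht x hx y hy => ?_⟩
  rw [mul_assoc]
  exact (hψ.norm_sub_le _ _).trans (by gcongr; exact hL t ht x hx y hy)

theorem bilin (T : Y →L[ℝ] Z →L[ℝ] F) {φ : ℝ → X → Y} {ψ : ℝ → X → Z} (h : TameOn I B φ)
    (h' : TameOn I B ψ) (hI : IsCompact I) (hB : IsCompact B) :
    TameOn I B fun t x => T (φ t x) (ψ t x) := by
  obtain ⟨L, hL0, hL⟩ := h.lip
  obtain ⟨L', hL0', hL'⟩ := h'.lip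
  obtain ⟨C, hC0, hC⟩ := h.bound hI hB
  obtain ⟨C', hC0', hC'⟩ := h'.bound hI hB
  refine ⟨(T.continuous.comp_continuousOn h.cont).clm_apply h'.cont,
    ‖T‖ * (L * C' + C * L'), by positivity, fun t ht x hx y hy => ?_⟩
  have e : T (φ t x) (ψ t x) - T (φ t y) (ψ t y) =
      T (φ t x - φ t y) (ψ t x) + T (φ t y) (ψ t x - ψ t y) := by
    simp only [map_sub, sub_apply]; abel
  rw [e]
  refine (norm_add_le _ _).trans ((add_le_add (T.le_opNorm₂ _ _) (T.le_opNorm₂ _ _)).trans ?_)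
  calc ‖T‖ * ‖φ t x - φ t y‖ * ‖ψ t x‖ + ‖T‖ * ‖φ t y‖ * ‖ψ t x - ψ t y‖
      ≤ ‖T‖ * (L * ‖x - y‖) * C' + ‖T‖ * C * (L' * ‖x - y‖) := by
        gcongr
        exacts [hL t ht x hx y hy, hC' t ht x hx, hC t ht y hy, hL' t ht x hx y hy]
    _ = _ := by ring

end TameOn

/-- The spatial derivative is the joint derivative restricted to the second factor, by the chain
rule along x ↦ (t, x) and uniqueness of derivatives within S. Joint continuity is inherited from the
joint derivative. -/
theorem fderivWithin_slice {I : Set ℝ} {S : Set X} (hI : UniqueDiffOn ℝ I) (hS : UniqueDiffOn ℝ S)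
    {G : ℝ → X → Y} (hG : ContDiffOn ℝ 1 (fun q : ℝ × X => G q.1 q.2) (I ×ˢ S)) :
    (∀ t ∈ I, DifferentiableOn ℝ (G t) S) ∧
    ContinuousOn (fun q : ℝ × X => fderivWithin ℝ (G q.1) S q.2) (I ×ˢ S) := by
  have hd : ∀ q ∈ I ×ˢ S, HasFDerivWithinAt (G q.1)
      ((fderivWithin ℝ (fun q : ℝ × X => G q.1 q.2) (I ×ˢ S) q).comp
        (ContinuousLinearMap.inr ℝ ℝ X)) S q.2 := by
    intro q hq
    have h1 := (hG.differentiableOn (by norm_num) q hq).hasFDerivWithinAt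
    have h2 : HasFDerivWithinAt (fun x : X => (q.1, x)) (ContinuousLinearMap.inr ℝ ℝ X) S q.2 :=
      (hasFDerivAt_prodMk_right q.1 q.2).hasFDerivWithinAt
    exact h1.comp q.2 h2 fun x hx => mk_mem_prod hq.1 hx
  refine ⟨fun t ht x hx => (hd (t, x) ⟨ht, hx⟩).differentiableWithinAt, ?_⟩
  have hc := hG.continuousOn_fderivWithin (hI.prod hS) le_rfl
  have hc' : ContinuousOn (fun q => (fderivWithin ℝ (fun q : ℝ × X => G q.1 q.2) (I ×ˢ S) q).comp
      (ContinuousLinearMap.inr ℝ ℝ X)) (I ×ˢ S) := hc.clm_comp continuousOn_const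
  exact hc'.congr fun q hq => (hd q hq).fderivWithin (hS q.2 hq.2)

/-- Continuity of the spatial derivative bounds it on the compact set I × B, and the mean value
inequality on the convex set B does the rest. The larger set S allows derivatives to be taken on the
whole space while the bound is local. -/
theorem tameOn_of_contDiffOn {I : Set ℝ} {B S : Set X} (hI : UniqueDiffOn ℝ I)
    (hIc : IsCompact I) (hS : UniqueDiffOn ℝ S)
    {G : ℝ → X → Y} (hG : ContDiffOn ℝ 1 (fun q : ℝ × X => G q.1 q.2) (I ×ˢ S))
    (hBS : B ⊆ S) (hB : IsCompact B) (hBc : Convex ℝ B) : TameOn I B G := by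
  obtain ⟨hd, hc⟩ := fderivWithin_slice hI hS hG
  have hsub : I ×ˢ B ⊆ I ×ˢ S := prod_mono_right hBS
  refine ⟨hG.continuousOn.mono hsub, ?_⟩
  obtain ⟨C, hC⟩ := (hIc.prod hB).exists_bound_of_continuousOn (hc.mono hsub)
  refine ⟨max C 0, le_max_right _ _, fun t ht x hx y hy => ?_⟩
  exact hBc.norm_image_sub_le_of_norm_hasFDerivWithin_le
    (fun z hz => ((hd t ht z (hBS hz)).hasFDerivWithinAt).mono hBS)
    (fun z hz => (hC (t, z) ⟨ht, hz⟩).trans (le_max_left _ _)) hy hx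

end Tame

end

end FeedbackLearning

namespace FeedbackLearning

noncomputable section

set_option linter.unusedSectionVars false

/-! ### Existence and comparison of solutions of integral equations -/

section ODE

variable {F : Type*} [NormedAddCommGroup F] [NormedSpace ℝ F] [FiniteDimensional ℝ F]

/-- Truncation by the retraction gives existence on the whole interval from local data; a solution
that turns out to stay in the ball solves the original equation. The initial time is arbitrary, so
backward equations are covered as well. -/
theorem exists_truncated_solution {a b t₀ r : ℝ} (ht₀ : t₀ ∈ Icc a b) (hr : 0 ≤ r)
    {v : ℝ → F → F} (hv : TameOn (Icc a b) (Metric.closedBall 0 r) v) (x₀ : F) :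
    ∃ y : ℝ → F, y t₀ = x₀ ∧ ContinuousOn y (Icc a b) ∧
      ∀ t ∈ Icc a b, y t = x₀ + ∫ s in t₀..t, v s (radialRetraction r (y s)) := by
  have : ProperSpace F := FiniteDimensional.proper ℝ F
  have : CompleteSpace F := FiniteDimensional.complete ℝ F
  obtain ⟨C, hC0, hC⟩ := hv.bound isCompact_Icc (isCompact_closedBall 0 r)
  obtain ⟨L, hL0, hL⟩ := hv.lip
  have hmem : ∀ x : F, radialRetraction r x ∈ Metric.closedBall (0 : F) r := fun x => by
    simpa using norm_radialRetraction_le hr x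
  have hab : a ≤ b := ht₀.1.trans ht₀.2
  lift C to NNReal using hC0
  lift L to NNReal using hL0
  obtain ⟨ℓ, hℓ⟩ : ∃ ℓ : NNReal, (ℓ : ℝ) = max (b - t₀) (t₀ - a) :=
    ⟨⟨_, (sub_nonneg.2 ht₀.2).trans (le_max_left _ _)⟩, rfl⟩
  have hlip : ∀ t ∈ Icc a b, LipschitzWith (L * 2) fun x => v t (radialRetraction r x) := by
    intro t ht
    refine LipschitzWith.of_dist_le_mul fun x y => ?_
    rw [dist_eq_norm, dist_eq_norm]
    refine (hL t ht _ (hmem x) _ (hmem y)).trans ?_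
    push_cast
    rw [mul_assoc]
    gcongr
    exact norm_radialRetraction_sub_le hr x y
  -- The truncated field is bounded by C, so no curve leaves the ball of radius Cℓ about x₀ within
  -- the time ℓ to the farther endpoint, and the whole interval is admissible for Picard–Lindelöf.
  -- The fixed point of the Picard map is used directly, as it already is the integral equation.
  have hP : IsPicardLindelof (fun t x => v t (radialRetraction r x)) (⟨t₀, ht₀⟩ : Icc a b) x₀ (C * ℓ) 0 C
      (L * 2) :=
    { lipschitzOnWith := fun t ht => (hlip t ht).lipschitzOnWith
      continuousOn := fun x _ => hv.comp_curve subset_rfl continuousOn_const fun _ _ => hmem x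
      norm_le := fun t ht x _ => hC t ht _ (hmem x)
      mul_max_le := by
        rw [NNReal.coe_zero, sub_zero, NNReal.coe_mul, hℓ] }
  have hx₀ : x₀ ∈ Metric.closedBall x₀ ((0 : NNReal) : ℝ) := by simp
  obtain ⟨α, hα⟩ := ODE.FunSpace.exists_isFixedPt_next hP hx₀
  have hα' : (ODE.FunSpace.next hP hx₀ α).compProj = α.compProj := by rw [hα]
  refine ⟨α.compProj, ?_, α.continuous_compProj.continuousOn, fun t ht => ?_⟩
  · rw [← hα', ODE.FunSpace.compProj_of_mem ht₀, ODE.FunSpace.next_apply₀]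
  · conv_lhs => rw [← hα', ODE.FunSpace.compProj_of_mem ht, ODE.FunSpace.next_apply]
    rfl

theorem continuousOn_of_integral_eq {a b t₀ : ℝ} (ht₀ : t₀ ∈ Icc a b) {y v : ℝ → F} {x : F}
    (hv : IntervalIntegrable v volume a b)
    (hy : ∀ t ∈ Icc a b, y t = x + ∫ s in t₀..t, v s) : ContinuousOn y (Icc a b) := by
  have hab : a ≤ b := ht₀.1.trans ht₀.2
  rw [← uIcc_of_le hab] at ht₀
  have h := intervalIntegral.continuousOn_primitive_interval' hv ht₀
  rw [uIcc_of_le hab] at h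
  exact (continuousOn_const.add h).congr hy

/-- Two curves that are primitives of functions which differ by at most `K |y - z| + η`. -/
theorem norm_sub_le_of_integral_eq {a b K η : ℝ} (hab : a ≤ b) (hK : 0 ≤ K) (hη : 0 ≤ η)
    {y z v w : ℝ → F}
    (hv : IntervalIntegrable v volume a b) (hw : IntervalIntegrable w volume a b)
    (hy : ∀ t ∈ Icc a b, y t = y a + ∫ s in a..t, v s)
    (hz : ∀ t ∈ Icc a b, z t = z a + ∫ s in a..t, w s)
    (h : ∀ᵐ s ∂(volume.restrict (Ioo a b)), ‖v s - w s‖ ≤ K * ‖y s - z s‖ + η)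
    {t : ℝ} (ht : t ∈ Icc a b) :
    ‖y t - z t‖ ≤ (‖y a - z a‖ + η * (b - a)) * Real.exp (K * (b - a)) := by
  have : CompleteSpace F := FiniteDimensional.complete ℝ F
  have ha : a ∈ Icc a b := left_mem_Icc.2 hab
  have hyc := continuousOn_of_integral_eq ha hv hy
  have hzc := continuousOn_of_integral_eq ha hw hz
  have hn : ContinuousOn (fun s => ‖y s - z s‖) (Icc a b) := (hyc.sub hzc).norm
  refine gronwall_integral (φ := fun s => ‖y s - z s‖) hab
    (add_nonneg (norm_nonneg _) (mul_nonneg hη (sub_nonneg.2 hab))) hK hn (fun t ht => ?_) ht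
  have hsub : uIcc a t ⊆ uIcc a b := by
    rw [uIcc_of_le ht.1, uIcc_of_le hab]; exact Icc_subset_Icc_right ht.2
  have hvt := hv.mono_set hsub
  have hwt := hw.mono_set hsub
  have hni : IntervalIntegrable (fun s => ‖y s - z s‖) volume a t :=
    (hn.mono (by rw [uIcc_of_le ht.1]; exact Icc_subset_Icc_right ht.2)).intervalIntegrable
  have e : y t - z t = (y a - z a) + ∫ s in a..t, (v s - w s) := by
    rw [intervalIntegral.integral_sub hvt hwt, hy t ht, hz t ht]; abel
  have h1 : ‖∫ s in a..t, (v s - w s)‖ ≤ ∫ s in a..t, (K * ‖y s - z s‖ + η) := by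
    refine intervalIntegral.norm_integral_le_of_norm_le ht.1 ?_
      ((hni.const_mul K).add intervalIntegrable_const)
    rw [← ae_restrict_iff' measurableSet_Ioc, ← Measure.restrict_congr_set Ioo_ae_eq_Ioc]
    exact ae_restrict_of_ae_restrict_of_subset (Ioo_subset_Ioo_right ht.2) h
  rw [intervalIntegral.integral_add (hni.const_mul K) intervalIntegrable_const,
    intervalIntegral.integral_const_mul, intervalIntegral.integral_const, smul_eq_mul] at h1
  have h2 : (t - a) * η ≤ η * (b - a) := by
    rw [mul_comm]; gcongr; exact ht.2
  show ‖y t - z t‖ ≤ _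
  rw [e]
  refine (norm_add_le _ _).trans ?_
  linarith

/-- Backward linear equations: comparison of solutions. -/
theorem norm_sub_le_of_backward_linear {a b K η R : ℝ} (hab : a ≤ b) (hK : 0 ≤ K) (hη : 0 ≤ η)
    (hR : 0 ≤ R) {p p' c c' : ℝ → F} {A A' : ℝ → F →L[ℝ] F} 
    (hpc : ContinuousOn p (Icc a b)) (hpc' : ContinuousOn p' (Icc a b))
    (hi : IntervalIntegrable (fun s => A s (p s) + c s) volume a b)
    (hi' : IntervalIntegrable (fun s => A' s (p' s) + c' s) volume a b)
    (hp : ∀ t ∈ Icc a b, p t = p b + ∫ s in t..b, (A s (p s) + c s))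
    (hp' : ∀ t ∈ Icc a b, p' t = p' b + ∫ s in t..b, (A' s (p' s) + c' s))
    (hA : ∀ s ∈ Icc a b, ‖A s‖ ≤ K) (hAA : ∀ s ∈ Icc a b, ‖A s - A' s‖ ≤ η)
    (hc : ∀ s ∈ Icc a b, ‖c s - c' s‖ ≤ η) (hb : ‖p b - p' b‖ ≤ η)
    (hR' : ∀ s ∈ Icc a b, ‖p' s‖ ≤ R) {t : ℝ} (ht : t ∈ Icc a b) :
    ‖p t - p' t‖ ≤ η * (1 + (R + 1) * (b - a)) * Real.exp (K * (b - a)) := by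
  have : CompleteSpace F := FiniteDimensional.complete ℝ F
  have hba : 0 ≤ b - a := sub_nonneg.2 hab
  have hn : ContinuousOn (fun s => ‖p s - p' s‖) (Icc a b) := (hpc.sub hpc').norm
  refine gronwall_integral_backward (φ := fun s => ‖p s - p' s‖) hab (by positivity) hK hn
    (fun t ht => ?_) ht
  have hsub : uIcc t b ⊆ uIcc a b := by
    rw [uIcc_of_le ht.2, uIcc_of_le hab]; exact Icc_subset_Icc_left ht.1
  have hni : IntervalIntegrable (fun s => ‖p s - p' s‖) volume t b :=
    (hn.mono (by rw [uIcc_of_le ht.2]; exact Icc_subset_Icc_left ht.1)).intervalIntegrable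
  have e : p t - p' t = (p b - p' b) +
      ∫ s in t..b, ((A s (p s) + c s) - (A' s (p' s) + c' s)) := by
    rw [intervalIntegral.integral_sub (hi.mono_set hsub) (hi'.mono_set hsub)]
    conv_lhs => rw [hp t ht, hp' t ht]
    abel
  have h1 : ‖∫ s in t..b, ((A s (p s) + c s) - (A' s (p' s) + c' s))‖ ≤
      ∫ s in t..b, (K * ‖p s - p' s‖ + η * (R + 1)) := by
    refine intervalIntegral.norm_integral_le_of_norm_le ht.2 ?_
      ((hni.const_mul K).add intervalIntegrable_const)
    refine ae_of_all _ fun s hs => ?_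
    have hs' : s ∈ Icc a b := ⟨ht.1.trans hs.1.le, hs.2⟩
    have e : (A s (p s) + c s) - (A' s (p' s) + c' s) =
        A s (p s - p' s) + ((A s - A' s) (p' s) + (c s - c' s)) := by
      simp only [map_sub, sub_apply]; abel
    rw [e]
    refine (norm_add_le _ _).trans (add_le_add ?_ ((norm_add_le _ _).trans ?_))
    · exact (A s).le_of_opNorm_le (hA s hs') _
    · rw [mul_add, mul_one]
      refine add_le_add (((A s - A' s).le_opNorm _).trans ?_) (hc s hs')
      gcongr
      exacts [hAA s hs', hR' s hs']
  rw [intervalIntegral.integral_add (hni.const_mul K) intervalIntegrable_const,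
    intervalIntegral.integral_const_mul, intervalIntegral.integral_const, smul_eq_mul] at h1
  have h2 : (b - t) * (η * (R + 1)) ≤ η * (R + 1) * (b - a) := by
    rw [mul_comm]; gcongr; exact ht.1
  show ‖p t - p' t‖ ≤ _
  rw [e]
  refine (norm_add_le _ _).trans ?_
  linarith

/-- Since c is only integrable, Picard–Lindelöf does not apply to p itself. The difference q = p -
k, with k(t) the integral of c over (t, b), solves an equation whose right hand side is continuous
in time and linear up to a shift. -/
theorem exists_backward_linear {a b : ℝ} (hab : a ≤ b) {A : ℝ → F →L[ℝ] F} {c : ℝ → F}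
    (hA : ContinuousOn A (Icc a b)) (hc : IntervalIntegrable c volume a b) (x : F) :
    ∃ p : ℝ → F, p b = x ∧ ContinuousOn p (Icc a b) ∧
      ∀ t ∈ Icc a b, p t = x + ∫ s in t..b, (A s (p s) + c s) := by
  have : CompleteSpace F := FiniteDimensional.complete ℝ F
  have hb : b ∈ Icc a b := right_mem_Icc.2 hab
  have hba : 0 ≤ b - a := sub_nonneg.2 hab
  -- remove the merely integrable part of the right hand side
  set k : ℝ → F := fun t => ∫ s in t..b, c s with hk
  have hkc : ContinuousOn k (Icc a b) := by
    refine continuousOn_of_integral_eq (x := 0) (v := fun s => -c s) hb hc.neg fun t ht => ?_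
    rw [hk, intervalIntegral.integral_neg, zero_add]
    exact intervalIntegral.integral_symm _ _
  obtain ⟨N, hN⟩ := isCompact_Icc.exists_bound_of_continuousOn hA
  obtain ⟨C, hC⟩ := isCompact_Icc.exists_bound_of_continuousOn hkc
  have hN0 : 0 ≤ N := (norm_nonneg _).trans (hN b hb)
  have hC0 : 0 ≤ C := (norm_nonneg _).trans (hC b hb)
  -- The a priori Gronwall bound for q; with this radius the truncation is never active.
  set r : ℝ := (‖x‖ + N * C * (b - a)) * Real.exp (N * (b - a)) with hr
  have hr0 : 0 ≤ r := by positivity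
  have htame : TameOn (Icc a b) (Metric.closedBall 0 r) fun t y => -(A t (y + k t)) := by
    refine ⟨?_, N, hN0, fun t ht y _ z _ => ?_⟩
    · have h1 : ContinuousOn (fun q : ℝ × F => A q.1) (Icc a b ×ˢ Metric.closedBall 0 r) :=
        hA.comp continuousOn_fst fun q hq => hq.1
      have h2 : ContinuousOn (fun q : ℝ × F => k q.1) (Icc a b ×ˢ Metric.closedBall 0 r) :=
        hkc.comp continuousOn_fst fun q hq => hq.1
      exact (h1.clm_apply (continuousOn_snd.add h2)).neg
    · rw [neg_sub_neg, ← map_sub, norm_sub_rev y z]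
      refine ((A t).le_of_opNorm_le (hN t ht) _).trans_eq ?_
      simp
  obtain ⟨q, hqb, hqc, hq⟩ := exists_truncated_solution hb hr0 htame x
  have hrc : ContinuousOn (fun s => radialRetraction r (q s)) (Icc a b) := by
    have : LipschitzWith 2 (radialRetraction r : F → F) :=
      LipschitzWith.of_dist_le_mul fun u v => by
        rw [dist_eq_norm, dist_eq_norm]; exact norm_radialRetraction_sub_le hr0 u v
    exact this.continuous.comp_continuousOn hqc
  -- The retraction does not increase norms, so the truncated equation already satisfies the a
  -- priori bound of the linear one.
  have hle : ∀ t ∈ Icc a b, ‖q t‖ ≤ r := by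
    intro t ht
    refine gronwall_integral_backward (φ := fun s => ‖q s‖) hab (by positivity) hN0 hqc.norm
      (fun t ht => ?_) ht
    have hni : IntervalIntegrable (fun s => ‖q s‖) volume t b :=
      (hqc.norm.mono (by rw [uIcc_of_le ht.2]; exact Icc_subset_Icc_left ht.1)).intervalIntegrable
    have h1 : ‖∫ s in t..b, A s (radialRetraction r (q s) + k s)‖ ≤
        ∫ s in t..b, (N * ‖q s‖ + N * C) := by
      refine intervalIntegral.norm_integral_le_of_norm_le ht.2 ?_
        ((hni.const_mul N).add intervalIntegrable_const)
      refine ae_of_all _ fun s hs => ?_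
      have hs' : s ∈ Icc a b := ⟨ht.1.trans hs.1.le, hs.2⟩
      refine ((A s).le_of_opNorm_le (hN s hs') _).trans ?_
      rw [← mul_add]
      gcongr
      exact (norm_add_le _ _).trans
        (add_le_add (norm_radialRetraction_le_norm hr0 _) (hC s hs'))
    rw [intervalIntegral.integral_add (hni.const_mul N) intervalIntegrable_const,
      intervalIntegral.integral_const_mul, intervalIntegral.integral_const, smul_eq_mul] at h1
    have h2 : (b - t) * (N * C) ≤ N * C * (b - a) := by
      rw [mul_comm]; gcongr; exact ht.1
    show ‖q t‖ ≤ _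
    rw [hq t ht, intervalIntegral.integral_neg, ← intervalIntegral.integral_symm]
    refine (norm_add_le _ _).trans ?_
    linarith
  refine ⟨fun t => q t + k t, by simp [hqb, hk], hqc.add hkc, fun t ht => ?_⟩
  have hsub : uIcc t b ⊆ uIcc a b := by
    rw [uIcc_of_le ht.2, uIcc_of_le hab]; exact Icc_subset_Icc_left ht.1
  have hAi : IntervalIntegrable (fun s => A s (q s + k s)) volume t b := by
    refine ContinuousOn.intervalIntegrable ?_
    rw [uIcc_of_le ht.2]
    exact ((hA.clm_apply (hqc.add hkc))).mono (Icc_subset_Icc_left ht.1)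
  rw [intervalIntegral.integral_add hAi (hc.mono_set hsub), ← add_assoc]
  show q t + k t = _
  congr 1
  rw [hq t ht, intervalIntegral.integral_neg, ← intervalIntegral.integral_symm]
  congr 1
  refine intervalIntegral.integral_congr fun s hs => ?_
  rw [uIcc_of_le ht.2] at hs
  show A s (radialRetraction r (q s) + k s) = _
  rw [radialRetraction_of_norm_le (hle s ⟨ht.1.trans hs.1, hs.2⟩)]

end ODE

end

end FeedbackLearning

namespace FeedbackLearning

noncomputable section

/-! ### Elements of H¹ as primitives and as continuous curves -/

theorem memLp_two_of_continuousOn {F : Type*} [NormedAddCommGroup F] [SecondCountableTopology F]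
    {a b : ℝ} {u : ℝ → F} (hu : ContinuousOn u (Icc a b)) :
    MemLp u 2 (volume.restrict (Ioo a b)) := by
  obtain ⟨C, hC⟩ := isCompact_Icc.exists_bound_of_continuousOn hu
  refine MemLp.of_bound
    ((hu.mono Ioo_subset_Icc_self).aestronglyMeasurable measurableSet_Ioo) C ?_
  rw [ae_restrict_iff' measurableSet_Ioo]
  exact ae_of_all _ fun t ht => hC t (Ioo_subset_Icc_self ht)

namespace H1

variable {a b : ℝ} {n : ℕ}

theorem intervalIntegrable_weakDeriv (hab : a < b) (w : H1 a b n) :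
    IntervalIntegrable (weakDeriv w) volume a b := intervalIntegrable_coe hab w.1.snd

theorem memLp_weakDeriv (w : H1 a b n) : MemLp (weakDeriv w) 2 (volume.restrict (Ioo a b)) :=
  Lp.memLp w.1.snd

theorem rep_eq_add_integral_weakDeriv (w : H1 a b n) (t : ℝ) :
    rep w t = rep w a + ∫ s in a..t, weakDeriv w s := rep_eq w t

theorem rep_eq_rep_add_integral (hab : a < b) (w : H1 a b n) {s t : ℝ} (hs : s ∈ Icc a b)
    (ht : t ∈ Icc a b) : rep w t = rep w s + ∫ r in s..t, weakDeriv w r := by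
  have hvi := intervalIntegrable_weakDeriv hab w
  rw [← uIcc_of_le hab.le] at hs ht
  rw [rep_eq_add_integral_weakDeriv w s, rep_eq_add_integral_weakDeriv w t, add_assoc,
    intervalIntegral.integral_add_adjacent_intervals (hvi.mono_set (uIcc_subset_uIcc_left hs))
      (hvi.mono_set (uIcc_subset_uIcc hs ht))]

theorem integral_congr_of_ae {v v' : ℝ → E n} (h : v =ᵐ[volume.restrict (Ioo a b)] v') {s t : ℝ}
    (hs : s ∈ Icc a b) (ht : t ∈ Icc a b) : ∫ r in s..t, v r = ∫ r in s..t, v' r := by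
  refine intervalIntegral.integral_congr_ae ?_
  have h' : ∀ᵐ r ∂(volume.restrict (Ioc a b)), v r = v' r := by
    rwa [← Measure.restrict_congr_set Ioo_ae_eq_Ioc]
  rw [ae_restrict_iff' measurableSet_Ioc] at h'
  filter_upwards [h'] with r hr hrm
  refine hr ⟨(le_min hs.1 ht.1).trans_lt hrm.1, hrm.2.trans (max_le hs.2 ht.2)⟩

/-- Primitives of `L²` functions belong to `H¹`. -/
theorem exists_of_primitive (hab : a < b) (c : E n) {v : ℝ → E n}
    (hv : MemLp v 2 (volume.restrict (Ioo a b))) :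
    ∃ w : H1 a b n, weakDeriv w =ᵐ[volume.restrict (Ioo a b)] v ∧
      ∀ t ∈ Icc a b, rep w t = c + ∫ s in a..t, v s := by
  have hvI : IntegrableOn v (Ioo a b) := hv.integrable (by norm_num)
  have hvi : IntervalIntegrable v volume a b :=
    (intervalIntegrable_iff_integrableOn_Ioo_of_le hab.le).2 hvI
  have hc : ContinuousOn (fun t => c + ∫ s in a..t, v s) (Icc a b) := by
    rw [← uIcc_of_le hab.le]
    exact continuousOn_const.add (intervalIntegral.continuousOn_primitive_interval' hvi
      left_mem_uIcc)
  have hm := memLp_two_of_continuousOn hc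
  let w : H1 a b n := ⟨WithLp.toLp 2 (hm.toLp _, hv.toLp _),
    isWeakDeriv_congr hm.coeFn_toLp.symm hv.coeFn_toLp.symm (isWeakDeriv_primitive hab c hvI)⟩
  have hw : weakDeriv w =ᵐ[volume.restrict (Ioo a b)] v := hv.coeFn_toLp
  have hrep : rep w =ᵐ[volume.restrict (Ioo a b)] fun t => c + ∫ s in a..t, v s :=
    (rep_ae_eq hab w).trans hm.coeFn_toLp
  have hint : ∀ t ∈ Icc a b, ∫ s in a..t, weakDeriv w s = ∫ s in a..t, v s := fun t ht =>
    integral_congr_of_ae hw (left_mem_Icc.2 hab.le) ht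
  have hne : (volume.restrict (Ioo a b)) ≠ 0 := by
    rw [Ne, Measure.restrict_eq_zero]; simp [hab]
  have : (ae (volume.restrict (Ioo a b))).NeBot := ae_neBot.2 hne
  -- The continuous representative and the primitive are so far known to agree only a.e.; one common
  -- point fixes the constant of integration.
  obtain ⟨t, ht, htm⟩ := (hrep.and (ae_restrict_mem measurableSet_Ioo)).exists
  have htm' := Ioo_subset_Icc_self htm
  have ha : rep w a = c := by
    rw [rep_eq_add_integral_weakDeriv, hint t htm'] at ht
    exact add_right_cancel ht
  exact ⟨w, hw, fun t ht => by rw [rep_eq_add_integral_weakDeriv, hint t ht, ha]⟩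

theorem rep_sub (hab : a < b) (w z : H1 a b n) {t : ℝ} (ht : t ∈ Icc a b) :
    rep (w - z) t = rep w t - rep z t :=
  congrArg (fun φ : C(Icc a b, E n) => φ ⟨t, ht⟩) (map_sub (toC hab) w z)

theorem norm_rep_le (hab : a < b) (w : H1 a b n) {t : ℝ} (ht : t ∈ Icc a b) :
    ‖rep w t‖ ≤ ‖toC (n := n) hab‖ * ‖w‖ :=
  ((toC hab w).norm_coe_le_norm ⟨t, ht⟩).trans ((toC hab).le_opNorm w)

/-- On (a, b) the L² norm is at most √(b - a) times the sup norm, and there are two components. This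
carries uniform estimates of trajectories and velocities to the norm of W_T, in which the state
bound and the continuity in y₀ are formulated. -/
theorem norm_sub_le (hab : a < b) (w z : H1 a b n) {η : ℝ} (hη : 0 ≤ η)
    (h : ∀ t ∈ Icc a b, ‖rep w t - rep z t‖ ≤ η)
    (h' : ∀ᵐ t ∂(volume.restrict (Ioo a b)), ‖weakDeriv w t - weakDeriv z t‖ ≤ η) :
    ‖w - z‖ ≤ 2 * Real.sqrt (b - a) * η := by
  have hb0 : 0 ≤ b - a := (sub_pos.2 hab).le
  have bound : ∀ v : L2 a b n, (∀ᵐ t ∂(volume.restrict (Ioo a b)), ‖v t‖ ≤ η) →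
      ‖v‖ ≤ Real.sqrt (b - a) * η := by
    intro v hv
    refine (Lp.norm_le_of_ae_bound hη hv).trans_eq ?_
    have e : ((measureUnivNNReal (volume.restrict (Ioo a b)) : NNReal) : ℝ) = b - a := by
      rw [measureUnivNNReal, Measure.restrict_apply_univ, Real.volume_Ioo]
      exact ENNReal.toReal_ofReal hb0
    rw [e, Real.sqrt_eq_rpow]
    norm_num
  have h1 : ‖(w - z).1.fst‖ ≤ Real.sqrt (b - a) * η := by
    refine bound _ ?_
    filter_upwards [rep_ae_eq hab (w - z), ae_restrict_mem measurableSet_Ioo] with t ht htm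
    rw [← ht, rep_sub hab w z (Ioo_subset_Icc_self htm)]
    exact h t (Ioo_subset_Icc_self htm)
  have h2 : ‖(w - z).1.snd‖ ≤ Real.sqrt (b - a) * η := by
    refine bound _ ?_
    filter_upwards [h', Lp.coeFn_sub w.1.snd z.1.snd] with t ht hs
    have e : (w - z).1.snd = w.1.snd - z.1.snd := rfl
    rw [e, hs]
    exact ht
  have e : ‖w - z‖ = Real.sqrt (‖(w - z).1.fst‖ ^ 2 + ‖(w - z).1.snd‖ ^ 2) :=
    WithLp.prod_norm_eq_of_L2 (w - z).1
  rw [e]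
  refine (Real.sqrt_le_sqrt (y := (‖(w - z).1.fst‖ + ‖(w - z).1.snd‖) ^ 2) ?_).trans ?_
  · nlinarith [norm_nonneg (w - z).1.fst, norm_nonneg (w - z).1.snd]
  · rw [Real.sqrt_sq (by positivity)]
    linarith

theorem continuous_rep (hab : a < b) {Y : Type*} [TopologicalSpace Y] {w : Y → H1 a b n}
    (hw : Continuous w) : Continuous fun q : Y × Icc a b => rep (w q.1) q.2 := by
  have h : Continuous fun y => toC hab (w y) := (toC hab).continuous.comp hw
  exact ContinuousMap.continuous_uncurry_of_continuous ⟨_, h⟩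

end H1

/-! ### Continuity in a parameter, uniformly in time -/

/-- A jointly continuous function is continuous in the parameter, uniformly on compact intervals. -/
theorem eventually_norm_sub_lt {Y X : Type*} [TopologicalSpace Y] [NormedAddCommGroup X] {a b : ℝ}
    {G : Y → ℝ → X} (hG : Continuous fun q : Y × Icc a b => G q.1 q.2) (y₀ : Y) {η : ℝ}
    (hη : 0 < η) : ∀ᶠ y in 𝓝 y₀, ∀ t ∈ Icc a b, ‖G y t - G y₀ t‖ < η := by
  let Φ : C(Y, C(Icc a b, X)) := ContinuousMap.curry ⟨_, hG⟩
  have h := Φ.continuous.tendsto y₀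
  filter_upwards [(Metric.tendsto_nhds.1 h) η hη] with y hy t ht
  rw [ContinuousMap.dist_lt_iff hη] at hy
  have := hy ⟨t, ht⟩
  rwa [dist_eq_norm] at this

/-- Uniform closeness is continuity of the curried map into C([a, b]; X), and currying may be undone
because [a, b] is compact. -/
theorem continuous_of_eventually_norm_sub_lt {Y X : Type*} [TopologicalSpace Y]
    [NormedAddCommGroup X] {a b : ℝ} {G : Y → ℝ → X} (hc : ∀ y, ContinuousOn (G y) (Icc a b))
    (h : ∀ y₀, ∀ η > 0, ∀ᶠ y in 𝓝 y₀, ∀ t ∈ Icc a b, ‖G y t - G y₀ t‖ < η) :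
    Continuous fun q : Y × Icc a b => G q.1 q.2 := by
  let Φ : Y → C(Icc a b, X) := fun y => ⟨fun t => G y t, (hc y).domRestrict⟩
  have hΦ : Continuous Φ := by
    refine continuous_iff_continuousAt.2 fun y₀ => Metric.tendsto_nhds.2 fun η hη => ?_
    filter_upwards [h y₀ η hη] with y hy
    rw [ContinuousMap.dist_lt_iff hη]
    intro t
    rw [dist_eq_norm]
    exact hy t t.2
  exact ContinuousMap.continuous_uncurry_of_continuous ⟨_, hΦ⟩

theorem continuous_setIntegral_of_continuous {Y : Type*} [TopologicalSpace Y]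
    {a b : ℝ} (hab : a ≤ b) {G : Y → ℝ → ℝ}
    (hG : Continuous fun q : Y × Icc a b => G q.1 q.2) :
    Continuous fun y => ∫ t in Ioo a b, G y t := by
  -- G is controlled only for times in [a, b]; precomposing with the projection onto this interval
  -- gives a function continuous for all times with the same integral.
  have h0 : Continuous fun q : Y × ℝ => (q.1, projIcc a b hab q.2) :=
    continuous_fst.prodMk (continuous_projIcc.comp continuous_snd)
  have h1 : Continuous (Function.uncurry fun (y : Y) (t : ℝ) => G y (projIcc a b hab t)) :=
    hG.comp h0
  have h2 := intervalIntegral.continuous_parametric_intervalIntegral_of_continuous'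
    (μ := volume) h1 a b
  refine h2.congr fun y => ?_
  rw [intervalIntegral.integral_of_le hab, integral_Ioc_eq_integral_Ioo]
  refine setIntegral_congr_fun measurableSet_Ioo fun t ht => ?_
  rw [projIcc_of_mem hab (Ioo_subset_Icc_self ht)]

/-- Integration by parts for absolutely continuous curves, obtained coordinate by coordinate from
the scalar case. It is applied to the adjoint state and the difference of two trajectories. -/
theorem integral_inner_deriv_eq_sub {n : ℕ} {a b : ℝ} {p q v w : ℝ → E n} (hab : a ≤ b)
    (hv : IntervalIntegrable v volume a b) (hw : IntervalIntegrable w volume a b)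
    (hp : ∀ t ∈ Icc a b, p t = p a + ∫ s in a..t, v s)
    (hq : ∀ t ∈ Icc a b, q t = q a + ∫ s in a..t, w s) :
    ∫ s in a..b, (inner ℝ (v s) (q s) + inner ℝ (p s) (w s)) =
      inner ℝ (p b) (q b) - inner ℝ (p a) (q a) := by
  have ha : a ∈ Icc a b := left_mem_Icc.2 hab
  have hb : b ∈ Icc a b := right_mem_Icc.2 hab
  have hpc := continuousOn_of_integral_eq ha hv hp
  have hqc := continuousOn_of_integral_eq ha hw hq
  have coord : ∀ {v : ℝ → E n}, IntervalIntegrable v volume a b → ∀ i,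
      IntervalIntegrable (fun s => v s i) volume a b := fun hv i =>
    ⟨(EuclideanSpace.proj (𝕜 := ℝ) i : E n →L[ℝ] ℝ).integrable_comp hv.1,
      (EuclideanSpace.proj (𝕜 := ℝ) i : E n →L[ℝ] ℝ).integrable_comp hv.2⟩
  have coord_eq : ∀ {p v : ℝ → E n}, IntervalIntegrable v volume a b →
      (∀ t ∈ Icc a b, p t = p a + ∫ s in a..t, v s) → ∀ i, ∀ t ∈ Icc a b,
        p t i = p a i + ∫ s in a..t, v s i := by
    intro p v hv hp i t ht
    have hsub : uIcc a t ⊆ uIcc a b := by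
      rw [uIcc_of_le ht.1, uIcc_of_le hab]; exact Icc_subset_Icc_right ht.2
    have := (EuclideanSpace.proj (𝕜 := ℝ) i : E n →L[ℝ] ℝ).intervalIntegral_comp_comm
      (hv.mono_set hsub)
    have h2 : ∫ s in a..t, v s i = (∫ s in a..t, v s) i := by simpa using this
    rw [h2, hp t ht]
    rfl
  have scalar : ∀ i, ∫ s in a..b, (v s i * q s i + p s i * w s i) =
      p b i * q b i - p a i * q a i := by
    intro i
    have hac : ∀ {v : ℝ → E n} (c : ℝ), IntervalIntegrable v volume a b →
        AbsolutelyContinuousOnInterval (fun t => c + ∫ s in a..t, v s i) a b := fun c hv =>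
      (LipschitzOnWith.absolutelyContinuousOnInterval (K := 0)
        (LipschitzWith.const c).lipschitzOnWith).add
        ((coord hv i).absolutelyContinuousOnInterval_intervalIntegral left_mem_uIcc)
    have key := AbsolutelyContinuousOnInterval.integral_deriv_mul_eq_sub
      (hac (p a i) hv) (hac (q a i) hw)
    rw [← coord_eq hv hp i b hb, ← coord_eq hw hq i b hb, ← coord_eq hv hp i a ha,
      ← coord_eq hw hq i a ha] at key
    rw [← key]
    refine intervalIntegral.integral_congr_ae ?_
    filter_upwards [(coord hv i).ae_hasDerivAt_integral, (coord hw i).ae_hasDerivAt_integral]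
      with x hx hx' hxm
    have hxu := uIoc_subset_uIcc hxm
    have hxI : x ∈ Icc a b := by rwa [uIcc_of_le hab] at hxu
    rw [((hx hxu a left_mem_uIcc).const_add (p a i)).deriv,
      ((hx' hxu a left_mem_uIcc).const_add (q a i)).deriv,
      ← coord_eq hv hp i x hxI, ← coord_eq hw hq i x hxI]
  have e : ∀ x y : E n, inner ℝ x y = ∑ i, x i * y i := fun x y => by
    simp [PiLp.inner_apply, mul_comm]
  simp only [e]
  rw [← Finset.sum_sub_distrib, ← Finset.sum_congr rfl fun i _ => scalar i,
    ← intervalIntegral.integral_finsetSum]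
  · simp only [Finset.sum_add_distrib]
  · intro i _
    have hpi : ContinuousOn (fun s => p s i) (uIcc a b) := by
      rw [uIcc_of_le hab]
      exact (EuclideanSpace.proj (𝕜 := ℝ) i : E n →L[ℝ] ℝ).continuous.comp_continuousOn hpc
    have hqi : ContinuousOn (fun s => q s i) (uIcc a b) := by
      rw [uIcc_of_le hab]
      exact (EuclideanSpace.proj (𝕜 := ℝ) i : E n →L[ℝ] ℝ).continuous.comp_continuousOn hqc
    exact ((coord hv i).mul_continuousOn hqi).add ((coord hw i).continuousOn_mul hpi)

end

end FeedbackLearning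

namespace FeedbackLearning

noncomputable section

namespace ControlProblem

variable {n m : ℕ} (P : ControlProblem n m)

/-! ### The cost functional -/

/-- The running cost. -/
def runningCost (y : ℝ → E n) (u : ℝ → E m) (s : ℝ) : ℝ :=
  ‖P.Q₁ (y s - P.yd s)‖ ^ 2 + P.β * ‖u s‖ ^ 2

theorem yd_memLp_of_nonneg {t : ℝ} (ht : 0 ≤ t) : MemLp P.yd 2 (volume.restrict (Ioo t P.T)) :=
  P.yd_memLp.mono_measure (Measure.restrict_mono (Ioo_subset_Ioo_left ht) le_rfl)

theorem integrableOn_runningCost {t : ℝ} (ht : 0 ≤ t) {y : ℝ → E n} {u : ℝ → E m}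
    (hy : ContinuousOn y (Icc t P.T)) (hu : MemLp u 2 (volume.restrict (Ioo t P.T))) :
    IntegrableOn (P.runningCost y u) (Ioo t P.T) := by
  have h1 : MemLp (fun s => P.Q₁ (y s - P.yd s)) 2 (volume.restrict (Ioo t P.T)) :=
    P.Q₁.comp_memLp' ((memLp_two_of_continuousOn hy).sub (P.yd_memLp_of_nonneg ht))
  exact ((memLp_two_iff_integrable_sq_norm h1.1).1 h1).add
    (((memLp_two_iff_integrable_sq_norm hu.1).1 hu).const_mul P.β)

theorem runningCost_nonneg (y : ℝ → E n) (u : ℝ → E m) (s : ℝ) : 0 ≤ P.runningCost y u s := by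
  have := P.β_pos
  unfold runningCost
  positivity

theorem cost_eq (t : ℝ) (y : ℝ → E n) (u : ℝ → E m) : P.cost t y u =
    1 / 2 * (∫ s in Ioo t P.T, P.runningCost y u s) + 1 / 2 * ‖P.Q₂ (y P.T - P.ydT)‖ ^ 2 := rfl

theorem cost_nonneg (t : ℝ) (y : ℝ → E n) (u : ℝ → E m) : 0 ≤ P.cost t y u := by
  rw [cost_eq]
  have : 0 ≤ ∫ s in Ioo t P.T, P.runningCost y u s :=
    integral_nonneg fun s => P.runningCost_nonneg y u s
  positivity

theorem cost_congr {t : ℝ} (ht : t ≤ P.T) {y y' : ℝ → E n} {u u' : ℝ → E m}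
    (hy : ∀ s ∈ Icc t P.T, y s = y' s) (hu : ∀ s ∈ Ioo t P.T, u s = u' s) :
    P.cost t y u = P.cost t y' u' := by
  rw [cost_eq, cost_eq, hy P.T (right_mem_Icc.2 ht)]
  congr 2
  refine setIntegral_congr_fun measurableSet_Ioo fun s hs => ?_
  simp only [runningCost, hy s (Ioo_subset_Icc_self hs), hu s hs]

theorem cost_eq_add {t : ℝ} (ht : t ∈ Icc 0 P.T) {y : ℝ → E n} {u : ℝ → E m}
    (hi : IntegrableOn (P.runningCost y u) (Ioo 0 P.T)) :
    P.cost 0 y u = 1 / 2 * (∫ s in Ioo 0 t, P.runningCost y u s) + P.cost t y u := by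
  have hii : IntervalIntegrable (P.runningCost y u) volume 0 P.T :=
    (intervalIntegrable_iff_integrableOn_Ioo_of_le P.T_pos.le).2 hi
  have e : ∀ a b, a ≤ b → ∫ s in Ioo a b, P.runningCost y u s =
      ∫ s in a..b, P.runningCost y u s := fun a b hab => by
    rw [intervalIntegral.integral_of_le hab, integral_Ioc_eq_integral_Ioo]
  have hm : t ∈ uIcc 0 P.T := by rwa [uIcc_of_le P.T_pos.le]
  rw [cost_eq, cost_eq, e _ _ P.T_pos.le, e _ _ ht.1, e _ _ ht.2,
    ← intervalIntegral.integral_add_adjacent_intervals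
      (hii.mono_set (uIcc_subset_uIcc_left hm)) (hii.mono_set (uIcc_subset_uIcc_right hm))]
  ring

theorem continuousOn_cost {y : ℝ → E n} {u : ℝ → E m}
    (hy : ContinuousOn y (Icc 0 P.T)) (hu : MemLp u 2 (volume.restrict (Ioo 0 P.T))) :
    ContinuousOn (fun t => P.cost t y u) (Icc 0 P.T) := by
  have hi := P.integrableOn_runningCost le_rfl hy hu
  have hii : IntervalIntegrable (P.runningCost y u) volume 0 P.T :=
    (intervalIntegrable_iff_integrableOn_Ioo_of_le P.T_pos.le).2 hi
  have h := intervalIntegral.continuousOn_primitive_interval' hii left_mem_uIcc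
  rw [uIcc_of_le P.T_pos.le] at h
  have h' : ContinuousOn (fun t => P.cost 0 y u - 1 / 2 * ∫ s in 0..t, P.runningCost y u s)
      (Icc 0 P.T) := continuousOn_const.sub (continuousOn_const.mul h)
  refine h'.congr fun t ht => ?_
  simp only [P.cost_eq_add ht hi, intervalIntegral.integral_of_le ht.1,
    integral_Ioc_eq_integral_Ioo]
  ring

theorem abs_norm_sq_sub_norm_sq_le {F : Type*} [NormedAddCommGroup F] {x y : F} {d c : ℝ}
    (h : ‖x - y‖ ≤ d) (hc : ‖x‖ + ‖y‖ ≤ c) : |‖x‖ ^ 2 - ‖y‖ ^ 2| ≤ d * c := by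
  rw [sq_sub_sq, abs_mul, abs_of_nonneg (by positivity), mul_comm]
  have := (abs_norm_sub_norm_le x y).trans h
  have h0 : 0 ≤ d := (norm_nonneg _).trans h
  gcongr

/-- The cost is Lipschitz on bounded sets of continuous states and controls, uniformly in the
initial time. -/
theorem exists_abs_cost_sub_le (R : ℝ) : ∃ K, 0 ≤ K ∧ ∀ t ∈ Icc 0 P.T,
    ∀ (y y' : ℝ → E n) (u u' : ℝ → E m) (η : ℝ), ContinuousOn y (Icc 0 P.T) →
    ContinuousOn y' (Icc 0 P.T) → ContinuousOn u (Icc 0 P.T) → ContinuousOn u' (Icc 0 P.T) →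
    (∀ s ∈ Icc 0 P.T, ‖y s‖ ≤ R ∧ ‖y' s‖ ≤ R ∧ ‖u s‖ ≤ R ∧ ‖u' s‖ ≤ R) →
    (∀ s ∈ Icc 0 P.T, ‖y s - y' s‖ ≤ η ∧ ‖u s - u' s‖ ≤ η) →
    |P.cost t y u - P.cost t y' u'| ≤ K * η := by
  -- The local Lipschitz constant of the running cost. It is unbounded in time because y_d is only
  -- square integrable, but it is integrable on (0, T), which suffices for a constant uniform in the
  -- initial time.
  set k : ℝ → ℝ := fun s => ‖P.Q₁‖ * (‖P.Q₁‖ * (2 * R + 2 * ‖P.yd s‖)) + P.β * (2 * R) with hk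
  have hβ := P.β_pos
  have hydi : Integrable P.yd (volume.restrict (Ioo 0 P.T)) :=
    P.yd_memLp.integrable (by norm_num)
  have hki : IntegrableOn k (Ioo 0 P.T) :=
    (((((integrable_const (2 * R)).add (hydi.norm.const_mul 2)).const_mul _).const_mul _).add
      (integrable_const _))
  set K := 1 / 2 * (∫ s in Ioo 0 P.T, k s) + 1 / 2 * (‖P.Q₂‖ * (‖P.Q₂‖ * (2 * R + 2 * ‖P.ydT‖)))
    with hK
  refine ⟨|K|, abs_nonneg _, fun t ht y y' u u' η hy hy' hu hu' hR hη => ?_⟩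
  have hT : P.T ∈ Icc 0 P.T := right_mem_Icc.2 P.T_pos.le
  have hR0 : 0 ≤ R := (norm_nonneg _).trans (hR _ hT).1
  have hη0 : 0 ≤ η := (norm_nonneg _).trans (hη _ hT).1
  have hk0 : ∀ s, 0 ≤ k s := fun s => by positivity
  have hsub : Ioo t P.T ⊆ Ioo 0 P.T := Ioo_subset_Ioo_left ht.1
  have est : ∀ (Q : E n →L[ℝ] E n) (x x' d : E n), ‖x‖ ≤ R → ‖x'‖ ≤ R → ‖x - x'‖ ≤ η →
      |‖Q (x - d)‖ ^ 2 - ‖Q (x' - d)‖ ^ 2| ≤ ‖Q‖ * η * (‖Q‖ * (2 * R + 2 * ‖d‖)) := by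
    intro Q x x' d hx hx' hxx
    refine abs_norm_sq_sub_norm_sq_le ?_ ?_
    · rw [← map_sub, sub_sub_sub_cancel_right]
      exact (Q.le_opNorm _).trans (by gcongr)
    · have h1 : ‖Q (x - d)‖ ≤ ‖Q‖ * (R + ‖d‖) :=
        (Q.le_opNorm _).trans (by gcongr; exact (norm_sub_le _ _).trans (by gcongr))
      have h2 : ‖Q (x' - d)‖ ≤ ‖Q‖ * (R + ‖d‖) :=
        (Q.le_opNorm _).trans (by gcongr; exact (norm_sub_le _ _).trans (by gcongr))
      linarith
  have hrun : ∀ s ∈ Ioo t P.T, ‖P.runningCost y u s - P.runningCost y' u' s‖ ≤ η * k s := by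
    intro s hs
    obtain ⟨h1, h2, h3, h4⟩ := hR s (Ioo_subset_Icc_self (hsub hs))
    obtain ⟨h5, h6⟩ := hη s (Ioo_subset_Icc_self (hsub hs))
    have e : P.runningCost y u s - P.runningCost y' u' s =
        (‖P.Q₁ (y s - P.yd s)‖ ^ 2 - ‖P.Q₁ (y' s - P.yd s)‖ ^ 2) +
          P.β * (‖u s‖ ^ 2 - ‖u' s‖ ^ 2) := by simp only [runningCost]; ring
    rw [e]
    refine (norm_add_le _ _).trans ?_
    have e1 := est P.Q₁ _ _ (P.yd s) h1 h2 h5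
    have e2 : |‖u s‖ ^ 2 - ‖u' s‖ ^ 2| ≤ η * (2 * R) :=
      abs_norm_sq_sub_norm_sq_le h6 (by linarith)
    rw [Real.norm_eq_abs, norm_mul, Real.norm_of_nonneg hβ.le, Real.norm_eq_abs]
    calc _ ≤ ‖P.Q₁‖ * η * (‖P.Q₁‖ * (2 * R + 2 * ‖P.yd s‖)) + P.β * (η * (2 * R)) := by gcongr
      _ = _ := by rw [hk]; ring
  have hm : ∀ {u : ℝ → E m}, ContinuousOn u (Icc 0 P.T) →
      MemLp u 2 (volume.restrict (Ioo t P.T)) := fun hu =>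
    memLp_two_of_continuousOn (hu.mono (Icc_subset_Icc_left ht.1))
  have hi := P.integrableOn_runningCost ht.1 (hy.mono (Icc_subset_Icc_left ht.1)) (hm hu)
  have hi' := P.integrableOn_runningCost ht.1 (hy'.mono (Icc_subset_Icc_left ht.1)) (hm hu')
  have hint : |(∫ s in Ioo t P.T, P.runningCost y u s) - ∫ s in Ioo t P.T, P.runningCost y' u' s| ≤
      η * ∫ s in Ioo 0 P.T, k s := by
    rw [← integral_sub hi hi', ← Real.norm_eq_abs]
    refine (norm_integral_le_of_norm_le (g := fun s => η * k s)
      ((hki.mono_set hsub).const_mul η) ?_).trans ?_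
    · rw [ae_restrict_iff' measurableSet_Ioo]
      exact ae_of_all _ hrun
    · rw [integral_const_mul]
      refine mul_le_mul_of_nonneg_left ?_ hη0
      exact setIntegral_mono_set hki (ae_of_all _ hk0) hsub.eventuallyLE
  have hend := est P.Q₂ _ _ P.ydT (hR _ hT).1 (hR _ hT).2.1 (hη _ hT).1
  have e : P.cost t y u - P.cost t y' u' =
      1 / 2 * ((∫ s in Ioo t P.T, P.runningCost y u s) - ∫ s in Ioo t P.T, P.runningCost y' u' s) +
      1 / 2 * (‖P.Q₂ (y P.T - P.ydT)‖ ^ 2 - ‖P.Q₂ (y' P.T - P.ydT)‖ ^ 2) := by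
    rw [cost_eq, cost_eq]; ring
  rw [e]
  refine (abs_add_le _ _).trans ?_
  rw [abs_mul, abs_mul, abs_of_pos (by norm_num : (0 : ℝ) < 1 / 2)]
  have : K * η ≤ |K| * η := by gcongr; exact le_abs_self _
  refine le_trans ?_ this
  rw [hK]
  linarith

/-! ### Dynamic programming -/

/-- Passes from curves solving an integral equation, as the existence theory provides them, to
admissible pairs in the H¹ formulation. -/
theorem exists_admissible {t : ℝ} (ht : t < P.T) {x : E n} {z v : ℝ → E n} {u : ℝ → E m}
    (hv : MemLp v 2 (volume.restrict (Ioo t P.T))) (hu : MemLp u 2 (volume.restrict (Ioo t P.T)))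
    (hz : ∀ s ∈ Icc t P.T, z s = x + ∫ r in t..s, v r)
    (hdyn : ∀ᵐ s ∂(volume.restrict (Ioo t P.T)), v s = P.f s (z s) + P.g s (z s) (u s)) :
    ∃ y : H1 t P.T n, P.IsAdmissible t x y u ∧ ∀ s ∈ Icc t P.T, H1.rep y s = z s := by
  obtain ⟨y, hyv, hy⟩ := H1.exists_of_primitive ht x hv
  have hrep : ∀ s ∈ Icc t P.T, H1.rep y s = z s := fun s hs => by rw [hy s hs, hz s hs]
  refine ⟨y, ⟨hu, ?_, ?_⟩, hrep⟩
  · filter_upwards [hyv, hdyn, ae_restrict_mem measurableSet_Ioo] with s h1 h2 hs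
    rw [h1, h2, hrep s (Ioo_subset_Icc_self hs)]
  · rw [hy t (left_mem_Icc.2 ht.le)]; simp

theorem bddBelow_costSet (t : ℝ) (x : E n) : BddBelow (P.costSet t x) :=
  ⟨0, by rintro _ ⟨y, u, -, rfl⟩; exact P.cost_nonneg _ _ _⟩

theorem valueFunction_le_cost {t : ℝ} (ht : t < P.T) {x : E n} {y : H1 t P.T n} {u : ℝ → E m}
    (h : P.IsAdmissible t x y u) : P.valueFunction t x ≤ P.cost t (H1.rep y) u := by
  rw [valueFunction, if_pos ht]
  exact csInf_le (P.bddBelow_costSet t x) ⟨y, u, h, rfl⟩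

/-- Tails of optimal pairs are optimal. -/
theorem valueFunction_eq_cost {y₀ : E n} {y : P.W} {u : ℝ → E m} (h : P.IsOptimalPair y₀ y u)
    {t : ℝ} (ht : t ∈ Ico 0 P.T) :
    P.valueFunction t (H1.rep y t) = P.cost t (H1.rep y) u := by
  classical
  have ht' : t ∈ Icc 0 P.T := Ico_subset_Icc_self ht
  have hT := P.T_pos
  obtain ⟨⟨hu, hdyn, h0⟩, hopt⟩ := h
  have hsub : Ioo t P.T ⊆ Ioo 0 P.T := Ioo_subset_Ioo_left ht.1
  have hv := H1.memLp_weakDeriv y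
  have hvi := H1.intervalIntegrable_weakDeriv hT y
  have hrest : volume.restrict (Ioo t P.T) ≤ volume.restrict (Ioo 0 P.T) :=
    Measure.restrict_mono hsub le_rfl
  have hmt : t ∈ uIcc 0 P.T := by rwa [uIcc_of_le hT.le]
  have tail : ∀ s ∈ Icc t P.T,
      H1.rep y s = H1.rep y t + ∫ r in t..s, H1.weakDeriv y r := fun s hs =>
    H1.rep_eq_rep_add_integral hT y ht' ⟨ht.1.trans hs.1, hs.2⟩
  obtain ⟨z₁, hz₁, hz₁r⟩ := P.exists_admissible ht.2 (x := H1.rep y t) (z := H1.rep y)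
    (hv.mono_measure hrest) (hu.mono_measure hrest) tail
    (ae_restrict_of_ae_restrict_of_subset hsub hdyn)
  rw [← P.cost_congr ht.2.le hz₁r fun s _ => rfl]
  refine le_antisymm (P.valueFunction_le_cost ht.2 hz₁) ?_
  rw [P.cost_congr ht.2.le hz₁r fun s _ => rfl, valueFunction, if_pos ht.2]
  refine le_csInf ⟨_, z₁, u, hz₁, rfl⟩ ?_
  rintro _ ⟨z, w, ⟨hw, hzdyn, hzt⟩, rfl⟩
  -- concatenate the optimal pair on `(0, t)` with a competitor on `(t, T)`
  set v' : ℝ → E n := (Iio t).piecewise (H1.weakDeriv y) (H1.weakDeriv z) with hv'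
  set u' : ℝ → E m := (Iio t).piecewise u w with hu'
  -- The two pieces of the state agree at the junction t, since the competitor starts at the optimal
  -- state there. Velocity and control may be chosen freely at this single time.
  set z' : ℝ → E n := (Iic t).piecewise (H1.rep y) (H1.rep z) with hz'
  have hres1 : (volume.restrict (Ioo 0 P.T)).restrict (Iio t) ≤ volume.restrict (Ioo 0 P.T) :=
    Measure.restrict_le_self
  have hres2 : (volume.restrict (Ioo 0 P.T)).restrict (Iio t)ᶜ ≤ volume.restrict (Ioo t P.T) := by
    rw [Measure.restrict_restrict measurableSet_Iio.compl, compl_Iio]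
    rw [Measure.restrict_congr_set (Ioo_ae_eq_Ico (μ := volume) (a := t) (b := P.T))]
    exact Measure.restrict_mono (by rintro s ⟨h1, h2⟩; exact ⟨h1, h2.2⟩) le_rfl
  have hv'm : MemLp v' 2 (volume.restrict (Ioo 0 P.T)) :=
    MemLp.piecewise measurableSet_Iio (hv.mono_measure hres1)
      ((H1.memLp_weakDeriv z).mono_measure hres2)
  have hu'm : MemLp u' 2 (volume.restrict (Ioo 0 P.T)) :=
    MemLp.piecewise measurableSet_Iio (hu.mono_measure hres1) (hw.mono_measure hres2)
  have hv'i : IntervalIntegrable v' volume 0 P.T :=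
    (intervalIntegrable_iff_integrableOn_Ioo_of_le hT.le).2 (hv'm.integrable (by norm_num))
  have before : ∀ s ∈ Icc 0 t, ∫ r in 0..s, v' r = ∫ r in 0..s, H1.weakDeriv y r := by
    intro s hs
    rw [intervalIntegral.integral_of_le hs.1, intervalIntegral.integral_of_le hs.1,
      integral_Ioc_eq_integral_Ioo, integral_Ioc_eq_integral_Ioo]
    refine setIntegral_congr_fun measurableSet_Ioo fun r hr => ?_
    exact piecewise_eq_of_mem _ _ _ (hr.2.trans_le hs.2)
  have hz'e : ∀ s ∈ Icc 0 P.T, z' s = y₀ + ∫ r in 0..s, v' r := by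
    intro s hs
    rcases le_or_gt s t with hst | hst
    · rw [hz', piecewise_eq_of_mem _ _ _ (mem_Iic.2 hst), before s ⟨hs.1, hst⟩, ← h0]
      exact H1.rep_eq_add_integral_weakDeriv y s
    · have hms : s ∈ uIcc 0 P.T := by rwa [uIcc_of_le hT.le]
      have after : ∫ r in t..s, v' r = ∫ r in t..s, H1.weakDeriv z r := by
        rw [intervalIntegral.integral_of_le hst.le, intervalIntegral.integral_of_le hst.le]
        refine setIntegral_congr_fun measurableSet_Ioc fun r hr => ?_
        exact piecewise_eq_of_notMem _ _ _ (notMem_Iio.2 hr.1.le)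
      rw [hz', piecewise_eq_of_notMem _ _ _ (notMem_Iic.2 hst),
        ← intervalIntegral.integral_add_adjacent_intervals
        (hv'i.mono_set (uIcc_subset_uIcc_left hmt)) (hv'i.mono_set (uIcc_subset_uIcc hmt hms)),
        after, before t ⟨ht.1, le_rfl⟩, ← h0, ← add_assoc, ← H1.rep_eq_add_integral_weakDeriv,
        ← hzt]
      exact H1.rep_eq_add_integral_weakDeriv z s
  have hz'dyn : ∀ᵐ s ∂(volume.restrict (Ioo 0 P.T)), v' s = P.f s (z' s) + P.g s (z' s) (u' s) := by
    rw [ae_restrict_iff' measurableSet_Ioo] at hdyn hzdyn ⊢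
    have hne : ∀ᵐ s : ℝ ∂volume, s ≠ t := by simp [ae_iff, measure_singleton]
    filter_upwards [hdyn, hzdyn, hne] with s h1 h2 h3 hs
    rcases lt_or_gt_of_ne h3 with hst | hst
    · rw [hv', hz', hu', piecewise_eq_of_mem _ _ _ (mem_Iio.2 hst),
        piecewise_eq_of_mem _ _ _ (mem_Iio.2 hst), piecewise_eq_of_mem _ _ _ (mem_Iic.2 hst.le)]
      exact h1 hs
    · rw [hv', hz', hu', piecewise_eq_of_notMem _ _ _ (notMem_Iio.2 hst.le),
        piecewise_eq_of_notMem _ _ _ (notMem_Iio.2 hst.le),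
        piecewise_eq_of_notMem _ _ _ (notMem_Iic.2 hst)]
      exact h2 ⟨hst, hs.2⟩
  obtain ⟨c, hc, hcr⟩ := P.exists_admissible hT hv'm hu'm hz'e hz'dyn
  have hle := hopt c u' hc
  have hicost := P.integrableOn_runningCost le_rfl (H1.continuousOn_rep hT y) hu
  have hicost' := P.integrableOn_runningCost le_rfl (H1.continuousOn_rep hT c) hu'm
  -- Both pairs have the same running cost on (0, t), so their optimality comparison on (0, T)
  -- reduces to one on (t, T).
  rw [P.cost_eq_add ht' hicost, P.cost_eq_add ht' hicost'] at hle
  have e1 : ∫ s in Ioo 0 t, P.runningCost (H1.rep c) u' s =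
      ∫ s in Ioo 0 t, P.runningCost (H1.rep y) u s := by
    refine setIntegral_congr_fun measurableSet_Ioo fun s hs => ?_
    simp only [runningCost]
    rw [hcr s ⟨hs.1.le, hs.2.le.trans ht.2.le⟩, hz', hu',
      piecewise_eq_of_mem _ _ _ (mem_Iic.2 hs.2.le), piecewise_eq_of_mem _ _ _ (mem_Iio.2 hs.2)]
  have e2 : P.cost t (H1.rep c) u' = P.cost t (H1.rep z) w := by
    refine P.cost_congr ht.2.le (fun s hs => ?_) fun s hs =>
      piecewise_eq_of_notMem _ _ _ (notMem_Iio.2 hs.1.le)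
    rw [hcr s ⟨ht.1.trans hs.1, hs.2⟩, hz']
    rcases hs.1.eq_or_lt with rfl | hst
    · rw [piecewise_eq_of_mem _ _ _ (mem_Iic.2 le_rfl), hzt]
    · exact piecewise_eq_of_notMem _ _ _ (notMem_Iic.2 hst)
  rw [e1, e2] at hle
  linarith

end ControlProblem

end

end FeedbackLearning

namespace FeedbackLearning

noncomputable section

set_option linter.unusedSectionVars false

/-! ### Control curves as fields, and Taylor remainders -/

section Tame

variable {X Y : Type*} [NormedAddCommGroup X] [NormedSpace ℝ X] [NormedAddCommGroup Y]
  [NormedSpace ℝ Y] {I : Set ℝ} {B : Set X}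

/-- Lets a fixed open loop control be treated as a feedback that ignores the state, so the feedback
lemmas apply to it. -/
theorem TameOn.of_curve {u : ℝ → Y} (hu : ContinuousOn u I) : TameOn I B fun t _ => u t :=
  ⟨hu.comp continuousOn_fst fun _ hq => hq.1, 0, le_rfl, fun t _ x _ y _ => by simp⟩

theorem TameOn.mono {φ : ℝ → X → Y} (h : TameOn I B φ) {J : Set ℝ} (hJ : J ⊆ I) :
    TameOn J B φ := by
  obtain ⟨L, hL0, hL⟩ := h.lip
  exact ⟨h.cont.mono (prod_mono_left hJ), L, hL0, fun t ht => hL t (hJ ht)⟩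

/-- First order Taylor expansion with quadratic remainder. -/
theorem exists_norm_taylor_le {G : ℝ → X → Y} (hB : Convex ℝ B)
    (hG : ∀ t ∈ I, Differentiable ℝ (G t)) (hD : TameOn I B fun t y => fderiv ℝ (G t) y) :
    ∃ L, 0 ≤ L ∧ ∀ t ∈ I, ∀ x ∈ B, ∀ y ∈ B,
      ‖G t y - G t x - fderiv ℝ (G t) x (y - x)‖ ≤ L * ‖y - x‖ ^ 2 := by
  obtain ⟨L, hL0, hL⟩ := hD.lip
  refine ⟨L, hL0, fun t ht x hx y hy => ?_⟩
  -- On this smaller convex set the derivative deviates from its value at x by at most L‖y - x‖, so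
  -- the mean value inequality gives a second factor ‖y - x‖.
  have hconv : Convex ℝ (B ∩ Metric.closedBall x ‖y - x‖) := hB.inter (convex_closedBall _ _)
  refine (hconv.norm_image_sub_le_of_norm_fderiv_le' (𝕜 := ℝ) (C := L * ‖y - x‖)
    (fun z _ => hG t ht z) (fun z hz => ?_) ⟨hx, by simp⟩ ⟨hy, by simp [dist_eq_norm]⟩).trans_eq
    (by ring)
  have hz2 : ‖z - x‖ ≤ ‖y - x‖ := by simpa [dist_eq_norm] using hz.2
  exact (hL t ht z hz.1 x hx).trans (by gcongr)

end Tame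

namespace ControlProblem

variable {n m : ℕ} (P : ControlProblem n m) {M : ℝ}

/-! ### The state ball -/

theorem Mhat_nonneg (hM : 0 < M) : 0 ≤ P.Mhat M := by
  unfold Mhat; positivity

/-- The state ball has radius 2M̂, which leaves room M̂ around every point of norm at most M̂. For n
> 0 this room is positive because constant curves show that the embedding is nonzero; for n = 0
there is only one point. -/
theorem exists_closedBall_subset_stateBall (hM : 0 < M) :
    ∃ r > 0, ∀ x : E n, ‖x‖ ≤ P.Mhat M → Metric.closedBall x r ⊆ P.stateBall M := by
  rcases subsingleton_or_nontrivial (E n) with hs | hs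
  · refine ⟨1, one_pos, fun x _ z _ => ?_⟩
    rw [Subsingleton.elim z 0, stateBall]
    simpa using P.Mhat_nonneg hM
  · obtain ⟨c, hc⟩ := exists_ne (0 : E n)
    have hpos : 0 < P.Mhat M := by
      obtain ⟨w, -, hw⟩ := H1.exists_of_primitive P.T_pos c (v := 0) MemLp.zero
      have h0 : (0 : ℝ) ∈ Icc 0 P.T := left_mem_Icc.2 P.T_pos.le
      have h1 := H1.norm_rep_le P.T_pos w h0
      rw [hw 0 h0] at h1
      have h2 : 0 < ‖c‖ := norm_pos_iff.2 hc
      refine mul_pos hM ((ContinuousLinearMap.opNorm_nonneg _).lt_of_ne' fun h => ?_)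
      rw [h] at h1
      simp at h1
      exact hc h1
    refine ⟨_, hpos, fun x hx z hz => ?_⟩
    rw [stateBall, mem_closedBall_zero_iff]
    rw [Metric.mem_closedBall, dist_eq_norm] at hz
    have := norm_le_norm_add_norm_sub' z x
    linarith

theorem isCompact_stateBall : IsCompact (P.stateBall M) := isCompact_closedBall _ _

theorem convex_stateBall : Convex ℝ (P.stateBall M) := convex_closedBall _ _

/-- A convex set with nonempty interior has unique derivatives; this gives gradients within the
closed ball their meaning at boundary points too. -/
theorem uniqueDiffOn_stateBall (hM : 0 < M) : UniqueDiffOn ℝ (P.stateBall M) := by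
  refine uniqueDiffOn_convex P.convex_stateBall ?_
  obtain ⟨r, hr, h⟩ := P.exists_closedBall_subset_stateBall hM
  exact ⟨0, mem_interior_iff_mem_nhds.2 (mem_of_superset (Metric.closedBall_mem_nhds 0 hr)
    (h 0 (by simpa using P.Mhat_nonneg hM)))⟩

theorem mem_stateBall {x : E n} (hM : 0 < M) (hx : ‖x‖ ≤ P.Mhat M) : x ∈ P.stateBall M := by
  obtain ⟨r, hr, h⟩ := P.exists_closedBall_subset_stateBall hM
  exact h x hx (Metric.mem_closedBall_self hr.le)

theorem norm_rep_le_Mhat {y : P.W} (hy : ‖y‖ ≤ M) {t : ℝ} (ht : t ∈ Icc 0 P.T) :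
    ‖H1.rep y t‖ ≤ P.Mhat M := by
  refine (H1.norm_rep_le P.T_pos y ht).trans ?_
  rw [Mhat, mul_comm]
  gcongr

/-! ### Regularity of the data -/

theorem uniqueDiffOn_time : UniqueDiffOn ℝ (Icc 0 P.T) := uniqueDiffOn_Icc P.T_pos

section Dynamics

variable {P} (hdyn : P.SmoothDynamics)
include hdyn

theorem SmoothDynamics.tame_f : TameOn (Icc 0 P.T) (P.stateBall M) P.f :=
  tameOn_of_contDiffOn P.uniqueDiffOn_time isCompact_Icc uniqueDiffOn_univ
    (hdyn.f_contDiff.of_le (by norm_num)) (subset_univ _) P.isCompact_stateBall P.convex_stateBall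

theorem SmoothDynamics.tame_g : TameOn (Icc 0 P.T) (P.stateBall M) P.g :=
  tameOn_of_contDiffOn P.uniqueDiffOn_time isCompact_Icc uniqueDiffOn_univ
    (hdyn.g_contDiff.of_le (by norm_num)) (subset_univ _) P.isCompact_stateBall P.convex_stateBall

theorem SmoothDynamics.differentiable_f {t : ℝ} (ht : t ∈ Icc 0 P.T) :
    Differentiable ℝ (P.f t) :=
  differentiableOn_univ.1 ((fderivWithin_slice P.uniqueDiffOn_time uniqueDiffOn_univ
    (hdyn.f_contDiff.of_le (by norm_num))).1 t ht)

theorem SmoothDynamics.differentiable_g {t : ℝ} (ht : t ∈ Icc 0 P.T) :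
    Differentiable ℝ (P.g t) :=
  differentiableOn_univ.1 ((fderivWithin_slice P.uniqueDiffOn_time uniqueDiffOn_univ
    (hdyn.g_contDiff.of_le (by norm_num))).1 t ht)

theorem SmoothDynamics.tame_fderiv_f :
    TameOn (Icc 0 P.T) (P.stateBall M) fun t y => fderiv ℝ (P.f t) y := by
  obtain ⟨L, hL⟩ := hdyn.f_lipschitz _ (P.isCompact_stateBall (M := M))
  refine ⟨?_, L, L.2, fun t ht x hx y hy => (hL t ht).1.norm_sub_le hx hy⟩
  have := (fderivWithin_slice P.uniqueDiffOn_time uniqueDiffOn_univ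
    (hdyn.f_contDiff.of_le (by norm_num))).2
  simp only [fderivWithin_univ] at this
  exact this.mono (prod_mono_right (subset_univ _))

theorem SmoothDynamics.tame_fderiv_g :
    TameOn (Icc 0 P.T) (P.stateBall M) fun t y => fderiv ℝ (P.g t) y := by
  obtain ⟨L, hL⟩ := hdyn.g_lipschitz _ (P.isCompact_stateBall (M := M))
  refine ⟨?_, L, L.2, fun t ht x hx y hy => (hL t ht).1.norm_sub_le hx hy⟩
  have := (fderivWithin_slice P.uniqueDiffOn_time uniqueDiffOn_univ
    (hdyn.g_contDiff.of_le (by norm_num))).2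
  simp only [fderivWithin_univ] at this
  exact this.mono (prod_mono_right (subset_univ _))

theorem SmoothDynamics.tame_feedback {q : ℝ → E n → E n}
    (hq : TameOn (Icc 0 P.T) (P.stateBall M) q) :
    TameOn (Icc 0 P.T) (P.stateBall M) (P.feedback q) := by
  have h1 : TameOn (Icc 0 P.T) (P.stateBall M) fun t y => ContinuousLinearMap.adjoint (P.g t y) :=
    hdyn.tame_g.comp_lipschitz (ContinuousLinearMap.adjoint (𝕜 := ℝ)).isometry.lipschitz
  exact (TameOn.bilin (ContinuousLinearMap.id ℝ (E n →L[ℝ] E m)) h1 hq isCompact_Icc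
    P.isCompact_stateBall).comp_lipschitz (lipschitzWith_smul (-(1 / P.β)))

/-- The dynamics with a time dependent feedback `F`. -/
theorem SmoothDynamics.tame_dynamics {F : ℝ → E n → E m}
    (hF : TameOn (Icc 0 P.T) (P.stateBall M) F) :
    TameOn (Icc 0 P.T) (P.stateBall M) fun t y => P.f t y + P.g t y (F t y) :=
  hdyn.tame_f.add (TameOn.bilin (ContinuousLinearMap.id ℝ (E m →L[ℝ] E n)) hdyn.tame_g hF
    isCompact_Icc P.isCompact_stateBall)

end Dynamics

/-- The operator of the adjoint equation for the state `y` and the control `u`. -/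
def adjointOp (t : ℝ) (y : E n) (u : E m) : E n →L[ℝ] E n :=
  ContinuousLinearMap.adjoint (fderiv ℝ (P.f t) y + (fderiv ℝ (P.g t) y).flip u)

section Dynamics

variable {P} (hdyn : P.SmoothDynamics)
include hdyn

theorem SmoothDynamics.tame_adjointOp {F : ℝ → E n → E m}
    (hF : TameOn (Icc 0 P.T) (P.stateBall M) F) :
    TameOn (Icc 0 P.T) (P.stateBall M) fun t y => P.adjointOp t y (F t y) := by
  have h1 : TameOn (Icc 0 P.T) (P.stateBall M) fun t y => (fderiv ℝ (P.g t) y).flip :=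
    hdyn.tame_fderiv_g.comp_lipschitz
      (ContinuousLinearMap.flipₗᵢ ℝ (E n) (E m) (E n)).isometry.lipschitz
  have h2 : TameOn (Icc 0 P.T) (P.stateBall M) fun t y => (fderiv ℝ (P.g t) y).flip (F t y) :=
    TameOn.bilin (ContinuousLinearMap.id ℝ (E m →L[ℝ] E n →L[ℝ] E n)) h1 hF isCompact_Icc
      P.isCompact_stateBall
  exact (hdyn.tame_fderiv_f.add h2).comp_lipschitz
    (ContinuousLinearMap.adjoint (𝕜 := ℝ)).isometry.lipschitz

/-- The derivative of z ↦ g(t, z)u for frozen u is the flipped derivative of g evaluated at u. In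
the flipped form the dependence on u is visibly linear, which the norm estimates use. -/
theorem SmoothDynamics.adjointOp_apply {t : ℝ} (ht : t ∈ Icc 0 P.T) (y : E n) (u : E m)
    (p : E n) : P.adjointOp t y u p = ContinuousLinearMap.adjoint (fderiv ℝ (P.f t) y) p +
      ContinuousLinearMap.adjoint (fderiv ℝ (fun z => P.g t z u) y) p := by
  have e : fderiv ℝ (fun z => P.g t z u) y = (fderiv ℝ (P.g t) y).flip u := by
    have h := (hdyn.differentiable_g ht y).hasFDerivAt.clm_apply (hasFDerivAt_const u y)
    rw [h.fderiv]
    ext z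
    simp
  rw [e, adjointOp, map_add]
  rfl

end Dynamics

theorem norm_feedback_sub_le (q q' : ℝ → E n → E n) (t : ℝ) (y : E n) :
    ‖P.feedback q t y - P.feedback q' t y‖ ≤ 1 / P.β * ‖P.g t y‖ * ‖q t y - q' t y‖ := by
  have hβ := P.β_pos
  rw [feedback, feedback, ← smul_sub, ← map_sub, norm_smul, norm_neg,
    Real.norm_of_nonneg (by positivity), mul_assoc]
  gcongr
  refine (ContinuousLinearMap.le_opNorm _ _).trans_eq ?_
  rw [LinearIsometryEquiv.norm_map]

section Value

variable {P} (hval : P.SmoothValue M)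
include hval

theorem SmoothValue.differentiableOn {t : ℝ} (ht : t ∈ Icc 0 P.T) :
    DifferentiableOn ℝ (P.valueFunction t) (P.stateBall M) :=
  (fderivWithin_slice P.uniqueDiffOn_time (P.uniqueDiffOn_stateBall hval.M_pos)
    (hval.contDiff.of_le (by norm_num))).1 t ht

theorem SmoothValue.tame_gradBall :
    TameOn (Icc 0 P.T) (P.stateBall M) (P.gradBall M P.valueFunction) := by
  obtain ⟨L, hL⟩ := hval.lipschitz
  refine ⟨?_, L, L.2, fun t ht x hx y hy => (hL t ht).1.norm_sub_le hx hy⟩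
  have := (fderivWithin_slice P.uniqueDiffOn_time (P.uniqueDiffOn_stateBall hval.M_pos)
    (hval.contDiff.of_le (by norm_num))).2
  exact (InnerProductSpace.toDual ℝ (E n)).symm.continuous.comp_continuousOn this

theorem SmoothValue.tame_valueFunction :
    TameOn (Icc 0 P.T) (P.stateBall M) P.valueFunction :=
  tameOn_of_contDiffOn P.uniqueDiffOn_time isCompact_Icc (P.uniqueDiffOn_stateBall hval.M_pos)
    (hval.contDiff.of_le (by norm_num)) subset_rfl P.isCompact_stateBall P.convex_stateBall

end Value

/-! ### Spatial gradients of approximate value functions -/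

section Approx

variable {V : ℝ → E n → ℝ} (hV : ContDiff ℝ 2 fun q : ℝ × E n => V q.1 q.2)
include hV

theorem contDiff_gradient : ContDiff ℝ 1 fun q : ℝ × E n => gradient (V q.1) q.2 := by
  have h : ContDiff ℝ 1 fun q : ℝ × E n => fderiv ℝ (V q.1) q.2 :=
    ContDiff.fderiv (f := fun q : ℝ × E n => V q.1) (g := fun q => q.2) (m := 2) (n := 1)
      (hV.comp (f := fun r : (ℝ × E n) × E n => (r.1.1, r.2)) (by fun_prop)) contDiff_snd
      (by norm_num)
  exact (InnerProductSpace.toDual ℝ (E n)).symm.contDiff.comp h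

theorem tame_gradient :
    TameOn (Icc 0 P.T) (P.stateBall M) fun t y => gradient (V t) y :=
  tameOn_of_contDiffOn P.uniqueDiffOn_time isCompact_Icc uniqueDiffOn_univ
    (contDiff_gradient hV).contDiffOn (subset_univ _) P.isCompact_stateBall P.convex_stateBall

theorem gradBall_sub_eq (hval : P.SmoothValue M) {t : ℝ} (ht : t ∈ Icc 0 P.T) {y : E n}
    (hy : y ∈ P.stateBall M) :
    P.gradBall M (fun s z => V s z - P.valueFunction s z) t y =
      gradient (V t) y - P.gradBall M P.valueFunction t y := by
  have hu := P.uniqueDiffOn_stateBall hval.M_pos y hy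
  have hd : DifferentiableAt ℝ (V t) y :=
    ((hV.comp (f := fun z : E n => (t, z)) (by fun_prop)).differentiable (by norm_num)) y
  simp only [gradBall, gradientWithin, gradient]
  rw [fderivWithin_fun_sub hu hd.differentiableWithinAt (hval.differentiableOn ht y hy),
    hd.fderivWithin hu, map_sub]

end Approx

end ControlProblem

end

end FeedbackLearning

namespace FeedbackLearning

noncomputable section

namespace ControlProblem

variable {n m : ℕ} (P : ControlProblem n m) {M : ℝ}

/-! ### The adjoint equation and the gradient of the value function -/

/-- The inhomogeneity of the adjoint equation. -/
def adjointSource (t : ℝ) (y : E n) : E n := ContinuousLinearMap.adjoint P.Q₁ (P.Q₁ (y - P.yd t))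

theorem intervalIntegrable_adjointSource {y : ℝ → E n} (hy : ContinuousOn y (Icc 0 P.T)) :
    IntervalIntegrable (fun s => P.adjointSource s (y s)) volume 0 P.T := by
  rw [intervalIntegrable_iff_integrableOn_Ioo_of_le P.T_pos.le]
  have h := ((memLp_two_of_continuousOn hy).sub P.yd_memLp).integrable (by norm_num)
  exact (ContinuousLinearMap.adjoint P.Q₁ ∘L P.Q₁).integrable_comp h

/-- `p` solves the adjoint equation along the state `y` and the control `u` in integrated form. -/
structure IsAdjointCurve (y : ℝ → E n) (u : ℝ → E m) (p : ℝ → E n) : Prop where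
  cont : ContinuousOn p (Icc 0 P.T)
  terminal : p P.T = ContinuousLinearMap.adjoint P.Q₂ (P.Q₂ (y P.T - P.ydT))
  eq : ∀ t ∈ Icc 0 P.T,
    p t = p P.T + ∫ s in t..P.T, (P.adjointOp s (y s) (u s) (p s) + P.adjointSource s (y s))

/-- Second order estimate of the change of the cost under a change of the initial value. -/
theorem cost_sub_le_of_isAdjointCurve {t : ℝ} (ht : t ∈ Ico 0 P.T) {y z v w p : ℝ → E n}
    {u : ℝ → E m} {C D R : ℝ} (hC : 0 ≤ C) (hR : 0 ≤ R)
    (hyc : ContinuousOn y (Icc 0 P.T)) (hzc : ContinuousOn z (Icc t P.T))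
    (hu : MemLp u 2 (volume.restrict (Ioo t P.T)))
    (hv : IntervalIntegrable v volume t P.T) (hw : IntervalIntegrable w volume t P.T)
    (hy : ∀ s ∈ Icc t P.T, y s = y t + ∫ r in t..s, v r)
    (hz : ∀ s ∈ Icc t P.T, z s = z t + ∫ r in t..s, w r)
    (hA : ContinuousOn (fun s => P.adjointOp s (y s) (u s)) (Icc 0 P.T))
    (hp : P.IsAdjointCurve y u p) (hpR : ∀ s ∈ Icc t P.T, ‖p s‖ ≤ R)
    (hlin : ∀ᵐ s ∂(volume.restrict (Ioo t P.T)),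
      ‖w s - v s - ContinuousLinearMap.adjoint (P.adjointOp s (y s) (u s)) (z s - y s)‖ ≤
        C * ‖z s - y s‖ ^ 2)
    (hD : ∀ s ∈ Icc t P.T, ‖z s - y s‖ ≤ D) :
    P.cost t z u - P.cost t y u ≤ inner ℝ (p t) (z t - y t) +
      ((R * C + ‖P.Q₁‖ ^ 2 / 2) * P.T + ‖P.Q₂‖ ^ 2 / 2) * D ^ 2 := by
  have htT := ht.2.le
  have hT := P.T_pos
  have hsubI : Icc t P.T ⊆ Icc 0 P.T := Icc_subset_Icc_left ht.1
  have hm : P.T ∈ Icc t P.T := right_mem_Icc.2 htT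
  have hmt : t ∈ Icc t P.T := left_mem_Icc.2 htT
  have hD0 : 0 ≤ D := (norm_nonneg _).trans (hD t hmt)
  have hyct := hyc.mono hsubI
  set δ : ℝ → E n := fun s => z s - y s with hδ
  have hδc : ContinuousOn δ (Icc t P.T) := hzc.sub hyct
  set c : ℝ → E n := fun s => P.adjointSource s (y s) with hc
  set A : ℝ → E n →L[ℝ] E n := fun s => P.adjointOp s (y s) (u s) with hAdef
  have huI : uIcc t P.T = Icc t P.T := uIcc_of_le htT
  have huT : uIcc t P.T ⊆ uIcc 0 P.T := by rwa [huI, uIcc_of_le hT.le]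
  have hci : IntervalIntegrable c volume t P.T :=
    (P.intervalIntegrable_adjointSource hyc).mono_set huT
  have hApc : ContinuousOn (fun s => A s (p s)) (Icc t P.T) := (hA.clm_apply hp.cont).mono hsubI
  have hApi : IntervalIntegrable (fun s => A s (p s)) volume t P.T :=
    (by rwa [huI] : ContinuousOn (fun s => A s (p s)) (uIcc t P.T)).intervalIntegrable
  have hδe : ∀ s ∈ Icc t P.T, δ s = δ t + ∫ r in t..s, (w r - v r) := by
    intro s hs
    have hsub : uIcc t s ⊆ uIcc t P.T := by
      rw [uIcc_of_le hs.1, huI]; exact Icc_subset_Icc_right hs.2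
    rw [intervalIntegral.integral_sub (hw.mono_set hsub) (hv.mono_set hsub)]
    simp only [hδ]
    rw [hz s hs, hy s hs]; abel
  have hpe : ∀ s ∈ Icc t P.T, p s = p t + ∫ r in t..s, -(A r (p r) + c r) := by
    intro s hs
    have hsum := hApi.add hci
    have h1 := hp.eq s (hsubI hs)
    have h2 := hp.eq t (hsubI hmt)
    have hms : s ∈ uIcc t P.T := by rwa [huI]
    have h3 := intervalIntegral.integral_add_adjacent_intervals
      (hsum.mono_set (uIcc_subset_uIcc_left hms)) (hsum.mono_set (uIcc_subset_uIcc_right hms))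
    rw [intervalIntegral.integral_neg, h1, h2, ← h3]
    abel
  have key := integral_inner_deriv_eq_sub htT (hApi.add hci).neg (hw.sub hv) hpe hδe
  simp only [Pi.neg_apply] at key
  -- the integrands
  have hδcu : ContinuousOn δ (uIcc t P.T) := by rwa [huI]
  have hpcu : ContinuousOn p (uIcc t P.T) := by rw [huI]; exact hp.cont.mono hsubI
  have inner_int : ∀ {a b : ℝ → E n}, ContinuousOn a (uIcc t P.T) →
      IntervalIntegrable b volume t P.T →
      IntervalIntegrable (fun s => inner ℝ (b s) (a s)) volume t P.T := by
    intro a b ha hb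
    obtain ⟨K, hK⟩ := isCompact_uIcc.exists_bound_of_continuousOn ha
    rw [intervalIntegrable_iff] at hb ⊢
    have ham : AEStronglyMeasurable a (volume.restrict (uIoc t P.T)) :=
      (ha.mono uIoc_subset_uIcc).aestronglyMeasurable measurableSet_uIoc
    refine Integrable.mono' (hb.norm.mul_const K) (hb.1.inner ham) ?_
    rw [ae_restrict_iff' measurableSet_uIoc]
    refine ae_of_all _ fun s hs => (norm_inner_le_norm _ _).trans ?_
    gcongr
    exact hK s (uIoc_subset_uIcc hs)
  have hkeyi : IntervalIntegrable (fun s => inner ℝ (-(A s (p s) + c s)) (δ s) +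
      inner ℝ (p s) (w s - v s)) volume t P.T := by
    refine (inner_int hδcu (hApi.add hci).neg).add ?_
    simpa only [real_inner_comm] using inner_int hpcu (hw.sub hv)
  have hicost := P.integrableOn_runningCost ht.1 hyct hu
  have hicost' := P.integrableOn_runningCost ht.1 hzc hu
  have conv : ∀ φ : ℝ → ℝ, ∫ s in Ioo t P.T, φ s = ∫ s in t..P.T, φ s := fun φ => by
    rw [intervalIntegral.integral_of_le htT, integral_Ioc_eq_integral_Ioo]
  have hrun : ∀ s, P.runningCost z u s - P.runningCost y u s =
      2 * inner ℝ (c s) (δ s) + ‖P.Q₁ (δ s)‖ ^ 2 := by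
    intro s
    have e : P.Q₁ (z s - P.yd s) = P.Q₁ (y s - P.yd s) + P.Q₁ (δ s) := by
      rw [← map_add]; congr 1; simp only [hδ]; abel
    simp only [runningCost, hc, adjointSource]
    rw [e, norm_add_sq_real, ContinuousLinearMap.adjoint_inner_left]
    ring
  have hterm : ‖P.Q₂ (z P.T - P.ydT)‖ ^ 2 - ‖P.Q₂ (y P.T - P.ydT)‖ ^ 2 =
      2 * inner ℝ (p P.T) (δ P.T) + ‖P.Q₂ (δ P.T)‖ ^ 2 := by
    have e : P.Q₂ (z P.T - P.ydT) = P.Q₂ (y P.T - P.ydT) + P.Q₂ (δ P.T) := by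
      rw [← map_add]; congr 1; simp only [hδ]; abel
    rw [e, norm_add_sq_real, hp.terminal, ContinuousLinearMap.adjoint_inner_left]
    ring
  have hruni : IntervalIntegrable (fun s => P.runningCost z u s - P.runningCost y u s)
      volume t P.T :=
    (intervalIntegrable_iff_integrableOn_Ioo_of_le htT).2 (hicost'.sub hicost)
  -- The terminal cost contributes ⟨p(T), δ(T)⟩ to first order; the integration by parts moves it to
  -- ⟨p(t), δ(t)⟩ plus an integral.
  have hcost : P.cost t z u - P.cost t y u = inner ℝ (p t) (δ t) + 1 / 2 * ‖P.Q₂ (δ P.T)‖ ^ 2 +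
      ∫ s in t..P.T, (1 / 2 * (P.runningCost z u s - P.runningCost y u s) +
        (inner ℝ (-(A s (p s) + c s)) (δ s) + inner ℝ (p s) (w s - v s))) := by
    rw [intervalIntegral.integral_add (hruni.const_mul _) hkeyi, key,
      intervalIntegral.integral_const_mul, ← conv, integral_sub hicost' hicost, cost_eq, cost_eq]
    linarith
  have hbound : ∀ᵐ s ∂(volume.restrict (Ioo t P.T)),
      1 / 2 * (P.runningCost z u s - P.runningCost y u s) +
        (inner ℝ (-(A s (p s) + c s)) (δ s) + inner ℝ (p s) (w s - v s)) ≤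
      (R * C + ‖P.Q₁‖ ^ 2 / 2) * D ^ 2 := by
    filter_upwards [hlin, ae_restrict_mem measurableSet_Ioo] with s hs hsm
    have hsI := Ioo_subset_Icc_self hsm
    -- The adjoint equation makes all first order terms cancel. What remains is the Taylor remainder
    -- of the dynamics tested with p and the quadratic part of the running cost.
    have e : 1 / 2 * (P.runningCost z u s - P.runningCost y u s) +
        (inner ℝ (-(A s (p s) + c s)) (δ s) + inner ℝ (p s) (w s - v s)) =
        inner ℝ (p s) (w s - v s - ContinuousLinearMap.adjoint (A s) (δ s)) +
          1 / 2 * ‖P.Q₁ (δ s)‖ ^ 2 := by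
      rw [hrun, inner_sub_right (p s) (w s - v s), ContinuousLinearMap.adjoint_inner_right, inner_neg_left,
        inner_add_left]
      ring
    rw [e]
    have hd2 : ‖δ s‖ ^ 2 ≤ D ^ 2 := by gcongr; exact hD s hsI
    have h1 : inner ℝ (p s) (w s - v s - ContinuousLinearMap.adjoint (A s) (δ s)) ≤
        R * (C * D ^ 2) := by
      refine (real_inner_le_norm _ _).trans ?_
      have := hs.trans (mul_le_mul_of_nonneg_left hd2 hC)
      have := hpR s hsI
      gcongr
    have h2 : ‖P.Q₁ (δ s)‖ ^ 2 ≤ ‖P.Q₁‖ ^ 2 * D ^ 2 := by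
      rw [← mul_pow]
      have := P.Q₁.le_opNorm_of_le (hD s hsI)
      gcongr
    linarith
  have hint : ∫ s in t..P.T, (1 / 2 * (P.runningCost z u s - P.runningCost y u s) +
      (inner ℝ (-(A s (p s) + c s)) (δ s) + inner ℝ (p s) (w s - v s))) ≤
      (R * C + ‖P.Q₁‖ ^ 2 / 2) * P.T * D ^ 2 := by
    have h1 : ∫ s in t..P.T, (1 / 2 * (P.runningCost z u s - P.runningCost y u s) +
        (inner ℝ (-(A s (p s) + c s)) (δ s) + inner ℝ (p s) (w s - v s))) ≤
        ∫ _ in t..P.T, (R * C + ‖P.Q₁‖ ^ 2 / 2) * D ^ 2 := by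
      refine intervalIntegral.integral_mono_ae_restrict htT ((hruni.const_mul _).add hkeyi)
        intervalIntegrable_const ?_
      rwa [← Measure.restrict_congr_set Ioo_ae_eq_Icc]
    refine h1.trans ?_
    rw [intervalIntegral.integral_const, smul_eq_mul]
    have h0 : 0 ≤ (R * C + ‖P.Q₁‖ ^ 2 / 2) * D ^ 2 := by positivity
    nlinarith [mul_nonneg ht.1 h0]
  have h2 : ‖P.Q₂ (δ P.T)‖ ^ 2 ≤ ‖P.Q₂‖ ^ 2 * D ^ 2 := by
    rw [← mul_pow]
    have := P.Q₂.le_opNorm_of_le (hD _ hm)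
    gcongr
  rw [hcost]
  linarith

/-- Along an optimal trajectory the gradient of the value function is the adjoint state. -/
theorem gradBall_valueFunction_eq (hdyn : P.SmoothDynamics) (hval : P.SmoothValue M)
    {y₀ : E n} {y : P.W} {u : ℝ → E m} {p : ℝ → E n} (hu : ContinuousOn u (Icc 0 P.T))
    (hopt : P.IsOptimalPair y₀ y u) (hyM : ∀ t ∈ Icc 0 P.T, ‖H1.rep y t‖ ≤ P.Mhat M)
    (hp : P.IsAdjointCurve (H1.rep y) u p) {t : ℝ} (ht : t ∈ Ico 0 P.T) :
    P.gradBall M P.valueFunction t (H1.rep y t) = p t := by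
  have hT := P.T_pos
  have htT := ht.2.le
  have hM := hval.M_pos
  have ht' : t ∈ Icc 0 P.T := Ico_subset_Icc_self ht
  have hsubI : Icc t P.T ⊆ Icc 0 P.T := Icc_subset_Icc_left ht.1
  have hmt : t ∈ Icc t P.T := left_mem_Icc.2 htT
  have hB : ∀ s ∈ Icc 0 P.T, H1.rep y s ∈ P.stateBall M := fun s hs =>
    P.mem_stateBall hM (hyM s hs)
  have hyc := H1.continuousOn_rep hT y
  obtain ⟨r, hr, hball⟩ := P.exists_closedBall_subset_stateBall hM
  set φ : ℝ → E n → E n := fun s z => P.f s z + P.g s z (u s) with hφ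
  have hu_tame : TameOn (Icc 0 P.T) (P.stateBall M) fun s _ => u s := TameOn.of_curve hu
  have hφt : TameOn (Icc 0 P.T) (P.stateBall M) φ := hdyn.tame_dynamics hu_tame
  obtain ⟨L, hL0, hL⟩ := hφt.lip
  obtain ⟨Lf, hLf0, hLf⟩ := exists_norm_taylor_le (P.convex_stateBall (M := M))
    (fun s hs => hdyn.differentiable_f hs) hdyn.tame_fderiv_f
  obtain ⟨Lg, hLg0, hLg⟩ := exists_norm_taylor_le (P.convex_stateBall (M := M))
    (fun s hs => hdyn.differentiable_g hs) hdyn.tame_fderiv_g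
  obtain ⟨Ru, hRu⟩ := isCompact_Icc.exists_bound_of_continuousOn hu
  obtain ⟨Rp, hRp⟩ := isCompact_Icc.exists_bound_of_continuousOn hp.cont
  have hRu0 : 0 ≤ Ru := (norm_nonneg _).trans (hRu t ht')
  have hRp0 : 0 ≤ Rp := (norm_nonneg _).trans (hRp t ht')
  have hA : ContinuousOn (fun s => P.adjointOp s (H1.rep y s) (u s)) (Icc 0 P.T) :=
    (hdyn.tame_adjointOp hu_tame).comp_curve subset_rfl hyc hB
  -- The Gronwall factor of the truncated field, whose Lipschitz constant is doubled by the
  -- retraction. A perturbation h with ‖h‖e ≤ r cannot push the trajectory out of the state ball.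
  set e := Real.exp (2 * L * (P.T - t)) with he
  have he0 : 0 < e := Real.exp_pos _
  set C : ℝ := Lf + Lg * Ru with hC
  have hC0 : 0 ≤ C := by positivity
  set K : ℝ := ((Rp * C + ‖P.Q₁‖ ^ 2 / 2) * P.T + ‖P.Q₂‖ ^ 2 / 2) * e ^ 2 with hK
  have hdyn_y := hopt.1.2.1
  -- upper bound for the value function near the trajectory
  have upper : ∀ h : E n, ‖h‖ * e ≤ r →
      P.valueFunction t (H1.rep y t + h) - P.valueFunction t (H1.rep y t) ≤
        inner ℝ (p t) h + K * ‖h‖ ^ 2 := by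
    intro h hh
    have hρ : 0 ≤ 2 * P.Mhat M := mul_nonneg zero_le_two (P.Mhat_nonneg hM)
    -- The perturbed start is driven by the unchanged open loop control u. This is admissible but in
    -- general not optimal, so it bounds the value function from above.
    obtain ⟨z, hzt, hzc, hz⟩ := exists_truncated_solution hmt hρ (hφt.mono hsubI)
      (H1.rep y t + h)
    set π : E n → E n := radialRetraction (2 * P.Mhat M) with hπ
    have hπB : ∀ x, π x ∈ P.stateBall M := fun x =>
      mem_closedBall_zero_iff.2 (norm_radialRetraction_le hρ x)
    have hπy : ∀ s ∈ Icc 0 P.T, π (H1.rep y s) = H1.rep y s := fun s hs =>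
      radialRetraction_of_norm_le (mem_closedBall_zero_iff.1 (hB s hs))
    have hπl : LipschitzWith 2 π := LipschitzWith.of_dist_le_mul fun a b => by
      rw [dist_eq_norm, dist_eq_norm]; exact norm_radialRetraction_sub_le hρ a b
    have hvc : ContinuousOn (fun s => φ s (π (z s))) (Icc t P.T) :=
      hφt.comp_curve hsubI (hπl.continuous.comp_continuousOn hzc) fun s _ => hπB _
    have hvi : IntervalIntegrable (fun s => φ s (π (z s))) volume t P.T :=
      (by rwa [uIcc_of_le htT] : ContinuousOn _ (uIcc t P.T)).intervalIntegrable
    have hyi : IntervalIntegrable (H1.weakDeriv y) volume t P.T :=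
      (H1.intervalIntegrable_weakDeriv hT y).mono_set
        (by rw [uIcc_of_le htT, uIcc_of_le hT.le]; exact hsubI)
    have hye : ∀ s ∈ Icc t P.T, H1.rep y s = H1.rep y t + ∫ τ in t..s, H1.weakDeriv y τ :=
      fun s hs => H1.rep_eq_rep_add_integral hT y ht' (hsubI hs)
    have hze : ∀ s ∈ Icc t P.T, z s = z t + ∫ τ in t..s, φ τ (π (z τ)) := fun s hs => by
      rw [hzt]; exact hz s hs
    have hyd : ∀ᵐ s ∂(volume.restrict (Ioo t P.T)), H1.weakDeriv y s = φ s (H1.rep y s) :=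
      ae_restrict_of_ae_restrict_of_subset (Ioo_subset_Ioo_left ht.1) hdyn_y
    have hclose : ∀ s ∈ Icc t P.T, ‖z s - H1.rep y s‖ ≤ ‖h‖ * e := by
      intro s hs
      have := norm_sub_le_of_integral_eq htT (K := 2 * L) (η := 0) (by positivity) le_rfl
        hvi hyi hze hye (by
          filter_upwards [hyd, ae_restrict_mem measurableSet_Ioo] with s h1 hs
          have hs' := hsubI (Ioo_subset_Icc_self hs)
          rw [h1, add_zero]
          refine (hL s hs' _ (hπB _) _ (hB s hs')).trans ?_
          have h2 := norm_radialRetraction_sub_le hρ (z s) (H1.rep y s)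
          change ‖π (z s) - π (H1.rep y s)‖ ≤ _ at h2
          rw [hπy s hs'] at h2
          calc L * ‖π (z s) - H1.rep y s‖ ≤ L * (2 * ‖z s - H1.rep y s‖) := by gcongr
            _ = _ := by ring) hs
      rw [hzt] at this
      simpa using this
    have hzB : ∀ s ∈ Icc t P.T, z s ∈ P.stateBall M := fun s hs =>
      hball _ (hyM s (hsubI hs)) (by
        rw [Metric.mem_closedBall, dist_eq_norm]; exact (hclose s hs).trans hh)
    have hπz : ∀ s ∈ Icc t P.T, π (z s) = z s := fun s hs =>
      radialRetraction_of_norm_le (mem_closedBall_zero_iff.1 (hzB s hs))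
    have hum : MemLp u 2 (volume.restrict (Ioo t P.T)) :=
      memLp_two_of_continuousOn (hu.mono hsubI)
    obtain ⟨w, hw, hwz⟩ := P.exists_admissible ht.2 (memLp_two_of_continuousOn hvc) hum hz (by
      rw [ae_restrict_iff' measurableSet_Ioo]
      refine ae_of_all _ fun s hs => ?_
      rw [hπz s (Ioo_subset_Icc_self hs)])
    have h1 := P.valueFunction_le_cost ht.2 hw
    rw [P.cost_congr htT hwz fun s _ => rfl] at h1
    have h2 := P.valueFunction_eq_cost hopt ht
    have h3 := P.cost_sub_le_of_isAdjointCurve ht (C := C) (D := ‖h‖ * e) (R := Rp) hC0 hRp0 hyc hzc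
      hum hyi hvi hye hze hA hp (fun s hs => hRp s (hsubI hs)) (by
        filter_upwards [hyd, ae_restrict_mem measurableSet_Ioo] with s h1 hs
        have hs1 := Ioo_subset_Icc_self hs
        have hs' := hsubI hs1
        rw [h1, hπz s hs1, adjointOp, ContinuousLinearMap.adjoint_adjoint]
        have e1 := hLf s hs' _ (hB s hs') _ (hzB s hs1)
        have e2 := hLg s hs' _ (hB s hs') _ (hzB s hs1)
        have e3 := ContinuousLinearMap.le_of_opNorm_le _ e2 (u s)
        set η := z s - H1.rep y s with hη
        have e4 : φ s (z s) - φ s (H1.rep y s) - (fderiv ℝ (P.f s) (H1.rep y s) +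
            (fderiv ℝ (P.g s) (H1.rep y s)).flip (u s)) η =
            (P.f s (z s) - P.f s (H1.rep y s) - fderiv ℝ (P.f s) (H1.rep y s) η) +
            (P.g s (z s) - P.g s (H1.rep y s) - fderiv ℝ (P.g s) (H1.rep y s) η) (u s) := by
          simp only [hφ, add_apply, sub_apply, ContinuousLinearMap.flip_apply]
          abel
        rw [e4]
        refine (norm_add_le _ _).trans ((add_le_add e1 e3).trans ?_)
        have := hRu s hs'
        rw [hC, add_mul]
        have : Lg * ‖η‖ ^ 2 * ‖u s‖ ≤ Lg * ‖η‖ ^ 2 * Ru := by gcongr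
        linarith) hclose
    rw [hzt, add_sub_cancel_left] at h3
    rw [h2]
    refine (sub_le_sub_right h1 _).trans (h3.trans_eq ?_)
    rw [hK]; ring
  -- first order condition
  have hnhds : P.stateBall M ∈ 𝓝 (H1.rep y t) :=
    mem_of_superset (Metric.closedBall_mem_nhds _ hr) (hball _ (hyM t ht'))
  have hdiff : DifferentiableAt ℝ (P.valueFunction t) (H1.rep y t) :=
    (hval.differentiableOn ht' _ (hB t ht')).differentiableAt hnhds
  set D := fderiv ℝ (P.valueFunction t) (H1.rep y t) with hD
  -- The upper bound says that ψ has a local maximum at h = 0. As the value function is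
  -- differentiable there, the one-sided bound already determines its gradient.
  let ψ : E n → ℝ := fun h => P.valueFunction t (H1.rep y t + h) - inner ℝ (p t) h - K * ‖h‖ ^ 2
  have hψd : HasFDerivAt ψ (D - innerSL ℝ (p t)) 0 := by
    have h1 : HasFDerivAt (fun h => P.valueFunction t (H1.rep y t + h)) D 0 := by
      have h0 : HasFDerivAt (P.valueFunction t) D (H1.rep y t + 0) := by
        rw [add_zero]; exact hdiff.hasFDerivAt
      have h4 := h0.comp 0 ((hasFDerivAt_id (0 : E n)).const_add (H1.rep y t))
      rw [ContinuousLinearMap.comp_id] at h4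
      exact h4
    have h2 : HasFDerivAt (fun h : E n => inner ℝ (p t) h) (innerSL ℝ (p t)) 0 :=
      (innerSL ℝ (p t)).hasFDerivAt
    have h3 : HasFDerivAt (fun h : E n => K * ‖h‖ ^ 2) (0 : E n →L[ℝ] ℝ) 0 := by
      simpa using ((hasStrictFDerivAt_norm_sq (0 : E n)).hasFDerivAt).const_mul K
    have h4 := (h1.sub h2).sub h3
    rw [sub_zero] at h4
    exact h4
  have hmax : IsLocalMax ψ 0 := by
    have hpos : 0 < r / e := by positivity
    filter_upwards [Metric.closedBall_mem_nhds (0 : E n) hpos] with h hh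
    rw [mem_closedBall_zero_iff, le_div_iff₀ he0] at hh
    have := upper h hh
    simp only [ψ, add_zero, inner_zero_right, norm_zero]
    linarith
  have hDp : D = innerSL ℝ (p t) := sub_eq_zero.1 (hmax.hasFDerivAt_eq_zero hψd)
  rw [gradBall, gradientWithin, fderivWithin_of_mem_nhds hnhds, ← hD, hDp]
  exact (InnerProductSpace.toDual ℝ (E n)).symm_apply_apply (p t)

end ControlProblem

end

end FeedbackLearning

namespace FeedbackLearning

noncomputable section

namespace ControlProblem

variable {n m : ℕ} (P : ControlProblem n m) {M : ℝ}

/-! ### Dependence of states and adjoint states on the initial value -/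

theorem rep_mem_stateBall {y : P.W} (hy : ‖y‖ ≤ 2 * M) {t : ℝ} (ht : t ∈ Icc 0 P.T) :
    H1.rep y t ∈ P.stateBall M := by
  rw [stateBall, mem_closedBall_zero_iff]
  refine (H1.norm_rep_le P.T_pos y ht).trans ?_
  rw [Mhat]
  have := mul_le_mul_of_nonneg_left hy (ContinuousLinearMap.opNorm_nonneg (H1.toC (n := n) P.T_pos))
  linarith

/-- Solutions of the closed loop equation that stay in the state ball depend continuously on the
initial value. -/
theorem exists_continuous_closedLoop (hdyn : P.SmoothDynamics) {F : ℝ → E n → E m}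
    (hF : TameOn (Icc 0 P.T) (P.stateBall M) F) {Y₀ : Set (E n)} {Y : Y₀ → ℝ → E n}
    (hB : ∀ y₀, ∀ t ∈ Icc 0 P.T, Y y₀ t ∈ P.stateBall M)
    (hc : ∀ y₀, ContinuousOn (Y y₀) (Icc 0 P.T))
    (hY : ∀ y₀ : Y₀, ∀ t ∈ Icc 0 P.T,
      Y y₀ t = y₀ + ∫ s in 0..t, (P.f s (Y y₀ s) + P.g s (Y y₀ s) (F s (Y y₀ s)))) :
    ∃ ys : C(Y₀, P.W), ∀ y₀ : Y₀, P.IsClosedLoop F y₀ (ys y₀) ∧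
      ∀ t ∈ Icc 0 P.T, H1.rep (ys y₀) t = Y y₀ t := by
  have hT := P.T_pos
  have h0 : (0 : ℝ) ∈ Icc 0 P.T := left_mem_Icc.2 hT.le
  have hφ := hdyn.tame_dynamics hF
  obtain ⟨L, hL0, hL⟩ := hφ.lip
  have hvc : ∀ y₀, ContinuousOn
      (fun s => P.f s (Y y₀ s) + P.g s (Y y₀ s) (F s (Y y₀ s))) (Icc 0 P.T) := fun y₀ =>
    hφ.comp_curve subset_rfl (hc y₀) (hB y₀)
  have hvi : ∀ y₀, IntervalIntegrable
      (fun s => P.f s (Y y₀ s) + P.g s (Y y₀ s) (F s (Y y₀ s))) volume 0 P.T := fun y₀ =>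
    (by rw [uIcc_of_le hT.le]; exact hvc y₀ : ContinuousOn _ (uIcc 0 P.T)).intervalIntegrable
  choose w hwv hw using fun y₀ : Y₀ =>
    H1.exists_of_primitive hT (y₀ : E n) (memLp_two_of_continuousOn (hvc y₀))
  have hrep : ∀ y₀, ∀ t ∈ Icc 0 P.T, H1.rep (w y₀) t = Y y₀ t := fun y₀ t ht => by
    rw [hw y₀ t ht, hY y₀ t ht]
  have hY0 : ∀ y₀ : Y₀, Y y₀ 0 = y₀ := fun y₀ => by simpa using hY y₀ 0 h0
  set e := Real.exp (L * (P.T - 0)) with he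
  have hclose : ∀ y₀ y₁ : Y₀, ∀ t ∈ Icc 0 P.T, ‖Y y₀ t - Y y₁ t‖ ≤ e * ‖(y₀ : E n) - y₁‖ := by
    intro y₀ y₁ t ht
    have := norm_sub_le_of_integral_eq (y := Y y₀) (z := Y y₁) hT.le hL0 (le_refl 0) (hvi y₀)
      (hvi y₁)
      (fun t ht => by rw [hY0, ← hY y₀ t ht]) (fun t ht => by rw [hY0, ← hY y₁ t ht]) (by
        rw [ae_restrict_iff' measurableSet_Ioo]
        refine ae_of_all _ fun s hs => ?_
        have hs' := Ioo_subset_Icc_self hs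
        rw [add_zero]
        exact hL s hs' _ (hB y₀ s hs') _ (hB y₁ s hs')) ht
    rw [hY0, hY0] at this
    linarith
  have hlip : ∀ y₀ y₁ : Y₀,
      ‖w y₀ - w y₁‖ ≤ 2 * Real.sqrt (P.T - 0) * ((1 + L) * (e * ‖(y₀ : E n) - y₁‖)) := by
    intro y₀ y₁
    have hpos : 0 ≤ e * ‖(y₀ : E n) - y₁‖ := by positivity
    refine H1.norm_sub_le hT _ _ (by positivity) (fun t ht => ?_) ?_
    · rw [hrep y₀ t ht, hrep y₁ t ht]
      refine (hclose y₀ y₁ t ht).trans ?_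
      nlinarith
    · filter_upwards [hwv y₀, hwv y₁, ae_restrict_mem measurableSet_Ioo] with s h1 h2 hs
      have hs' := Ioo_subset_Icc_self hs
      rw [h1, h2]
      refine (hL s hs' _ (hB y₀ s hs') _ (hB y₁ s hs')).trans ?_
      have := mul_le_mul_of_nonneg_left (hclose y₀ y₁ s hs') hL0
      linarith
  have hcont : Continuous w := by
    refine (LipschitzWith.of_dist_le_mul
      (K := Real.toNNReal (2 * Real.sqrt (P.T - 0) * ((1 + L) * e))) fun y₀ y₁ => ?_).continuous
    rw [dist_eq_norm]
    refine (hlip y₀ y₁).trans_eq ?_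
    rw [Subtype.dist_eq, dist_eq_norm, Real.coe_toNNReal _ (by positivity)]
    ring
  refine ⟨⟨w, hcont⟩, fun y₀ => ⟨⟨?_, ?_⟩, hrep y₀⟩⟩
  · filter_upwards [hwv y₀, ae_restrict_mem measurableSet_Ioo] with s h1 hs
    rw [ContinuousMap.coe_mk, h1, hrep y₀ s (Ioo_subset_Icc_self hs)]
  · rw [ContinuousMap.coe_mk, hrep y₀ 0 h0, hY0]

/-- The right hand side of the adjoint equation. -/
def adjointRhs (y : ℝ → E n) (u : ℝ → E m) (p : ℝ → E n) (s : ℝ) : E n :=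
  P.adjointOp s (y s) (u s) (p s) + P.adjointSource s (y s)

theorem continuousOn_adjointOp (hdyn : P.SmoothDynamics) {y : ℝ → E n} {u : ℝ → E m}
    (hy : ContinuousOn y (Icc 0 P.T)) (hyB : ∀ t ∈ Icc 0 P.T, y t ∈ P.stateBall M)
    (hu : ContinuousOn u (Icc 0 P.T)) :
    ContinuousOn (fun s => P.adjointOp s (y s) (u s)) (Icc 0 P.T) :=
  (hdyn.tame_adjointOp (TameOn.of_curve hu)).comp_curve subset_rfl hy hyB

theorem exists_isAdjointCurve (hdyn : P.SmoothDynamics) {y : ℝ → E n} {u : ℝ → E m}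
    (hy : ContinuousOn y (Icc 0 P.T)) (hyB : ∀ t ∈ Icc 0 P.T, y t ∈ P.stateBall M)
    (hu : ContinuousOn u (Icc 0 P.T)) : ∃ p, P.IsAdjointCurve y u p := by
  obtain ⟨p, hpT, hpc, hp⟩ := exists_backward_linear P.T_pos.le
    (P.continuousOn_adjointOp hdyn hy hyB hu) (P.intervalIntegrable_adjointSource hy)
    (ContinuousLinearMap.adjoint P.Q₂ (P.Q₂ (y P.T - P.ydT)))
  exact ⟨p, hpc, hpT, fun t ht => by rw [hpT]; exact hp t ht⟩

theorem memLp_adjointRhs {y : ℝ → E n} {u : ℝ → E m} {p : ℝ → E n}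
    (hy : ContinuousOn y (Icc 0 P.T))
    (hA : ContinuousOn (fun s => P.adjointOp s (y s) (u s)) (Icc 0 P.T))
    (hp : ContinuousOn p (Icc 0 P.T)) :
    MemLp (P.adjointRhs y u p) 2 (volume.restrict (Ioo 0 P.T)) :=
  (memLp_two_of_continuousOn (hA.clm_apply hp)).add
    ((ContinuousLinearMap.adjoint P.Q₁ ∘L P.Q₁).comp_memLp'
      ((memLp_two_of_continuousOn hy).sub P.yd_memLp))

/-- The adjoint state depends Lipschitz continuously on state and control. -/
theorem exists_norm_isAdjointCurve_sub_le (hdyn : P.SmoothDynamics) (R : ℝ) :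
    ∃ K, 0 ≤ K ∧ ∀ (y y' : ℝ → E n) (u u' : ℝ → E m) (p p' : ℝ → E n) (η : ℝ),
      ContinuousOn y (Icc 0 P.T) → ContinuousOn y' (Icc 0 P.T) →
      ContinuousOn u (Icc 0 P.T) → ContinuousOn u' (Icc 0 P.T) →
      P.IsAdjointCurve y u p → P.IsAdjointCurve y' u' p' →
      (∀ s ∈ Icc 0 P.T, y s ∈ P.stateBall M ∧ y' s ∈ P.stateBall M) →
      (∀ s ∈ Icc 0 P.T, ‖u s‖ ≤ R ∧ ‖u' s‖ ≤ R ∧ ‖p' s‖ ≤ R) →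
      (∀ s ∈ Icc 0 P.T, ‖y s - y' s‖ ≤ η ∧ ‖u s - u' s‖ ≤ η) →
      ∀ s ∈ Icc 0 P.T, ‖p s - p' s‖ ≤ K * η ∧
        ‖P.adjointRhs y u p s - P.adjointRhs y' u' p' s‖ ≤ K * η := by
  have hT := P.T_pos
  obtain ⟨Lf, hLf0, hLf⟩ := (hdyn.tame_fderiv_f (M := M)).lip
  obtain ⟨Lg, hLg0, hLg⟩ := (hdyn.tame_fderiv_g (M := M)).lip
  obtain ⟨Cf, hCf0, hCf⟩ := (hdyn.tame_fderiv_f (M := M)).bound isCompact_Icc P.isCompact_stateBall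
  obtain ⟨Cg, hCg0, hCg⟩ := (hdyn.tame_fderiv_g (M := M)).bound isCompact_Icc P.isCompact_stateBall
  set r := |R| with hr
  have hr0 : 0 ≤ r := abs_nonneg R
  set N := Cf + Cg * r with hN
  -- One constant for the operator, the source and the terminal value, since the backward comparison
  -- takes a common perturbation size.
  set κ := Lf + Lg * r + Cg + ‖P.Q₁‖ ^ 2 + ‖P.Q₂‖ ^ 2 with hκ
  set K₁ := κ * (1 + (r + 1) * (P.T - 0)) * Real.exp (N * (P.T - 0)) with hK₁
  have hTT : 0 ≤ P.T - 0 := by linarith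
  have hN0 : 0 ≤ N := by positivity
  have hκ0 : 0 ≤ κ := by positivity
  have hK₁0 : 0 ≤ K₁ := by positivity
  -- K₁ controls the adjoint states; the bracket controls their velocities, its terms coming from
  -- the change of p, of the operator and of the source.
  refine ⟨K₁ + (N * K₁ + κ * r + κ), by positivity, ?_⟩
  intro y y' u u' p p' η hy hy' hu hu' hp hp' hB hR hη
  have hη0 : 0 ≤ η := (norm_nonneg _).trans (hη 0 (left_mem_Icc.2 hT.le)).1
  have hRr : R ≤ r := le_abs_self R
  have hAN : ∀ s ∈ Icc 0 P.T, ‖P.adjointOp s (y s) (u s)‖ ≤ N := by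
    intro s hs
    rw [adjointOp, LinearIsometryEquiv.norm_map]
    refine (norm_add_le _ _).trans (add_le_add (hCf s hs _ (hB s hs).1) ?_)
    refine ((fderiv ℝ (P.g s) (y s)).flip.le_opNorm _).trans ?_
    rw [ContinuousLinearMap.opNorm_flip]
    have h1 := hCg s hs _ (hB s hs).1
    have h2 := (hR s hs).1.trans hRr
    gcongr
  have hAA : ∀ s ∈ Icc 0 P.T,
      ‖P.adjointOp s (y s) (u s) - P.adjointOp s (y' s) (u' s)‖ ≤ κ * η := by
    intro s hs
    obtain ⟨hyB, hyB'⟩ := hB s hs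
    obtain ⟨h1, h2⟩ := hη s hs
    have e : (fderiv ℝ (P.f s) (y s) + (fderiv ℝ (P.g s) (y s)).flip (u s)) -
        (fderiv ℝ (P.f s) (y' s) + (fderiv ℝ (P.g s) (y' s)).flip (u' s)) =
        (fderiv ℝ (P.f s) (y s) - fderiv ℝ (P.f s) (y' s)) +
        ((fderiv ℝ (P.g s) (y s) - fderiv ℝ (P.g s) (y' s)).flip (u s) +
          (fderiv ℝ (P.g s) (y' s)).flip (u s - u' s)) := by
      ext z
      simp only [sub_apply, add_apply, ContinuousLinearMap.flip_apply, map_sub]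
      abel_nf
    rw [adjointOp, adjointOp, ← map_sub, LinearIsometryEquiv.norm_map, e]
    have b1 : ‖fderiv ℝ (P.f s) (y s) - fderiv ℝ (P.f s) (y' s)‖ ≤ Lf * η :=
      (hLf s hs _ hyB _ hyB').trans (by gcongr)
    have b2 : ‖(fderiv ℝ (P.g s) (y s) - fderiv ℝ (P.g s) (y' s)).flip (u s)‖ ≤ Lg * η * r := by
      refine (ContinuousLinearMap.le_opNorm _ _).trans ?_
      rw [ContinuousLinearMap.opNorm_flip]
      have h3 := (hR s hs).1.trans hRr
      have h4 : ‖fderiv ℝ (P.g s) (y s) - fderiv ℝ (P.g s) (y' s)‖ ≤ Lg * η :=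
        (hLg s hs _ hyB _ hyB').trans (by gcongr)
      gcongr
    have b3 : ‖(fderiv ℝ (P.g s) (y' s)).flip (u s - u' s)‖ ≤ Cg * η := by
      refine (ContinuousLinearMap.le_opNorm _ _).trans ?_
      rw [ContinuousLinearMap.opNorm_flip]
      have h3 := hCg s hs _ hyB'
      gcongr
    refine (norm_add_le _ _).trans ((add_le_add b1 ((norm_add_le _ _).trans
      (add_le_add b2 b3))).trans ?_)
    rw [hκ]
    nlinarith [mul_nonneg (sq_nonneg ‖P.Q₁‖) hη0, mul_nonneg (sq_nonneg ‖P.Q₂‖) hη0]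
  have hQ : ∀ (Q : E n →L[ℝ] E n) (x x' d : E n), ‖x - x'‖ ≤ η → ‖Q‖ ^ 2 ≤ κ →
      ‖ContinuousLinearMap.adjoint Q (Q (x - d)) - ContinuousLinearMap.adjoint Q (Q (x' - d))‖ ≤
        κ * η := by
    intro Q x x' d hx hQκ
    rw [← map_sub, ← map_sub, sub_sub_sub_cancel_right]
    refine ((ContinuousLinearMap.adjoint Q).le_opNorm_of_le (Q.le_opNorm_of_le hx)).trans ?_
    rw [LinearIsometryEquiv.norm_map, ← mul_assoc, ← sq]
    gcongr
  have hQ₁ : ‖P.Q₁‖ ^ 2 ≤ κ := by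
    have : 0 ≤ Lf + Lg * r + Cg + ‖P.Q₂‖ ^ 2 := by positivity
    linarith
  have hQ₂ : ‖P.Q₂‖ ^ 2 ≤ κ := by
    have : 0 ≤ Lf + Lg * r + Cg + ‖P.Q₁‖ ^ 2 := by positivity
    linarith
  have hcc : ∀ s ∈ Icc 0 P.T, ‖P.adjointSource s (y s) - P.adjointSource s (y' s)‖ ≤ κ * η :=
    fun s hs => hQ P.Q₁ _ _ _ (hη s hs).1 hQ₁
  have hend : ‖p P.T - p' P.T‖ ≤ κ * η := by
    rw [hp.terminal, hp'.terminal]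
    exact hQ P.Q₂ _ _ _ (hη _ (right_mem_Icc.2 hT.le)).1 hQ₂
  have int : ∀ {y : ℝ → E n} {u : ℝ → E m} {p : ℝ → E n}, ContinuousOn y (Icc 0 P.T) →
      (∀ s ∈ Icc 0 P.T, y s ∈ P.stateBall M) → ContinuousOn u (Icc 0 P.T) →
      ContinuousOn p (Icc 0 P.T) → IntervalIntegrable (P.adjointRhs y u p) volume 0 P.T := by
    intro y u p hy hyB hu hp
    rw [intervalIntegrable_iff_integrableOn_Ioo_of_le hT.le]
    exact (P.memLp_adjointRhs hy (P.continuousOn_adjointOp hdyn hy hyB hu) hp).integrable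
      (by norm_num)
  intro s hs
  have hps : ‖p s - p' s‖ ≤ K₁ * η := by
    have := norm_sub_le_of_backward_linear hT.le hN0 (mul_nonneg hκ0 hη0) hr0 hp.cont hp'.cont
      (int hy (fun s hs => (hB s hs).1) hu hp.cont) (int hy' (fun s hs => (hB s hs).2) hu' hp'.cont)
      hp.eq hp'.eq hAN hAA hcc hend (fun s hs => (hR s hs).2.2.trans hRr) hs
    refine this.trans_eq ?_
    rw [hK₁]; ring
  refine ⟨hps.trans ?_, ?_⟩
  · have : 0 ≤ (N * K₁ + κ * r + κ) * η := by positivity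
    linarith
  · have e : P.adjointRhs y u p s - P.adjointRhs y' u' p' s =
        P.adjointOp s (y s) (u s) (p s - p' s) +
        ((P.adjointOp s (y s) (u s) - P.adjointOp s (y' s) (u' s)) (p' s) +
          (P.adjointSource s (y s) - P.adjointSource s (y' s))) := by
      simp only [adjointRhs, map_sub, sub_apply]
      abel
    have b1 : ‖P.adjointOp s (y s) (u s) (p s - p' s)‖ ≤ N * (K₁ * η) := by
      refine (ContinuousLinearMap.le_opNorm _ _).trans ?_
      have := hAN s hs
      gcongr
    have b2 : ‖(P.adjointOp s (y s) (u s) - P.adjointOp s (y' s) (u' s)) (p' s)‖ ≤ κ * η * r := by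
      refine (ContinuousLinearMap.le_opNorm _ _).trans ?_
      have h1 := hAA s hs
      have h2 := (hR s hs).2.2.trans hRr
      gcongr
    rw [e]
    refine (norm_add_le _ _).trans ((add_le_add b1 ((norm_add_le _ _).trans
      (add_le_add b2 (hcc s hs)))).trans ?_)
    have : 0 ≤ K₁ * η := by positivity
    linarith

/-- The adjoint states belonging to a continuous family of states form a continuous family. -/
theorem exists_continuous_adjoint (hdyn : P.SmoothDynamics) {F : ℝ → E n → E m}
    (hF : TameOn (Icc 0 P.T) (P.stateBall M) F) {Y : Type*} [TopologicalSpace Y]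
    (ys : C(Y, P.W)) (hB : ∀ y₀, ∀ t ∈ Icc 0 P.T, H1.rep (ys y₀) t ∈ P.stateBall M) :
    ∃ ps : C(Y, P.W), ∀ y₀, P.IsAdjoint F (ys y₀) (ps y₀) ∧
      P.IsAdjointCurve (H1.rep (ys y₀)) (fun t => F t (H1.rep (ys y₀) t)) (H1.rep (ps y₀)) := by
  have hT := P.T_pos
  have h0 : (0 : ℝ) ∈ Icc 0 P.T := left_mem_Icc.2 hT.le
  have hTm : P.T ∈ Icc 0 P.T := right_mem_Icc.2 hT.le
  have hyc : ∀ y₀, ContinuousOn (H1.rep (ys y₀)) (Icc 0 P.T) := fun y₀ =>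
    H1.continuousOn_rep hT (ys y₀)
  have huc : ∀ y₀, ContinuousOn (fun t => F t (H1.rep (ys y₀) t)) (Icc 0 P.T) := fun y₀ =>
    hF.comp_curve subset_rfl (hyc y₀) (hB y₀)
  choose p hp using fun y₀ => P.exists_isAdjointCurve hdyn (hyc y₀) (hB y₀) (huc y₀)
  set rhs : Y → ℝ → E n := fun y₀ =>
    P.adjointRhs (H1.rep (ys y₀)) (fun t => F t (H1.rep (ys y₀) t)) (p y₀) with hrhs
  have hm : ∀ y₀, MemLp (fun s => -rhs y₀ s) 2 (volume.restrict (Ioo 0 P.T)) := fun y₀ =>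
    (P.memLp_adjointRhs (hyc y₀) (P.continuousOn_adjointOp hdyn (hyc y₀) (hB y₀) (huc y₀))
      (hp y₀).cont).neg
  -- Elements of H¹ are built from the left endpoint, so the backward solution enters through its
  -- value at time 0 and its velocity.
  choose w hwv hw using fun y₀ => H1.exists_of_primitive hT (p y₀ 0) (hm y₀)
  have hrep : ∀ y₀, ∀ t ∈ Icc 0 P.T, H1.rep (w y₀) t = p y₀ t := by
    intro y₀ t ht
    have hi : IntervalIntegrable (rhs y₀) volume 0 P.T :=
      (intervalIntegrable_iff_integrableOn_Ioo_of_le hT.le).2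
        (by
          have := (hm y₀).neg.integrable (by norm_num)
          simpa [IntegrableOn] using this)
    have htu : t ∈ uIcc 0 P.T := by rwa [uIcc_of_le hT.le]
    have h3 := intervalIntegral.integral_add_adjacent_intervals
      (hi.mono_set (uIcc_subset_uIcc_left htu)) (hi.mono_set (uIcc_subset_uIcc_right htu))
    have h1 : p y₀ t = p y₀ P.T + ∫ s in t..P.T, rhs y₀ s := (hp y₀).eq t ht
    have h2 : p y₀ 0 = p y₀ P.T + ∫ s in 0..P.T, rhs y₀ s := (hp y₀).eq 0 h0
    rw [hw y₀ t ht, intervalIntegral.integral_neg, h1, h2, ← h3]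
    abel
  obtain ⟨LF, hLF0, hLF⟩ := hF.lip
  obtain ⟨CF, hCF0, hCF⟩ := hF.bound isCompact_Icc P.isCompact_stateBall
  have hcont : Continuous w := by
    refine continuous_iff_continuousAt.2 fun y₁ => ?_
    -- Only the adjoint state at the reference point y₁ must be bounded. The constant may depend on
    -- y₁, which is enough for continuity at that point.
    obtain ⟨R, hR⟩ := isCompact_Icc.exists_bound_of_continuousOn (hp y₁).cont
    obtain ⟨K, hK0, hK⟩ := P.exists_norm_isAdjointCurve_sub_le (M := M) hdyn (max R CF)
    set ι := ‖H1.toC (n := n) hT‖ with hι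
    have hι0 : 0 ≤ ι := ContinuousLinearMap.opNorm_nonneg _
    have est : ∀ y₀, ‖w y₀ - w y₁‖ ≤
        2 * Real.sqrt (P.T - 0) * (K * ((1 + LF) * (ι * ‖ys y₀ - ys y₁‖))) := by
      intro y₀
      have hd0 : 0 ≤ ι * ‖ys y₀ - ys y₁‖ := by positivity
      have hd : ∀ s ∈ Icc 0 P.T, ‖H1.rep (ys y₀) s - H1.rep (ys y₁) s‖ ≤ ι * ‖ys y₀ - ys y₁‖ := by
        intro s hs
        rw [← H1.rep_sub hT _ _ hs]
        exact H1.norm_rep_le hT _ hs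
      have key := hK _ _ _ _ _ _ ((1 + LF) * (ι * ‖ys y₀ - ys y₁‖)) (hyc y₀) (hyc y₁) (huc y₀)
        (huc y₁) (hp y₀) (hp y₁) (fun s hs => ⟨hB y₀ s hs, hB y₁ s hs⟩)
        (fun s hs => ⟨(hCF s hs _ (hB y₀ s hs)).trans (le_max_right _ _),
          (hCF s hs _ (hB y₁ s hs)).trans (le_max_right _ _), (hR s hs).trans (le_max_left _ _)⟩)
        (fun s hs => ⟨(hd s hs).trans (by nlinarith), by
          refine (hLF s hs _ (hB y₀ s hs) _ (hB y₁ s hs)).trans ?_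
          have := mul_le_mul_of_nonneg_left (hd s hs) hLF0
          linarith⟩)
      refine H1.norm_sub_le hT _ _ (by positivity) (fun t ht => ?_) ?_
      · rw [hrep y₀ t ht, hrep y₁ t ht]
        exact (key t ht).1
      · filter_upwards [hwv y₀, hwv y₁, ae_restrict_mem measurableSet_Ioo] with s h1 h2 hs
        rw [h1, h2, neg_sub_neg, norm_sub_rev]
        exact (key s (Ioo_subset_Icc_self hs)).2
    refine tendsto_iff_norm_sub_tendsto_zero.2 ?_
    refine squeeze_zero (fun _ => norm_nonneg _) est ?_
    have h := tendsto_iff_norm_sub_tendsto_zero.1 (ys.continuous.tendsto y₁)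
    simpa using ((((h.const_mul ι).const_mul (1 + LF)).const_mul K).const_mul
      (2 * Real.sqrt (P.T - 0)))
  refine ⟨⟨w, hcont⟩, fun y₀ => ⟨⟨?_, ?_⟩, ?_⟩⟩
  · filter_upwards [hwv y₀, ae_restrict_mem measurableSet_Ioo] with s h1 hs
    have hs' := Ioo_subset_Icc_self hs
    rw [ContinuousMap.coe_mk, h1, neg_neg, hrep y₀ s hs', ← hdyn.adjointOp_apply hs']
    rfl
  · rw [ContinuousMap.coe_mk, hrep y₀ _ hTm, (hp y₀).terminal]
  · refine ⟨H1.continuousOn_rep hT _, ?_, fun t ht => ?_⟩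
    · rw [ContinuousMap.coe_mk, hrep y₀ _ hTm, (hp y₀).terminal]
    · rw [ContinuousMap.coe_mk, hrep y₀ _ hTm, hrep y₀ t ht, (hp y₀).eq t ht]
      congr 1
      refine intervalIntegral.integral_congr fun s hs => ?_
      rw [uIcc_of_le ht.2] at hs
      simp only [hrep y₀ s ⟨ht.1.trans hs.1, hs.2⟩]

end ControlProblem

end

end FeedbackLearning

namespace FeedbackLearning

noncomputable section

/-! ### The almost optimal competitor -/

theorem setIntegral_Ioo_le_of_abs_le {φ : ℝ → ℝ} {T b : ℝ} (hT : 0 ≤ T)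
    (h : ∀ t ∈ Ioo 0 T, |φ t| ≤ b) : ∫ t in Ioo 0 T, φ t ≤ b * T := by
  have := norm_setIntegral_le_of_norm_le_const (μ := volume) (f := φ) (s := Ioo 0 T) (C := b)
    (by simp) h
  refine (le_abs_self _).trans (this.trans_eq ?_)
  simp [hT]

namespace ControlProblem

variable {n m : ℕ} (P : ControlProblem n m) {M : ℝ}

theorem tame_approxFeedback (hdyn : P.SmoothDynamics) {V : ℝ → E n → ℝ}
    (hV : ContDiff ℝ 2 fun q : ℝ × E n => V q.1 q.2) :
    TameOn (Icc 0 P.T) (P.stateBall M) (P.approxFeedback V) :=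
  hdyn.tame_feedback (P.tame_gradient hV)

set_option maxHeartbeats 1000000 in
/-- An approximate value function that is close to the value function, together with its gradient,
has a family of closed loop solutions and adjoint states that is almost optimal. -/
theorem exists_almost_optimal_family (hdyn : P.SmoothDynamics) (hval : P.SmoothValue M)
    {Y₀ : Set (E n)} (hopt : P.OptimalClosedLoop Y₀ M) {c ε₀ : ℝ} (hc : 0 ≤ c) (hε₀ : 0 < ε₀) :
    ∃ C, 0 ≤ C ∧ ∃ ε₁ > 0, ∀ ε ∈ Ioc 0 ε₁, ε ≤ ε₀ → ∀ V : ℝ → E n → ℝ,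
      ContDiff ℝ 2 (fun q : ℝ × E n => V q.1 q.2) →
      (∀ t ∈ Icc 0 P.T, ∀ y ∈ P.stateBall M, |V t y - P.valueFunction t y| ≤ c * ε ∧
        ‖gradient (V t) y - P.gradBall M P.valueFunction t y‖ ≤ c * ε) →
      ∃ ys ps : C(Y₀, P.W), ∀ y₀ : Y₀, ‖ys y₀‖ ≤ 2 * M ∧
        P.IsClosedLoop (P.approxFeedback V) y₀ (ys y₀) ∧
        P.IsAdjoint (P.approxFeedback V) (ys y₀) (ps y₀) ∧
        P.cost 0 (H1.rep (ys y₀)) (P.approxControl V (ys y₀)) ≤ P.valueFunction 0 y₀ + C * ε ∧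
        P.valueMisfit V (ys y₀) ≤ C * ε ∧ P.gradientMisfit V (ys y₀) (ps y₀) ≤ C * ε := by
  have hT := P.T_pos
  have hM := hval.M_pos
  have h0 : (0 : ℝ) ∈ Icc 0 P.T := left_mem_Icc.2 hT.le
  have hTm : P.T ∈ Icc 0 P.T := right_mem_Icc.2 hT.le
  have hβ := P.β_pos
  have hIc : IsCompact (Icc 0 P.T) := isCompact_Icc
  have hBc := P.isCompact_stateBall (M := M)
  have hρ : 0 ≤ 2 * P.Mhat M := mul_nonneg zero_le_two (P.Mhat_nonneg hM)
  obtain ⟨r, hr, hball⟩ := P.exists_closedBall_subset_stateBall hM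
  set q := P.gradBall M P.valueFunction with hqdef
  have hq : TameOn (Icc 0 P.T) (P.stateBall M) q := hval.tame_gradBall
  have hFt : TameOn (Icc 0 P.T) (P.stateBall M) (P.optimalFeedback M) := hdyn.tame_feedback hq
  obtain ⟨Lφ, hLφ0, hLφ⟩ := (hdyn.tame_dynamics hFt).lip
  obtain ⟨Lq, hLq0, hLq⟩ := hq.lip
  obtain ⟨Cq, hCq0, hCq⟩ := hq.bound hIc hBc
  obtain ⟨LF, hLF0, hLF⟩ := hFt.lip
  obtain ⟨CF, hCF0, hCF⟩ := hFt.bound hIc hBc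
  obtain ⟨LV, hLV0, hLV⟩ := hval.tame_valueFunction.lip
  obtain ⟨Cg, hCg0, hCg⟩ := (hdyn.tame_g (M := M)).bound hIc hBc
  set κ := 1 / P.β * Cg * c with hκ
  have hκ0 : 0 ≤ κ := by positivity
  clear_value κ
  -- closeness of the states, the controls and the derivatives of the states
  set a₁ := Cg * κ * (P.T - 0) * Real.exp (2 * Lφ * (P.T - 0)) with ha₁
  have hTT : 0 ≤ P.T - 0 := by linarith
  have ha₁0 : 0 ≤ a₁ := by positivity
  clear_value a₁
  -- The three summands bound, in units of ε, the deviation of the states, of their velocities and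
  -- of the controls.
  set a := a₁ + (Cg * κ + Lφ * a₁) + (κ + LF * a₁) with ha
  have ha0 : 0 ≤ a := by positivity
  have ha₁a : a₁ ≤ a := by
    have : 0 ≤ (Cg * κ + Lφ * a₁) + (κ + LF * a₁) := by positivity
    linarith
  have ha₂a : Cg * κ + Lφ * a₁ ≤ a := by
    have : 0 ≤ a₁ + (κ + LF * a₁) := by positivity
    linarith
  have ha₃a : κ + LF * a₁ ≤ a := by
    have : 0 ≤ a₁ + (Cg * κ + Lφ * a₁) := by positivity
    linarith
  clear_value a
  -- Bounds the terminal adjoint state directly, because the adjoint state is identified with the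
  -- gradient of the value function only for t < T.
  set pT := ‖P.Q₂‖ * (‖P.Q₂‖ * (P.Mhat M + ‖P.ydT‖)) with hpT
  have hpT0 : 0 ≤ pT := by
    have := P.Mhat_nonneg hM
    positivity
  clear_value pT
  set R := 2 * P.Mhat M + (CF + a * ε₀) + (Cq + pT) with hR
  clear_value R
  obtain ⟨Kc, hKc0, hKc⟩ := P.exists_abs_cost_sub_le R
  obtain ⟨Kp, hKp0, hKp⟩ := P.exists_norm_isAdjointCurve_sub_le (M := M) hdyn R
  -- Sizes of the two misfits before squaring: the error of V or its gradient, the change of V* or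
  -- its gradient between the two trajectories, and the change of the cost-to-go or of the adjoint
  -- state.
  set b₁ := c + LV * a + Kc * a with hb₁
  set b₂ := c + Lq * a + Kp * a with hb₂
  have hb₁0 : 0 ≤ b₁ := by positivity
  have hb₂0 : 0 ≤ b₂ := by positivity
  clear_value b₁ b₂
  -- The first bound keeps the trajectories in the state ball, the second keeps their W_T distance
  -- from the optimal ones below M. Adding 1 excludes zero denominators.
  have hε₁ : 0 < min (r / (a + 1)) (M / (2 * Real.sqrt (P.T - 0) * a + 1)) := by positivity
  refine ⟨Kc * a + b₁ ^ 2 * ε₀ * P.T + b₂ ^ 2 * ε₀ * P.T, by positivity, _, hε₁, ?_⟩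
  intro ε hε hεε₀ V hV happ
  have hε0 : 0 < ε := hε.1
  have hεr : a * ε ≤ r := by
    have := (le_div_iff₀ (by positivity)).1 (hε.2.trans (min_le_left _ _))
    linarith
  have hεM : 2 * Real.sqrt (P.T - 0) * (a * ε) ≤ M := by
    have := (le_div_iff₀ (by positivity)).1 (hε.2.trans (min_le_right _ _))
    linarith
  have hFVt : TameOn (Icc 0 P.T) (P.stateBall M) (P.approxFeedback V) :=
    P.tame_approxFeedback hdyn hV
  have hFdiff : ∀ t ∈ Icc 0 P.T, ∀ y ∈ P.stateBall M,
      ‖P.approxFeedback V t y - P.optimalFeedback M t y‖ ≤ κ * ε := by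
    intro t ht y hy
    refine (P.norm_feedback_sub_le _ _ t y).trans ?_
    have h1 := hCg t ht y hy
    have h2 := (happ t ht y hy).2
    calc _ ≤ 1 / P.β * Cg * (c * ε) := by gcongr
      _ = κ * ε := by rw [hκ]; ring
  have hφdiff : ∀ t ∈ Icc 0 P.T, ∀ y ∈ P.stateBall M,
      ‖(P.f t y + P.g t y (P.approxFeedback V t y)) -
        (P.f t y + P.g t y (P.optimalFeedback M t y))‖ ≤ Cg * κ * ε := by
    intro t ht y hy
    rw [add_sub_add_left_eq_sub, ← map_sub, mul_assoc]
    exact ContinuousLinearMap.le_of_opNorm_le_of_le _ (hCg t ht y hy) (hFdiff t ht y hy)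
  -- the optimal trajectories
  choose yopt hyopt _ hyoptimal using fun y₀ : Y₀ => hopt y₀ y₀.2
  have hyM : ∀ y₀, ∀ t ∈ Icc 0 P.T, ‖H1.rep (yopt y₀) t‖ ≤ P.Mhat M := fun y₀ t ht =>
    P.norm_rep_le_Mhat (hyopt y₀).2 ht
  have hyB : ∀ y₀, ∀ t ∈ Icc 0 P.T, H1.rep (yopt y₀) t ∈ P.stateBall M := fun y₀ t ht =>
    P.mem_stateBall hM (hyM y₀ t ht)
  have hyc : ∀ y₀, ContinuousOn (H1.rep (yopt y₀)) (Icc 0 P.T) := fun y₀ =>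
    H1.continuousOn_rep hT _
  -- the closed loop trajectories of the approximate feedback
  choose Y hY0 hYc hY using fun y₀ : Y₀ =>
    exists_truncated_solution h0 hρ (hdyn.tame_dynamics hFVt) (y₀ : E n)
  set π : E n → E n := radialRetraction (2 * P.Mhat M) with hπ
  have hπB : ∀ x, π x ∈ P.stateBall M := fun x =>
    mem_closedBall_zero_iff.2 (norm_radialRetraction_le hρ x)
  have hπid : ∀ x ∈ P.stateBall M, π x = x := fun x hx =>
    radialRetraction_of_norm_le (mem_closedBall_zero_iff.1 hx)
  have hπl : LipschitzWith 2 π := LipschitzWith.of_dist_le_mul fun a b => by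
    rw [dist_eq_norm, dist_eq_norm]; exact norm_radialRetraction_sub_le hρ a b
  have hclose : ∀ y₀, ∀ t ∈ Icc 0 P.T, ‖Y y₀ t - H1.rep (yopt y₀) t‖ ≤ a₁ * ε := by
    intro y₀ t ht
    have hvc : ContinuousOn (fun s => P.f s (π (Y y₀ s)) +
        P.g s (π (Y y₀ s)) (P.approxFeedback V s (π (Y y₀ s)))) (Icc 0 P.T) :=
      (hdyn.tame_dynamics hFVt).comp_curve subset_rfl
        (hπl.continuous.comp_continuousOn (hYc y₀)) fun s _ => hπB _
    have hvi : IntervalIntegrable (fun s => P.f s (π (Y y₀ s)) +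
        P.g s (π (Y y₀ s)) (P.approxFeedback V s (π (Y y₀ s)))) volume 0 P.T :=
      (by rwa [uIcc_of_le hT.le] : ContinuousOn _ (uIcc 0 P.T)).intervalIntegrable
    have := norm_sub_le_of_integral_eq (y := Y y₀) (z := H1.rep (yopt y₀)) hT.le
      (K := 2 * Lφ) (η := Cg * κ * ε) (by positivity) (by positivity) hvi
      (H1.intervalIntegrable_weakDeriv hT (yopt y₀))
      (fun t ht => by rw [hY0]; exact hY y₀ t ht)
      (fun t _ => H1.rep_eq_add_integral_weakDeriv _ t) (by
        filter_upwards [(hyopt y₀).1.1, ae_restrict_mem measurableSet_Ioo] with s h1 hs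
        have hs' := Ioo_subset_Icc_self hs
        rw [h1]
        -- The optimal feedback is inserted at the state of the competitor. Thus only the Lipschitz
        -- constant of the optimal field enters the exponent, and the bound does not depend on V.
        refine (norm_sub_le_norm_sub_add_norm_sub _ (P.f s (π (Y y₀ s)) +
          P.g s (π (Y y₀ s)) (P.optimalFeedback M s (π (Y y₀ s)))) _).trans ?_
        rw [add_comm]
        refine add_le_add ((hLφ s hs' _ (hπB _) _ (hyB y₀ s hs')).trans ?_)
          (hφdiff s hs' _ (hπB _))
        have h2 : ‖π (Y y₀ s) - π (H1.rep (yopt y₀) s)‖ ≤ 2 * ‖Y y₀ s - H1.rep (yopt y₀) s‖ :=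
          norm_radialRetraction_sub_le hρ _ _
        rw [hπid _ (hyB y₀ s hs')] at h2
        calc _ ≤ Lφ * (2 * ‖Y y₀ s - H1.rep (yopt y₀) s‖) := by gcongr
          _ = _ := by ring) ht
    rw [hY0, (hyopt y₀).1.2, sub_self, norm_zero, zero_add] at this
    refine this.trans_eq ?_
    rw [ha₁]; ring
  have hYB : ∀ y₀, ∀ t ∈ Icc 0 P.T, Y y₀ t ∈ P.stateBall M := by
    intro y₀ t ht
    refine hball _ (hyM y₀ t ht) ?_
    rw [Metric.mem_closedBall, dist_eq_norm]
    exact (hclose y₀ t ht).trans ((mul_le_mul_of_nonneg_right ha₁a hε0.le).trans hεr)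
  obtain ⟨ys, hys⟩ := P.exists_continuous_closedLoop hdyn hFVt hYB hYc (fun y₀ t ht => by
    rw [hY y₀ t ht]
    congr 1
    refine intervalIntegral.integral_congr fun s hs => ?_
    rw [uIcc_of_le ht.1] at hs
    have h1 := hπid _ (hYB y₀ s ⟨hs.1, hs.2.trans ht.2⟩)
    change P.f s (π (Y y₀ s)) + P.g s (π (Y y₀ s)) (P.approxFeedback V s (π (Y y₀ s))) = _
    rw [h1])
  have hysB : ∀ y₀, ∀ t ∈ Icc 0 P.T, H1.rep (ys y₀) t ∈ P.stateBall M := fun y₀ t ht => by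
    rw [(hys y₀).2 t ht]; exact hYB y₀ t ht
  have hysclose : ∀ y₀, ∀ t ∈ Icc 0 P.T,
      ‖H1.rep (ys y₀) t - H1.rep (yopt y₀) t‖ ≤ a₁ * ε := fun y₀ t ht => by
    rw [(hys y₀).2 t ht]; exact hclose y₀ t ht
  obtain ⟨ps, hps⟩ := P.exists_continuous_adjoint hdyn hFVt ys hysB
  refine ⟨ys, ps, fun y₀ => ?_⟩
  set y := H1.rep (ys y₀) with hy
  set z := H1.rep (yopt y₀) with hz
  set u : ℝ → E m := fun t => P.approxFeedback V t (y t) with hu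
  set w : ℝ → E m := fun t => P.optimalFeedback M t (z t) with hw
  have hyc' : ContinuousOn y (Icc 0 P.T) := H1.continuousOn_rep hT _
  have huc : ContinuousOn u (Icc 0 P.T) := hFVt.comp_curve subset_rfl hyc' (hysB y₀)
  have hwc : ContinuousOn w (Icc 0 P.T) := hFt.comp_curve subset_rfl (hyc y₀) (hyB y₀)
  have hstate : ∀ s ∈ Icc 0 P.T, ‖y s - z s‖ ≤ a * ε := fun s hs =>
    (hysclose y₀ s hs).trans (mul_le_mul_of_nonneg_right ha₁a hε0.le)
  have huw : ∀ s ∈ Icc 0 P.T, ‖u s - w s‖ ≤ a * ε := by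
    intro s hs
    refine (norm_sub_le_norm_sub_add_norm_sub _ (P.optimalFeedback M s (y s)) _).trans ?_
    have h1 := hFdiff s hs _ (hysB y₀ s hs)
    have h2 := hLF s hs _ (hysB y₀ s hs) _ (hyB y₀ s hs)
    have h3 := mul_le_mul_of_nonneg_left (hysclose y₀ s hs) hLF0
    have h4 := mul_le_mul_of_nonneg_right ha₃a hε0.le
    change ‖u s - P.optimalFeedback M s (y s)‖ ≤ _ at h1
    change ‖P.optimalFeedback M s (y s) - w s‖ ≤ _ at h2
    linarith
  -- Since the optimal trajectory has norm at most M, this yields the state constraint with 2M.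
  have hnorm : ‖ys y₀ - yopt y₀‖ ≤ M := by
    refine (H1.norm_sub_le hT (η := a * ε) _ _ (by positivity) hstate ?_).trans hεM
    filter_upwards [(hys y₀).1.1, (hyopt y₀).1.1, ae_restrict_mem measurableSet_Ioo]
      with s h1 h2 hs
    have hs' := Ioo_subset_Icc_self hs
    rw [h1, h2]
    refine (norm_sub_le_norm_sub_add_norm_sub _
      (P.f s (y s) + P.g s (y s) (P.optimalFeedback M s (y s))) _).trans ?_
    have h3 := hφdiff s hs' _ (hysB y₀ s hs')
    have h4 := hLφ s hs' _ (hysB y₀ s hs') _ (hyB y₀ s hs')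
    have h5 := mul_le_mul_of_nonneg_left (hysclose y₀ s hs') hLφ0
    have h6 := mul_le_mul_of_nonneg_right ha₂a hε0.le
    refine (add_le_add h3 (h4.trans h5)).trans ?_
    linarith
  have hopt' : P.IsOptimalPair y₀ (yopt y₀) w := hyoptimal y₀
  obtain ⟨p, hp⟩ := P.exists_isAdjointCurve hdyn (hyc y₀) (hyB y₀) hwc
  have hgrad : ∀ t ∈ Ico 0 P.T, q t (z t) = p t := fun t ht =>
    P.gradBall_valueFunction_eq hdyn hval hwc hopt' (hyM y₀) hp ht
  have haε₀ : a * ε ≤ a * ε₀ := mul_le_mul_of_nonneg_left hεε₀ ha0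
  have haε₀0 : 0 ≤ a * ε₀ := by positivity
  have hbnd : ∀ s ∈ Icc 0 P.T, ‖y s‖ ≤ R ∧ ‖z s‖ ≤ R ∧ ‖u s‖ ≤ R ∧ ‖w s‖ ≤ R ∧ ‖p s‖ ≤ R := by
    intro s hs
    have h1 : ‖y s‖ ≤ 2 * P.Mhat M := mem_closedBall_zero_iff.1 (hysB y₀ s hs)
    have h2 : ‖z s‖ ≤ 2 * P.Mhat M := mem_closedBall_zero_iff.1 (hyB y₀ s hs)
    have h3 : ‖w s‖ ≤ CF := hCF s hs _ (hyB y₀ s hs)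
    have h4 : ‖u s‖ ≤ CF + a * ε₀ := by
      have := norm_le_norm_add_norm_sub' (u s) (w s)
      have := huw s hs
      linarith
    have h5 : ‖p s‖ ≤ Cq + pT := by
      rcases hs.2.eq_or_lt with rfl | hlt
      · rw [hp.terminal]
        have : ‖ContinuousLinearMap.adjoint P.Q₂ (P.Q₂ (z P.T - P.ydT))‖ ≤ pT := by
          refine (ContinuousLinearMap.le_opNorm_of_le _ (P.Q₂.le_opNorm_of_le
            ((norm_sub_le _ _).trans (add_le_add_left (hyM y₀ _ hs) _)))).trans_eq ?_
          rw [LinearIsometryEquiv.norm_map, hpT]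
        linarith
      · rw [← hgrad s ⟨hs.1, hlt⟩]
        have := hCq s hs _ (hyB y₀ s hs)
        linarith
    refine ⟨?_, ?_, ?_, ?_, ?_⟩ <;> linarith
  have hcost : ∀ t ∈ Icc 0 P.T, |P.cost t y u - P.cost t z w| ≤ Kc * (a * ε) := fun t ht =>
    hKc t ht _ _ _ _ _ hyc' (hyc y₀) huc hwc
      (fun s hs => ⟨(hbnd s hs).1, (hbnd s hs).2.1, (hbnd s hs).2.2.1, (hbnd s hs).2.2.2.1⟩)
      fun s hs => ⟨hstate s hs, huw s hs⟩
  have hvalue : ∀ t ∈ Ico 0 P.T, P.valueFunction t (z t) = P.cost t z w := fun t ht =>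
    P.valueFunction_eq_cost hopt' ht
  have hadj := hKp _ _ _ _ _ _ (a * ε) hyc' (hyc y₀) huc hwc (hps y₀).2 hp
    (fun s hs => ⟨hysB y₀ s hs, hyB y₀ s hs⟩)
    (fun s hs => ⟨(hbnd s hs).2.2.1, (hbnd s hs).2.2.2.1, (hbnd s hs).2.2.2.2⟩)
    (fun s hs => ⟨hstate s hs, huw s hs⟩)
  -- Squaring yields ε², and one factor is absorbed by ε ≤ ε₀.
  have hsq : ∀ {b x : ℝ}, 0 ≤ x → x ≤ b * ε → |x ^ 2| ≤ b ^ 2 * ε₀ * ε := by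
    intro b x hx hxb
    rw [abs_of_nonneg (sq_nonneg x)]
    calc x ^ 2 ≤ (b * ε) ^ 2 := by gcongr
      _ = b ^ 2 * ε * ε := by ring
      _ ≤ _ := by gcongr
  have hv₁ : 0 ≤ b₁ ^ 2 * ε₀ * P.T * ε := by positivity
  have hv₂ : 0 ≤ b₂ ^ 2 * ε₀ * P.T * ε := by positivity
  have hv₃ : 0 ≤ Kc * a * ε := by positivity
  refine ⟨?_, (hys y₀).1, (hps y₀).1, ?_, ?_, ?_⟩
  · have := norm_le_norm_add_norm_sub' (ys y₀) (yopt y₀)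
    linarith [(hyopt y₀).2]
  · have h1 := (abs_le.1 (hcost 0 h0)).2
    rw [← hvalue 0 ⟨le_rfl, hT⟩, hz, (hyopt y₀).1.2] at h1
    change P.cost 0 y u ≤ _
    linarith
  · refine (setIntegral_Ioo_le_of_abs_le hT.le (b := b₁ ^ 2 * ε₀ * ε) fun t ht => ?_).trans ?_
    · refine hsq (abs_nonneg _) ?_
      have ht' := Ioo_subset_Icc_self ht
      -- The chain runs from V at y to V* at y, to V* at the optimal state z, which equals the
      -- cost-to-go of the optimal pair, and on to the cost-to-go of the competitor.
      have h1 := (happ t ht' _ (hysB y₀ t ht')).1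
      have h2 := hLV t ht' _ (hysB y₀ t ht') _ (hyB y₀ t ht')
      have h3 := mul_le_mul_of_nonneg_left (hstate t ht') hLV0
      have h4 := hcost t ht'
      rw [← hvalue t ⟨ht.1.le, ht.2⟩, abs_sub_comm] at h4
      rw [Real.norm_eq_abs] at h2
      change |V t (y t) - P.valueFunction t (y t)| ≤ _ at h1
      change |P.valueFunction t (y t) - P.valueFunction t (z t)| ≤ _ at h2
      change |V t (y t) - P.cost t y u| ≤ _
      have h5 := abs_sub_le (V t (y t)) (P.valueFunction t (y t)) (P.cost t y u)
      have h6 := abs_sub_le (P.valueFunction t (y t)) (P.valueFunction t (z t)) (P.cost t y u)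
      rw [hb₁]
      linarith
    · linarith
  · refine (setIntegral_Ioo_le_of_abs_le hT.le (b := b₂ ^ 2 * ε₀ * ε) fun t ht => ?_).trans ?_
    · refine hsq (norm_nonneg _) ?_
      have ht' := Ioo_subset_Icc_self ht
      -- The same chain for gradients: the gradient of V* along the optimal trajectory is its
      -- adjoint state p, which is close to the adjoint state of the competitor.
      have h1 := (happ t ht' _ (hysB y₀ t ht')).2
      have h2 := hLq t ht' _ (hysB y₀ t ht') _ (hyB y₀ t ht')
      have h3 := mul_le_mul_of_nonneg_left (hstate t ht') hLq0
      have h4 := (hadj t ht').1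
      rw [norm_sub_rev] at h4
      change ‖gradient (V t) (y t) - q t (y t)‖ ≤ _ at h1
      change ‖q t (y t) - q t (z t)‖ ≤ _ at h2
      rw [hgrad t ⟨ht.1.le, ht.2⟩] at h2
      have h5 := norm_sub_le_norm_sub_add_norm_sub (gradient (V t) (y t)) (q t (y t))
        (H1.rep (ps y₀) t)
      have h6 := norm_sub_le_norm_sub_add_norm_sub (q t (y t)) (p t) (H1.rep (ps y₀) t)
      change ‖gradient (V t) (y t) - H1.rep (ps y₀) t‖ ≤ _
      rw [hb₂]
      linarith
    · linarith

end ControlProblem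

end

end FeedbackLearning

set_option linter.unusedSectionVars false

namespace FeedbackLearning

noncomputable section

/-! ### Feasibility and continuity of the integrands in the initial value -/

theorem isFiniteMeasure_normalizedLebesgue {n : ℕ} {Y₀ : Set (E n)} (hY₀ : IsCompact Y₀)
    (hpos : 0 < volume Y₀) : IsFiniteMeasure (normalizedLebesgue Y₀) := by
  refine ⟨?_⟩
  rw [normalizedLebesgue, Measure.smul_apply, comap_subtype_coe_apply hY₀.measurableSet, smul_eq_mul,
    image_univ, Subtype.range_coe]
  exact ENNReal.mul_lt_top (ENNReal.inv_lt_top.2 hpos) hY₀.measure_lt_top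

theorem exists_bound_of_continuous_prod {Y X : Type*} [TopologicalSpace Y] [CompactSpace Y]
    [NormedAddCommGroup X] {a b : ℝ} {G : Y → ℝ → X}
    (hG : Continuous fun q : Y × Icc a b => G q.1 q.2) :
    ∃ R, ∀ y, ∀ t ∈ Icc a b, ‖G y t‖ ≤ R := by
  obtain ⟨R, hR⟩ := isCompact_univ.exists_bound_of_continuousOn hG.continuousOn
  exact ⟨R, fun y t ht => hR (y, ⟨t, ht⟩) (mem_univ _)⟩

theorem continuousOn_slice {Y X : Type*} [TopologicalSpace Y] [TopologicalSpace X] {a b : ℝ}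
    {G : Y → ℝ → X} (hG : Continuous fun q : Y × Icc a b => G q.1 q.2) (y : Y) :
    ContinuousOn (G y) (Icc a b) := by
  rw [continuousOn_iff_continuous_domRestrict]
  exact hG.comp (f := fun t : Icc a b => (y, t)) (by fun_prop)

/-- Joint continuity makes the L²-valued map continuous in the parameter; on a compact parameter set
it is then measurable and bounded. This provides the control constraint of the learning problem. -/
theorem exists_memLp_L2_of_continuous {n m : ℕ} {Y₀ : Set (E n)} [CompactSpace Y₀]
    {μ : Measure Y₀} [IsFiniteMeasure μ] {T : ℝ} {G : Y₀ → ℝ → E m}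
    (hG : Continuous fun q : Y₀ × Icc 0 T => G q.1 q.2) :
    ∃ U : Y₀ → L2 0 T m, MemLp U 2 μ ∧ ∀ y₀, U y₀ =ᵐ[volume.restrict (Ioo 0 T)] G y₀ := by
  have hm : ∀ y₀, MemLp (G y₀) 2 (volume.restrict (Ioo 0 T)) := fun y₀ =>
    memLp_two_of_continuousOn (continuousOn_slice hG y₀)
  have hcont : Continuous fun y₀ => (hm y₀).toLp (G y₀) := by
    refine continuous_iff_continuousAt.2 fun y₁ => Metric.tendsto_nhds.2 fun η hη => ?_
    set k : ℝ := (measureUnivNNReal (volume.restrict (Ioo 0 T)) : ℝ) ^ (2 : ENNReal).toReal⁻¹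
      with hk
    have hk0 : 0 ≤ k := by positivity
    have hη' : 0 < η / (k + 1) := by positivity
    filter_upwards [eventually_norm_sub_lt hG y₁ hη'] with y₀ hy₀
    rw [dist_eq_norm, ← MemLp.toLp_sub]
    have h1 : ‖((hm y₀).sub (hm y₁)).toLp (G y₀ - G y₁)‖ ≤ k * (η / (k + 1)) := by
      refine Lp.norm_le_of_ae_bound hη'.le ?_
      filter_upwards [((hm y₀).sub (hm y₁)).coeFn_toLp, ae_restrict_mem measurableSet_Ioo]
        with t h2 ht
      rw [h2]
      exact (hy₀ t (Ioo_subset_Icc_self ht)).le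
    refine h1.trans_lt ?_
    rw [mul_div_assoc', div_lt_iff₀ (by positivity)]
    linarith
  refine ⟨_, ?_, fun y₀ => (hm y₀).coeFn_toLp⟩
  obtain ⟨C, hC⟩ := isCompact_univ.exists_bound_of_continuousOn hcont.continuousOn
  exact MemLp.of_bound hcont.aestronglyMeasurable C (ae_of_all _ fun y => hC y (mem_univ y))

namespace ControlProblem

variable {n m : ℕ} (P : ControlProblem n m) {M : ℝ}

section Continuity

variable {Y : Type*} [TopologicalSpace Y] (ys : C(Y, P.W))

theorem continuous_comp_rep {X : Type*} [TopologicalSpace X] {φ : ℝ → E n → X}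
    (hφ : ContinuousOn (fun q : ℝ × E n => φ q.1 q.2) (Icc 0 P.T ×ˢ P.stateBall M))
    (hB : ∀ y₀, ∀ t ∈ Icc 0 P.T, H1.rep (ys y₀) t ∈ P.stateBall M) :
    Continuous fun q : Y × Icc 0 P.T => φ q.2 (H1.rep (ys q.1) q.2) :=
  hφ.comp_continuous (f := fun q : Y × Icc 0 P.T => ((q.2 : ℝ), H1.rep (ys q.1) q.2))
    ((continuous_subtype_val.comp continuous_snd).prodMk (H1.continuous_rep P.T_pos ys.continuous))
    fun q => ⟨q.2.2, hB q.1 q.2 q.2.2⟩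

variable [CompactSpace Y] {V : ℝ → E n → ℝ} (hdyn : P.SmoothDynamics)
  (hV : ContDiff ℝ 2 fun q : ℝ × E n => V q.1 q.2)
  (hB : ∀ y₀, ∀ t ∈ Icc 0 P.T, H1.rep (ys y₀) t ∈ P.stateBall M)

include hdyn hV hB

theorem continuous_approxControl :
    Continuous fun q : Y × Icc 0 P.T => P.approxControl V (ys q.1) q.2 :=
  P.continuous_comp_rep ys (P.tame_approxFeedback hdyn hV).cont hB

/-- For fixed y₀ the cost-to-go is continuous in t as an integral with moving lower limit.
Continuity in y₀ is uniform in t because the Lipschitz constant of the cost does not depend on the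
initial time. -/
theorem continuous_cost :
    Continuous fun q : Y × Icc 0 P.T =>
      P.cost q.2 (H1.rep (ys q.1)) (P.approxControl V (ys q.1)) := by
  have hu := P.continuous_approxControl ys hdyn hV hB
  have hy := H1.continuous_rep P.T_pos ys.continuous
  have huc := fun y₀ => continuousOn_slice (G := fun y₀ => P.approxControl V (ys y₀)) hu y₀
  have hyc := fun y₀ => H1.continuousOn_rep P.T_pos (ys y₀)
  obtain ⟨R₁, hR₁⟩ := exists_bound_of_continuous_prod
    (G := fun y₀ => P.approxControl V (ys y₀)) hu
  obtain ⟨R₂, hR₂⟩ := exists_bound_of_continuous_prod (G := fun y₀ => H1.rep (ys y₀)) hy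
  obtain ⟨K, hK0, hK⟩ := P.exists_abs_cost_sub_le (max R₁ R₂)
  refine continuous_of_eventually_norm_sub_lt
    (G := fun y₀ t => P.cost t (H1.rep (ys y₀)) (P.approxControl V (ys y₀)))
    (fun y₀ => P.continuousOn_cost (hyc y₀) (memLp_two_of_continuousOn (huc y₀)))
    fun y₁ η hη => ?_
  have hη' : 0 < η / (K + 1) := by positivity
  filter_upwards [eventually_norm_sub_lt (G := fun y₀ => P.approxControl V (ys y₀)) hu y₁ hη',
    eventually_norm_sub_lt (G := fun y₀ => H1.rep (ys y₀)) hy y₁ hη'] with y₀ h1 h2 t ht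
  have := hK t ht _ _ _ _ (η / (K + 1)) (hyc y₀) (hyc y₁) (huc y₀) (huc y₁)
    (fun s hs => ⟨(hR₂ y₀ s hs).trans (le_max_right _ _), (hR₂ y₁ s hs).trans (le_max_right _ _),
      (hR₁ y₀ s hs).trans (le_max_left _ _), (hR₁ y₁ s hs).trans (le_max_left _ _)⟩)
    fun s hs => ⟨(h2 s hs).le, (h1 s hs).le⟩
  refine this.trans_lt ?_
  rw [mul_div_assoc', div_lt_iff₀ (by positivity)]
  linarith

theorem continuous_initial_cost :
    Continuous fun y₀ => P.cost 0 (H1.rep (ys y₀)) (P.approxControl V (ys y₀)) :=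
  (P.continuous_cost ys hdyn hV hB).comp
    (f := fun y₀ => (y₀, (⟨0, left_mem_Icc.2 P.T_pos.le⟩ : Icc 0 P.T))) (by fun_prop)

theorem continuous_valueMisfit : Continuous fun y₀ => P.valueMisfit V (ys y₀) := by
  have h := P.continuous_comp_rep ys (φ := V) hV.continuous.continuousOn hB
  exact continuous_setIntegral_of_continuous P.T_pos.le
    ((h.sub (P.continuous_cost ys hdyn hV hB)).abs.pow 2)

omit hdyn [CompactSpace Y] in
theorem continuous_gradientMisfit (ps : C(Y, P.W)) :
    Continuous fun y₀ => P.gradientMisfit V (ys y₀) (ps y₀) := by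
  have h := P.continuous_comp_rep ys (φ := fun t y => gradient (V t) y)
    (P.tame_gradient hV).cont hB
  exact continuous_setIntegral_of_continuous P.T_pos.le
    ((h.sub (H1.continuous_rep P.T_pos ps.continuous)).norm.pow 2)

end Continuity

theorem valueMisfit_nonneg (V : ℝ → E n → ℝ) (y : P.W) : 0 ≤ P.valueMisfit V y :=
  integral_nonneg fun _ => by positivity

theorem gradientMisfit_nonneg (V : ℝ → E n → ℝ) (y p : P.W) : 0 ≤ P.gradientMisfit V y p :=
  integral_nonneg fun _ => by positivity

theorem isFeasible_of_forall {Y₀ : Set (E n)} (hY₀ : IsCompact Y₀) (hpos : 0 < volume Y₀)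
    (hdyn : P.SmoothDynamics) {V : ℝ → E n → ℝ} (hV : ContDiff ℝ 2 fun q : ℝ × E n => V q.1 q.2)
    {ys ps : C(Y₀, P.W)} (hM : ∀ y₀, ‖ys y₀‖ ≤ 2 * M)
    (hs : ∀ y₀ : Y₀, P.IsClosedLoop (P.approxFeedback V) y₀ (ys y₀))
    (ha : ∀ y₀ : Y₀, P.IsAdjoint (P.approxFeedback V) (ys y₀) (ps y₀)) :
    P.IsFeasible Y₀ M V ys ps := by
  have := isCompact_iff_compactSpace.1 hY₀
  have := isFiniteMeasure_normalizedLebesgue hY₀ hpos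
  obtain ⟨U, hU, hUG⟩ := exists_memLp_L2_of_continuous (μ := normalizedLebesgue Y₀)
    (G := fun y₀ => P.approxControl V (ys y₀))
    (P.continuous_approxControl (M := M) ys hdyn hV fun y₀ t ht => P.rep_mem_stateBall (hM y₀) ht)
  exact ⟨hM, ⟨U, hU, ae_of_all _ hUG⟩, ae_of_all _ hs, ae_of_all _ ha⟩

/-- Forgetting the feedback structure leaves an admissible open loop pair. This gives the lower
bound for every feasible triple. -/
theorem valueFunction_le_cost_of_isClosedLoop {F : ℝ → E n → E m} {y₀ : E n} {y : P.W}
    (h : P.IsClosedLoop F y₀ y) (hc : ContinuousOn (fun t => F t (H1.rep y t)) (Icc 0 P.T)) :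
    P.valueFunction 0 y₀ ≤ P.cost 0 (H1.rep y) fun t => F t (H1.rep y t) :=
  P.valueFunction_le_cost P.T_pos ⟨memLp_two_of_continuousOn hc, h.1, h.2⟩

end ControlProblem

end

end FeedbackLearning

namespace FeedbackLearning

noncomputable section

/-! ### Comparison of the objectives -/

/-- If a weighted sum of three terms exceeds the weighted lower bound `v` of the first term by at
most `κ`, then so do the individual terms. -/
theorem weighted_gap_bounds {Y : Type*} [MeasurableSpace Y] {μ : Measure Y} {wt a b d v : Y → ℝ}
    {γ₁ γ₂ κ : ℝ} (hγ₁ : 0 ≤ γ₁) (hγ₂ : 0 ≤ γ₂) (hwt : ∀ᵐ y ∂μ, 0 ≤ wt y)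
    (ha : Integrable (fun y => wt y * a y) μ) (hb : Integrable (fun y => wt y * b y) μ)
    (hd : Integrable (fun y => wt y * d y) μ) (hv : Integrable (fun y => wt y * v y) μ)
    (hva : ∀ᵐ y ∂μ, v y ≤ a y) (hb0 : ∀ y, 0 ≤ b y) (hd0 : ∀ y, 0 ≤ d y)
    (h : ∫ y, wt y * (a y + γ₁ / 2 * b y + γ₂ / 2 * d y) ∂μ ≤ (∫ y, wt y * v y ∂μ) + κ) :
    (Integrable (fun y => wt y * (a y - v y)) μ ∧ 0 ≤ ∫ y, wt y * (a y - v y) ∂μ ∧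
      ∫ y, wt y * (a y - v y) ∂μ ≤ κ) ∧
    (0 < γ₁ → 0 < γ₂ → Integrable (fun y => wt y * (b y + d y)) μ ∧
      ∫ y, wt y * (b y + d y) ∂μ ≤ (2 / γ₁ + 2 / γ₂) * κ) := by
  have hb1 : 0 ≤ ∫ y, wt y * b y ∂μ :=
    integral_nonneg_of_ae (hwt.mono fun y hy => mul_nonneg hy (hb0 y))
  have hd1 : 0 ≤ ∫ y, wt y * d y ∂μ :=
    integral_nonneg_of_ae (hwt.mono fun y hy => mul_nonneg hy (hd0 y))
  have hav : 0 ≤ ∫ y, wt y * (a y - v y) ∂μ := by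
    refine integral_nonneg_of_ae ?_
    filter_upwards [hwt, hva] with y h1 h2 using mul_nonneg h1 (sub_nonneg.2 h2)
  have e1 : ∫ y, wt y * (a y + γ₁ / 2 * b y + γ₂ / 2 * d y) ∂μ =
      (∫ y, wt y * a y ∂μ) + γ₁ / 2 * (∫ y, wt y * b y ∂μ) + γ₂ / 2 * ∫ y, wt y * d y ∂μ := by
    have hab : Integrable (fun y => wt y * a y + γ₁ / 2 * (wt y * b y)) μ :=
      ha.add (hb.const_mul _)
    rw [← integral_const_mul, ← integral_const_mul, ← integral_add ha (hb.const_mul _),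
      ← integral_add hab (hd.const_mul _)]
    exact integral_congr_ae (ae_of_all _ fun y => by ring)
  have e2 : ∫ y, wt y * (a y - v y) ∂μ = (∫ y, wt y * a y ∂μ) - ∫ y, wt y * v y ∂μ := by
    rw [← integral_sub ha hv]
    exact integral_congr_ae (ae_of_all _ fun y => by ring)
  have e3 : ∫ y, wt y * (b y + d y) ∂μ = (∫ y, wt y * b y ∂μ) + ∫ y, wt y * d y ∂μ := by
    rw [← integral_add hb hd]
    exact integral_congr_ae (ae_of_all _ fun y => by ring)
  have p1 : 0 ≤ γ₁ / 2 * ∫ y, wt y * b y ∂μ := by positivity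
  have p2 : 0 ≤ γ₂ / 2 * ∫ y, wt y * d y ∂μ := by positivity
  refine ⟨⟨(ha.sub hv).congr (ae_of_all _ fun y => by simp [mul_sub]), hav, by linarith⟩,
    fun g1 g2 => ⟨(hb.add hd).congr (ae_of_all _ fun y => by simp [mul_add]), ?_⟩⟩
  -- The gap of the first term and the other misfit are nonnegative, so each misfit alone is bounded
  -- by the total excess.
  have q1 : ∫ y, wt y * b y ∂μ ≤ 2 / γ₁ * κ := by
    rw [div_mul_eq_mul_div, le_div_iff₀ g1]
    linarith
  have q2 : ∫ y, wt y * d y ∂μ ≤ 2 / γ₂ * κ := by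
    rw [div_mul_eq_mul_div, le_div_iff₀ g2]
    linarith
  rw [e3, add_mul]
  linarith

theorem integrable_mul_of_continuous {Y : Type*} [TopologicalSpace Y] [CompactSpace Y]
    [MeasurableSpace Y] [OpensMeasurableSpace Y] {μ : Measure Y} {wt h : Y → ℝ}
    (hwt : Integrable wt μ) (hh : Continuous h) : Integrable (fun y => wt y * h y) μ := by
  obtain ⟨C, hC⟩ := isCompact_univ.exists_bound_of_continuousOn hh.continuousOn
  exact hwt.mul_bdd hh.aestronglyMeasurable (ae_of_all _ fun y => hC y (mem_univ y))

namespace ControlProblem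

variable {n m : ℕ} (P : ControlProblem n m) {M : ℝ}

/-- Each y₀ is the starting point of a trajectory of norm at most M, so Y₀ lies in the state ball,
where V* is continuous. -/
theorem continuous_valueFunction_restrict (hval : P.SmoothValue M) {Y₀ : Set (E n)}
    (hopt : P.OptimalClosedLoop Y₀ M) : Continuous fun y₀ : Y₀ => P.valueFunction 0 y₀ := by
  refine hval.tame_valueFunction.cont.comp_continuous (f := fun y₀ : Y₀ => ((0 : ℝ), (y₀ : E n)))
    (by fun_prop) fun y₀ => ⟨left_mem_Icc.2 P.T_pos.le, ?_⟩
  obtain ⟨y, ⟨hy, hyM⟩, -⟩ := hopt y₀ y₀.2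
  refine P.mem_stateBall hval.M_pos ?_
  rw [← hy.2]
  exact P.norm_rep_le_Mhat hyM (left_mem_Icc.2 P.T_pos.le)

section Family

variable {ε₀ : ℝ} {R : ℝ → Type*} [∀ ε, NormedAddCommGroup (R ε)]
  [∀ ε, InnerProductSpace ℝ (R ε)] {V : ∀ ε, R ε → ℝ → E n → ℝ} {θ : ∀ ε, R ε} {P}

theorem ApproximatingFamily.contDiff_two (hV : P.ApproximatingFamily M ε₀ V θ) {ε : ℝ}
    (hε : ε ∈ Ioc 0 ε₀) (ϑ : R ε) : ContDiff ℝ 2 fun q : ℝ × E n => V ε ϑ q.1 q.2 :=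
  ((hV.contDiff ε hε).of_le (by norm_num)).comp (f := fun q : ℝ × E n => (ϑ, q.1, q.2))
    (by fun_prop)

theorem ApproximatingFamily.exists_approx (hV : P.ApproximatingFamily M ε₀ V θ)
    (hval : P.SmoothValue M) :
    ∃ c > 0, ∀ ε ∈ Ioc 0 ε₀, ∀ t ∈ Icc 0 P.T, ∀ y ∈ P.stateBall M,
      |V ε (θ ε) t y - P.valueFunction t y| ≤ c * ε ∧
      ‖gradient (V ε (θ ε) t) y - P.gradBall M P.valueFunction t y‖ ≤ c * ε := by
  obtain ⟨c, hc, h⟩ := hV.approx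
  refine ⟨c, hc, fun ε hε t ht y hy => ?_⟩
  have := h ε hε t ht y hy
  rw [P.gradBall_sub_eq (hV.contDiff_two hε (θ ε)) hval ht hy] at this
  have h1 := abs_nonneg (V ε (θ ε) t y - P.valueFunction t y)
  have h2 := norm_nonneg (gradient (V ε (θ ε) t) y - P.gradBall M P.valueFunction t y)
  have h3 := norm_nonneg
    (P.hessBall M (fun s z => V ε (θ ε) s z - P.valueFunction s z) t y)
  constructor <;> linarith

end Family

end ControlProblem

end

end FeedbackLearning

theorem mainTheorem3 {n m : ℕ} (P : ControlProblem n m)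
    (Y₀ : Set (E n)) (hY₀ : IsCompact Y₀) (hY₀_pos : 0 < volume Y₀)
    (M : ℝ) (hdyn : P.SmoothDynamics) (hval : P.SmoothValue M) (hopt : P.OptimalClosedLoop Y₀ M)
    (wt : Y₀ → ℝ) (hwt : MemLp wt ⊤ (normalizedLebesgue Y₀))
    (hwt_pos : ∃ δ > 0, ∀ᵐ y₀ ∂(normalizedLebesgue Y₀), δ ≤ wt y₀)
    (γ₁ γ₂ : ℝ) (hγ₁ : 0 ≤ γ₁) (hγ₂ : 0 ≤ γ₂)
    (ε₀ : ℝ) (hε₀ : 0 < ε₀)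
    {R : ℝ → Type*} [∀ ε, NormedAddCommGroup (R ε)] [∀ ε, InnerProductSpace ℝ (R ε)]
    [∀ ε, FiniteDimensional ℝ (R ε)]
    (V : ∀ ε, R ε → ℝ → E n → ℝ) (θ : ∀ ε, R ε) (hV : P.ApproximatingFamily M ε₀ V θ)
    (γ : ℝ → ℝ) (hγ : ∀ ε ∈ Ioc 0 ε₀, 0 < γ ε)
    (hγθ : (fun ε => γ ε * ‖θ ε‖ ^ 2) =O[𝓝[>] 0] fun ε => ε) :
    ∃ c > 0, ∀ᶠ ε in 𝓝[>] (0 : ℝ), ∀ (ys ps : C(Y₀, P.W)) (ϑ : R ε),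
      P.IsOptimalTriple Y₀ M wt γ₁ γ₂ (γ ε) (V ε) ys ps ϑ →
      (Integrable (fun y₀ : Y₀ => wt y₀ *
          (P.cost 0 (H1.rep (ys y₀)) (P.approxControl (V ε ϑ) (ys y₀)) - P.valueFunction 0 y₀))
          (normalizedLebesgue Y₀) ∧
        0 ≤ ∫ y₀ : Y₀, wt y₀ *
          (P.cost 0 (H1.rep (ys y₀)) (P.approxControl (V ε ϑ) (ys y₀)) - P.valueFunction 0 y₀)
          ∂(normalizedLebesgue Y₀) ∧
        ∫ y₀ : Y₀, wt y₀ *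
          (P.cost 0 (H1.rep (ys y₀)) (P.approxControl (V ε ϑ) (ys y₀)) - P.valueFunction 0 y₀)
          ∂(normalizedLebesgue Y₀) ≤ c * ε) ∧
      (0 < γ₁ → 0 < γ₂ →
        Integrable (fun y₀ : Y₀ => wt y₀ *
          (P.valueMisfit (V ε ϑ) (ys y₀) + P.gradientMisfit (V ε ϑ) (ys y₀) (ps y₀)))
          (normalizedLebesgue Y₀) ∧
        ∫ y₀ : Y₀, wt y₀ *
          (P.valueMisfit (V ε ϑ) (ys y₀) + P.gradientMisfit (V ε ϑ) (ys y₀) (ps y₀))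
          ∂(normalizedLebesgue Y₀) ≤ c * ε) := by
  have := isCompact_iff_compactSpace.1 hY₀
  have := isFiniteMeasure_normalizedLebesgue hY₀ hY₀_pos
  set μ := normalizedLebesgue Y₀ with hμ
  have hwtI : Integrable wt μ := hwt.integrable le_top
  obtain ⟨δ, hδ, hwtδ⟩ := hwt_pos
  have hwt0 : ∀ᵐ y₀ ∂μ, 0 ≤ wt y₀ := hwtδ.mono fun y h => hδ.le.trans h
  have hI : ∀ {h : Y₀ → ℝ}, Continuous h → Integrable (fun y₀ => wt y₀ * h y₀) μ := fun hh =>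
    integrable_mul_of_continuous hwtI hh
  have hvc := P.continuous_valueFunction_restrict hval hopt
  obtain ⟨c, hc, hclose⟩ := hV.exists_approx hval
  obtain ⟨C, hC, ε₁, hε₁, hfam⟩ := P.exists_almost_optimal_family hdyn hval hopt hc.le hε₀
  obtain ⟨D, hD⟩ := hγθ.bound
  set W : ℝ := ∫ y₀, wt y₀ ∂μ with hW
  have hW0 : 0 ≤ W := integral_nonneg_of_ae hwt0
  set K : ℝ := C + γ₁ / 2 * C + γ₂ / 2 * C with hK
  have hK0 : 0 ≤ K := by positivity
  -- The first term comes from the augmented cost of the competitor integrated against the weight,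
  -- the second from its penalty γ_ε‖θ_ε‖²/2.
  set c₀ : ℝ := K * W + |D| / 2 with hc₀
  have hc₀0 : 0 ≤ c₀ := by positivity
  -- A single factor for both estimates. If some γᵢ vanishes, its quotient is 0 by convention, so A
  -- ≥ 1 in all cases and the second factor is relevant only for positive parameters.
  set A : ℝ := 1 + (2 / γ₁ + 2 / γ₂) with hA
  have hA1 : 1 ≤ A := by
    have : 0 ≤ 2 / γ₁ + 2 / γ₂ := by positivity
    linarith
  refine ⟨A * (c₀ + 1), by positivity, ?_⟩
  have hmem : ∀ᶠ ε in 𝓝[>] (0 : ℝ), ε ∈ Ioc 0 (min ε₁ ε₀) :=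
    Ioc_mem_nhdsGT (lt_min hε₁ hε₀)
  filter_upwards [hmem, hD] with ε hε hDε ys ps ϑ hoptT
  have hε' : ε ∈ Ioc 0 ε₀ := ⟨hε.1, hε.2.trans (min_le_right _ _)⟩
  -- The competitor, with the parameter θ_ε.
  obtain ⟨zs, qs, hz⟩ := hfam ε ⟨hε.1, hε.2.trans (min_le_left _ _)⟩ hε'.2 (V ε (θ ε))
    (hV.contDiff_two hε' _) (hclose ε hε')
  have hfeas := P.isFeasible_of_forall hY₀ hY₀_pos hdyn (hV.contDiff_two hε' (θ ε))
    (fun y₀ => (hz y₀).1) (fun y₀ => (hz y₀).2.1) fun y₀ => (hz y₀).2.2.1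
  have hcmp := hoptT.2 zs qs (θ ε) hfeas
  have hV2 := hV.contDiff_two hε' ϑ
  have hB : ∀ y₀, ∀ t ∈ Icc 0 P.T, H1.rep (ys y₀) t ∈ P.stateBall M := fun y₀ t ht =>
    P.rep_mem_stateBall (hoptT.1.state_bound y₀) ht
  have hBz : ∀ y₀, ∀ t ∈ Icc 0 P.T, H1.rep (zs y₀) t ∈ P.stateBall M := fun y₀ t ht =>
    P.rep_mem_stateBall (hz y₀).1 ht
  have hV2z := hV.contDiff_two hε' (θ ε)
  -- The lower bound holds only almost everywhere, because feasibility imposes the state equation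
  -- for almost every initial value.
  have hlow : ∀ᵐ y₀ : Y₀ ∂μ, P.valueFunction 0 y₀ ≤
      P.cost 0 (H1.rep (ys y₀)) (P.approxControl (V ε ϑ) (ys y₀)) :=
    hoptT.1.state_eq.mono fun y₀ h => P.valueFunction_le_cost_of_isClosedLoop h
      (continuousOn_slice (G := fun y₀ => P.approxControl (V ε ϑ) (ys y₀))
        (P.continuous_approxControl ys hdyn hV2 hB) y₀)
  have hzc : Continuous fun y₀ =>
      P.augmentedCost γ₁ γ₂ (V ε (θ ε)) (zs y₀) (qs y₀) :=
    ((P.continuous_initial_cost zs hdyn hV2z hBz).add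
      ((P.continuous_valueMisfit zs hdyn hV2z hBz).const_mul _)).add
      ((P.continuous_gradientMisfit zs hV2z hBz qs).const_mul _)
  have hzle : ∫ y₀, wt y₀ * P.augmentedCost γ₁ γ₂ (V ε (θ ε)) (zs y₀) (qs y₀) ∂μ ≤
      (∫ y₀ : Y₀, wt y₀ * P.valueFunction 0 y₀ ∂μ) + K * ε * W := by
    rw [hW, ← integral_const_mul, ← integral_add (hI hvc) (hwtI.const_mul _)]
    refine integral_mono_ae (hI hzc) ((hI hvc).add (hwtI.const_mul _)) ?_
    filter_upwards [hwt0] with y₀ h0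
    obtain ⟨-, -, -, h1, h2, h3⟩ := hz y₀
    have h4 : P.augmentedCost γ₁ γ₂ (V ε (θ ε)) (zs y₀) (qs y₀) ≤
        P.valueFunction 0 y₀ + C * ε + γ₁ / 2 * (C * ε) + γ₂ / 2 * (C * ε) := by
      unfold ControlProblem.augmentedCost
      gcongr
    refine (mul_le_mul_of_nonneg_left h4 h0).trans_eq ?_
    simp only [hK]
    ring
  have hreg : γ ε / 2 * ‖θ ε‖ ^ 2 ≤ |D| / 2 * ε := by
    have h1 := (Real.le_norm_self _).trans hDε
    rw [Real.norm_of_nonneg hε.1.le] at h1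
    have h2 := mul_le_mul_of_nonneg_right (le_abs_self D) hε.1.le
    linarith
  have hreg0 : 0 ≤ γ ε / 2 * ‖ϑ‖ ^ 2 := by
    have := hγ ε hε'
    positivity
  -- The penalty of the optimal triple is nonnegative and is dropped; the penalty of the competitor
  -- is part of c₀ε.
  have hmain : ∫ y₀, wt y₀ * P.augmentedCost γ₁ γ₂ (V ε ϑ) (ys y₀) (ps y₀) ∂μ ≤
      (∫ y₀ : Y₀, wt y₀ * P.valueFunction 0 y₀ ∂μ) + c₀ * ε := by
    unfold ControlProblem.objective at hcmp
    rw [← hμ] at hcmp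
    have : c₀ * ε = K * ε * W + |D| / 2 * ε := by simp only [hc₀]; ring
    linarith
  obtain ⟨⟨r1, r2, r3⟩, r4⟩ := weighted_gap_bounds hγ₁ hγ₂ hwt0
    (hI (P.continuous_initial_cost ys hdyn hV2 hB)) (hI (P.continuous_valueMisfit ys hdyn hV2 hB))
    (hI (P.continuous_gradientMisfit ys hV2 hB ps)) (hI hvc) hlow
    (fun y₀ => P.valueMisfit_nonneg _ _) (fun y₀ => P.gradientMisfit_nonneg _ _ _) hmain
  have hcε : 0 ≤ c₀ * ε := mul_nonneg hc₀0 hε.1.le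
  have hfin : A * (c₀ * ε) ≤ A * (c₀ + 1) * ε := by
    have : 0 ≤ A * ε := mul_nonneg (by linarith) hε.1.le
    linarith
  refine ⟨⟨r1, r2, r3.trans ?_⟩, fun g1 g2 => ⟨(r4 g1 g2).1, (r4 g1 g2).2.trans ?_⟩⟩
  · exact (le_mul_of_one_le_left hcε hA1).trans hfin
  · refine le_trans ?_ hfin
    gcongr
    simp [hA]
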